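/- **Theorem (structure theorem).** Let $R$ be a commutative ring and $F\in R[[x,y]]$ a commutative one-dimensional formal group law. Let $\Sigma\hookrightarrow\Lambda^\vee$, $\alpha\mapsto\alpha^\vee$, be a (reduced) semi-simple root datum, with $\Sigma$ a finite subset of the lattice $\Lambda$ and with $\Lambda\otimes\mathbb Q$ spanned by $\Sigma$; let $\alpha_1,\dots,\alpha_n$ be simple roots, $s_\alpha$ the reflection in $\alpha\in\Sigma$, $s_i=s_{\alpha_i}$, and $W$ the Weyl group. For an abelian group $M$ let $R[[x_M]]$ be the completion of the polynomial ring $R[x_m\mid m\in M]$ at the ideal $(x_m)_{m\in M}$, and let $R[[M]]_F$ be the quotient of $R[[x_M]]$ by the closure of the ideal generated by $x_0$ and all $F(x_l,x_m)-x_{l+m}$. Put $S=R[[\Gamma\oplus\Lambda]]_F$ with $\Gamma=\mathbb Z\gamma$ free of rank $1$; $W$ acts on $S$ by $w(x_\gamma)=x_\gamma$, $w(x_\lambda)=x_{w\lambda}$. Let $Q^F=S[\frac1{x_\alpha}\mid\alpha\in\Sigma]$, and let $Q_W^F=\bigoplus_{w\in W}Q^F\delta_w$ be the twisted group ring, with $(u\delta_w)(u'\delta_{w'})=u\,w(u')\,\delta_{ww'}$.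 It acts on $Q^F$ by $(u\delta_w)\cdot u'=u\,w(u')$. For $\alpha\in\Sigma$ put $$X_\alpha=\tfrac1{x_\alpha}-\tfrac1{x_\alpha}\delta_{s_\alpha},\qquad T_\alpha=x_\gamma X_\alpha+\delta_{s_\alpha},\qquad X_i=X_{\alpha_i},\quad T_i=T_{\alpha_i}.$$ Let $\mathbf D_F$ (resp. $\mathbf H_F$) be the $R$-subalgebra of $Q_W^F$ generated by $S$ and $X_1,\dots,X_n$ (resp. by $S$ and $T_1,\dots,T_n$). For each $w\in W$ fix a reduced sequence $I_w=(i_1,\dots,i_k)$, $w=s_{i_1}\cdots s_{i_k}$, and put $T_{I_w}=T_{i_1}\cdots T_{i_k}$. Let $\mathfrak t$ be the torsion index of the root datum: the positive generator of the ideal $\Delta_{i_1}\circ\cdots\circ\Delta_{i_N}(\mathrm{Sym}^N_{\mathbb Z}\Lambda)\subseteq\mathbb Z$, where $(i_1,\dots,i_N)$ is a reduced sequence of the longest element of $W$ and $\Delta_i(u)=(u-s_i(u))/\alpha_i$ on $\mathrm{Sym}_{\mathbb Z}\Lambda$. Assume that $\mathfrak t$ is regular (a non-zero-divisor) in $R$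 and that, if the root datum contains an irreducible component of type $C_l^{sc}$ for some $l\ge1$ (where $C_1=A_1$, $C_2=B_2$, and $sc$ means that its lattice is its full weight lattice), then $2$ is invertible in $R$. Then, viewing $S$ in $Q^F$, 1. $\mathbf D_F=\{z\in Q_W^F\mid z\cdot S\subseteq S\}$; 2. $\mathbf H_F=\{z=\sum_{w\in W}u_wT_{I_w}\mid u_w\in Q^F\text{ for all } w,\ z\cdot S\subseteq S\}$. -/

import Mathlib

noncomputable section

namespace FormalHecke

/-! ### The formal group algebra `R⟦M⟧_F` of an abelian group `M` -/

section FormalGroupAlgebra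

variable (R : Type*) [CommRing R]

/-- The augmentation ideal of the polynomial ring `R[x_m | m ∈ M]`, i.e. the ideal `(x_m)_m`. -/
def augIdeal (M : Type*) : Ideal (MvPolynomial M R) :=
  RingHom.ker (MvPolynomial.constantCoeff : MvPolynomial M R →+* R)

/-- The ring `R⟦x_M⟧` of power series in the variables `x_m`, `m ∈ M`: the completion of the
polynomial ring at its augmentation ideal. -/
abbrev PowSeries (M : Type*) : Type _ := AdicCompletion (augIdeal R M) (MvPolynomial M R)

/-- The variable `x_m` of `R⟦x_M⟧`. -/
def variableX {M : Type*} (m : M) : PowSeries R M :=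
  AdicCompletion.of (augIdeal R M) (MvPolynomial M R) (MvPolynomial.X m)

variable {R}

lemma X_mem_augIdeal {M : Type*} (m : M) : (MvPolynomial.X m : MvPolynomial M R) ∈ augIdeal R M := by
  simp [augIdeal, RingHom.mem_ker]

lemma aeval_mem_augIdeal_pow {M : Type*} (l m : M) (n : ℕ) (p : MvPolynomial (Fin 2) R)
    (hp : ∀ d ∈ p.support, n ≤ d.degree) :
    MvPolynomial.aeval ![(MvPolynomial.X l : MvPolynomial M R), MvPolynomial.X m] p ∈
      augIdeal R M ^ n := by
  rw [MvPolynomial.aeval_def, MvPolynomial.eval₂_eq']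
  refine Ideal.sum_mem _ fun d hd => Ideal.mul_mem_left _ _ ?_
  have h := hp d hd
  have hdeg : d.degree = d 0 + d 1 := by
    rw [Finsupp.degree_eq_sum]; simp
  rw [hdeg] at h
  refine Ideal.pow_le_pow_right h ?_
  rw [Fin.prod_univ_two, pow_add]
  exact Ideal.mul_mem_mul (Ideal.pow_mem_pow (X_mem_augIdeal l) _)
    (Ideal.pow_mem_pow (X_mem_augIdeal m) _)

/-- The value `G(x_l, x_m) ∈ R⟦x_M⟧` of a power series `G` in two variables: the limit of the values
of its truncations. -/
def evalTwo {M : Type*} (G : MvPowerSeries (Fin 2) R) (l m : M) : PowSeries R M :=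
  AdicCompletion.mk (augIdeal R M) (MvPolynomial M R)
    (AdicCompletion.AdicCauchySequence.mk (augIdeal R M) (MvPolynomial M R)
      (fun n => MvPolynomial.aeval ![(MvPolynomial.X l : MvPolynomial M R), MvPolynomial.X m]
        (MvPowerSeries.truncTotal n G))
      (fun n => by
        rw [SModEq.sub_mem, ← map_sub, smul_eq_mul, Ideal.mul_top]
        refine aeval_mem_augIdeal_pow l m n _ fun d hd => ?_
        by_contra hlt
        rw [not_le] at hlt
        rw [MvPolynomial.mem_support_iff, MvPolynomial.coeff_sub,
          MvPowerSeries.coeff_truncTotal _ hlt,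
          MvPowerSeries.coeff_truncTotal _ (hlt.trans (Nat.lt_succ_self n)), sub_self] at hd
        exact hd rfl))

/-- The ideal of `R⟦x_M⟧` generated by `x_0` and the `F(x_l, x_m) - x_{l + m}`. -/
def relIdeal (F : FormalGroup R) (M : Type*) [AddCommGroup M] : Ideal (PowSeries R M) :=
  Ideal.span ({variableX R (0 : M)} ∪
    Set.range fun p : M × M => evalTwo F.toPowerSeries p.1 p.2 - variableX R (p.1 + p.2))

/-- The closure of `relIdeal F M` in the topology of the completion `R⟦x_M⟧`, for which the kernels
of `R⟦x_M⟧ → R[x_M] / (x_m)_m ^ k` are a fundamental system of neighbourhoods of `0`. -/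
def closedRelIdeal (F : FormalGroup R) (M : Type*) [AddCommGroup M] : Ideal (PowSeries R M) :=
  ⨅ k : ℕ, relIdeal F M ⊔ RingHom.ker (AdicCompletion.evalₐ (augIdeal R M) k)

/-- The formal group algebra `R⟦M⟧_F`. -/
def FGA (F : FormalGroup R) (M : Type*) [AddCommGroup M] : Type _ :=
  PowSeries R M ⧸ closedRelIdeal F M

instance (F : FormalGroup R) (M : Type*) [AddCommGroup M] : CommRing (FGA F M) :=
  inferInstanceAs (CommRing (PowSeries R M ⧸ closedRelIdeal F M))

instance (F : FormalGroup R) (M : Type*) [AddCommGroup M] : Algebra R (FGA F M) :=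
  inferInstanceAs (Algebra R (PowSeries R M ⧸ closedRelIdeal F M))

/-- The projection `R⟦x_M⟧ → R⟦M⟧_F`. -/
def FGA.proj (F : FormalGroup R) (M : Type*) [AddCommGroup M] : PowSeries R M →ₐ[R] FGA F M :=
  Ideal.Quotient.mkₐ R (closedRelIdeal F M)

lemma FGA.proj_surjective (F : FormalGroup R) (M : Type*) [AddCommGroup M] :
    Function.Surjective (FGA.proj F M) :=
  Ideal.Quotient.mkₐ_surjective R (closedRelIdeal F M)

/-- The element `x_m` of `R⟦M⟧_F`. -/
def FGA.x (F : FormalGroup R) {M : Type*} [AddCommGroup M] (m : M) : FGA F M :=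
  FGA.proj F M (variableX R m)

/-! Functoriality in `M`: an additive map `f : M → M'` induces `x_m ↦ x_{f m}`. -/

lemma augIdeal_pow_le_comap {M M' : Type*} (f : M → M') (n : ℕ) :
    augIdeal R M ^ n ≤
      (augIdeal R M' ^ n).comap (MvPolynomial.rename f : MvPolynomial M R →ₐ[R] _) := by
  refine le_trans (Ideal.pow_right_mono ?_ n) (Ideal.le_comap_pow _ n)
  intro p hp
  simpa [augIdeal, RingHom.mem_ker] using hp

/-- The map `R[x_M] / (x_m)_m ^ n → R[x_M'] / (x_m)_m ^ n` induced by `x_m ↦ x_{f m}`. -/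
def quotRename {M M' : Type*} (f : M → M') (n : ℕ) :
    (MvPolynomial M R ⧸ augIdeal R M ^ n) →ₐ[R] (MvPolynomial M' R ⧸ augIdeal R M' ^ n) :=
  Ideal.quotientMapₐ _ (MvPolynomial.rename f) (augIdeal_pow_le_comap f n)

lemma quotRename_compat {M M' : Type*} (f : M → M') {m n : ℕ} (hle : m ≤ n) :
    (Ideal.Quotient.factorₐ R (Ideal.pow_le_pow_right (I := augIdeal R M') hle)).comp
        ((quotRename f n).comp
          ((AdicCompletion.evalₐ (augIdeal R M) n).restrictScalars R)) =
      (quotRename f m).comp ((AdicCompletion.evalₐ (augIdeal R M) m).restrictScalars R) := by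
  ext a
  obtain ⟨a, rfl⟩ := AdicCompletion.mk_surjective _ _ a
  simp only [AlgHom.comp_apply, AlgHom.restrictScalars_apply, AdicCompletion.evalₐ_mk]
  rw [← AdicCompletion.Ideal.mk_eq_mk (augIdeal R M) hle a]
  rfl

/-- The continuous map `R⟦x_M⟧ → R⟦x_M'⟧` with `x_m ↦ x_{f m}`. -/
def PowSeries.rename {M M' : Type*} (f : M → M') : PowSeries R M →ₐ[R] PowSeries R M' :=
  AdicCompletion.liftAlgHom (augIdeal R M')
    (fun n => (quotRename f n).comp ((AdicCompletion.evalₐ (augIdeal R M) n).restrictScalars R))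
    (quotRename_compat f)

lemma PowSeries.evalₐ_rename {M M' : Type*} (f : M → M') (n : ℕ) (a : PowSeries R M) :
    AdicCompletion.evalₐ (augIdeal R M') n (PowSeries.rename f a) =
      quotRename f n (AdicCompletion.evalₐ (augIdeal R M) n a) :=
  AdicCompletion.evalₐ_liftAlgHom (augIdeal R M') _ (quotRename_compat f) n a

lemma PowSeries.rename_mk {M M' : Type*} (f : M → M')
    (a : AdicCompletion.AdicCauchySequence (augIdeal R M) (MvPolynomial M R))
    (b : AdicCompletion.AdicCauchySequence (augIdeal R M') (MvPolynomial M' R))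
    (hab : ∀ n, MvPolynomial.rename f (a n) = b n) :
    PowSeries.rename f (AdicCompletion.mk _ _ a) = AdicCompletion.mk _ _ b := by
  refine AdicCompletion.ext_evalₐ fun n => ?_
  rw [PowSeries.evalₐ_rename, AdicCompletion.evalₐ_mk, AdicCompletion.evalₐ_mk, ← hab]
  rfl

lemma PowSeries.rename_variableX {M M' : Type*} (f : M → M') (m : M) :
    PowSeries.rename f (variableX R m) = variableX R (f m) := by
  refine AdicCompletion.ext_evalₐ fun n => ?_
  rw [PowSeries.evalₐ_rename, variableX, variableX, AdicCompletion.evalₐ_of,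
    AdicCompletion.evalₐ_of, ← MvPolynomial.rename_X (R := R) f m]
  rfl

lemma PowSeries.rename_evalTwo {M M' : Type*} (f : M → M') (G : MvPowerSeries (Fin 2) R)
    (l m : M) : PowSeries.rename f (evalTwo G l m) = evalTwo G (f l) (f m) := by
  refine PowSeries.rename_mk f _ _ fun n => ?_
  change MvPolynomial.rename f (MvPolynomial.aeval _ _) = MvPolynomial.aeval _ _
  rw [← AlgHom.comp_apply]
  congr 1
  ext i
  fin_cases i <;> simp

lemma PowSeries.rename_id (M : Type*) (a : PowSeries R M) : PowSeries.rename id a = a := by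
  obtain ⟨a, rfl⟩ := AdicCompletion.mk_surjective _ _ a
  exact PowSeries.rename_mk id a a fun n => by simp

lemma PowSeries.rename_rename {M M' M'' : Type*} (f : M → M') (g : M' → M'') (a : PowSeries R M) :
    PowSeries.rename g (PowSeries.rename f a) = PowSeries.rename (g ∘ f) a := by
  refine AdicCompletion.ext_evalₐ fun n => ?_
  simp only [PowSeries.evalₐ_rename]
  obtain ⟨p, hp⟩ := Ideal.Quotient.mk_surjective (AdicCompletion.evalₐ (augIdeal R M) n a)
  rw [← hp]
  change Ideal.Quotient.mk _ (MvPolynomial.rename g (MvPolynomial.rename f p)) =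
    Ideal.Quotient.mk _ (MvPolynomial.rename (g ∘ f) p)
  rw [MvPolynomial.rename_rename]

section

variable {M M' M'' : Type*} [AddCommGroup M] [AddCommGroup M'] [AddCommGroup M'']

lemma relIdeal_le_comap (F : FormalGroup R) (f : M →+ M') :
    relIdeal F M ≤ (relIdeal F M').comap (PowSeries.rename (R := R) f) := by
  rw [relIdeal, Ideal.span_le]
  rintro _ (h | ⟨p, rfl⟩)
  · rw [Set.mem_singleton_iff] at h
    subst h
    simp only [SetLike.mem_coe, Ideal.mem_comap, PowSeries.rename_variableX, map_zero]
    exact Ideal.subset_span (Or.inl rfl)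
  · simp only [SetLike.mem_coe, Ideal.mem_comap, map_sub, PowSeries.rename_variableX, map_add,
      PowSeries.rename_evalTwo]
    exact Ideal.subset_span (Or.inr ⟨(f p.1, f p.2), rfl⟩)

lemma closedRelIdeal_le_comap (F : FormalGroup R) (f : M →+ M') :
    closedRelIdeal F M ≤ (closedRelIdeal F M').comap (PowSeries.rename (R := R) f) := by
  intro a ha
  rw [closedRelIdeal, Ideal.mem_iInf] at ha
  rw [Ideal.mem_comap, closedRelIdeal, Ideal.mem_iInf]
  intro k
  obtain ⟨b, hb, c, hc, rfl⟩ := Submodule.mem_sup.mp (ha k)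
  rw [map_add]
  refine Submodule.add_mem_sup (relIdeal_le_comap F f hb) ?_
  rw [RingHom.mem_ker] at hc ⊢
  rw [PowSeries.evalₐ_rename, hc, map_zero]

/-- The map `R⟦M⟧_F → R⟦M'⟧_F`, `x_m ↦ x_{f m}`, induced by an additive map `f : M → M'`. -/
def FGA.map (F : FormalGroup R) (f : M →+ M') : FGA F M →ₐ[R] FGA F M' :=
  Ideal.quotientMapₐ (closedRelIdeal F M') (PowSeries.rename f) (closedRelIdeal_le_comap F f)

lemma FGA.map_proj (F : FormalGroup R) (f : M →+ M') (a : PowSeries R M) :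
    FGA.map F f (FGA.proj F M a) = FGA.proj F M' (PowSeries.rename f a) := rfl

lemma FGA.map_x (F : FormalGroup R) (f : M →+ M') (m : M) :
    FGA.map F f (FGA.x F m) = FGA.x F (f m) := by
  rw [FGA.x, FGA.map_proj, PowSeries.rename_variableX, FGA.x]

lemma FGA.map_id (F : FormalGroup R) (a : FGA F M) : FGA.map F (AddMonoidHom.id M) a = a := by
  obtain ⟨a, rfl⟩ := FGA.proj_surjective F M a
  rw [FGA.map_proj]
  exact congrArg _ (PowSeries.rename_id M a)

lemma FGA.map_map (F : FormalGroup R) (f : M →+ M') (g : M' →+ M'') (a : FGA F M) :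
    FGA.map F g (FGA.map F f a) = FGA.map F (g.comp f) a := by
  obtain ⟨a, rfl⟩ := FGA.proj_surjective F M a
  rw [FGA.map_proj, FGA.map_proj, FGA.map_proj, PowSeries.rename_rename]
  rfl

end

end FormalGroupAlgebra

/-! ### Root data -/

section RootDatum

variable {ι Λ Λv : Type*} [AddCommGroup Λ] [AddCommGroup Λv] (P : RootPairing ι ℤ Λ Λv)

/-- A root datum is semi-simple if `Λ_r ⊗ ℚ = Λ ⊗ ℚ`: every element of `Λ` has a nonzero multiple
in the root lattice. -/
def IsSemisimple : Prop :=
  ∀ l : Λ, ∃ k : ℤ, k ≠ 0 ∧ k • l ∈ Submodule.span ℤ (Set.range P.root)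

variable {P}

/-- The product `s_{i_1} ⋯ s_{i_k}` of simple reflections attached to a sequence of simple roots. -/
def wordProd (b : P.Base) (I : List b.support) : P.weylGroup :=
  (I.map fun i => RootPairing.weylGroup.ofIdx P i).prod

/-- `I` is a reduced sequence of `w`. -/
def IsReducedWord (b : P.Base) (w : P.weylGroup) (I : List b.support) : Prop :=
  wordProd b I = w ∧ ∀ J : List b.support, wordProd b J = w → I.length ≤ J.length

/-- The root datum contains an irreducible component of type `C_l^{sc}` for some `l ≥ 1`
(where `C_1 = A_1` and `C_2 = B_2`). That is: some simple roots, numbered by `Fin l`, have the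
Cartan matrix of type `C_l` and are orthogonal to all other simple roots, and the fundamental weights
of this component lie in `Λ`. -/
def HasComponentCsc (b : P.Base) : Prop :=
  ∃ (l : ℕ) (_ : 1 ≤ l) (f : Fin l ↪ b.support),
    (∀ i j, P.pairing (f i) (f j) = CartanMatrix.C l i j) ∧
    (∀ i, ∀ k : b.support, k ∉ Set.range f → P.pairing (f i) k = 0) ∧
    ∃ ω : Fin l → Λ, ∀ j, P.toLinearMap (ω j) (P.coroot (f j)) = 1 ∧
      ∀ k : b.support, k ≠ f j → P.toLinearMap (ω j) (P.coroot k) = 0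

/-! The torsion index. -/

variable (P)

/-- The action of the reflection `s_i` on the symmetric algebra of `Λ`. -/
def symReflection (i : ι) : SymmetricAlgebra ℤ Λ →ₐ[ℤ] SymmetricAlgebra ℤ Λ :=
  SymmetricAlgebra.lift (SymmetricAlgebra.ι ℤ Λ ∘ₗ (P.reflection i : Λ →ₗ[ℤ] Λ))

lemma exists_symDemazure (i : ι) (u : SymmetricAlgebra ℤ Λ) :
    ∃ v, SymmetricAlgebra.ι ℤ Λ (P.root i) * v = u - symReflection P i u := by
  induction u using SymmetricAlgebra.induction with
  | algebraMap r => exact ⟨0, by simp⟩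
  | ι l =>
    refine ⟨algebraMap ℤ _ (P.toLinearMap l (P.coroot i)), ?_⟩
    rw [symReflection, SymmetricAlgebra.lift_ι_apply, LinearMap.comp_apply, ← map_sub,
      mul_comm, ← Algebra.smul_def, ← map_smul]
    congr 1
    simp [RootPairing.reflection_apply]
  | mul a c ha hc =>
    obtain ⟨v, hv⟩ := ha
    obtain ⟨v', hv'⟩ := hc
    refine ⟨v * c + symReflection P i a * v', ?_⟩
    rw [map_mul, mul_add, ← mul_assoc, hv, mul_left_comm, hv']
    ring
  | add a c ha hc =>
    obtain ⟨v, hv⟩ := ha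
    obtain ⟨v', hv'⟩ := hc
    refine ⟨v + v', ?_⟩
    rw [mul_add, hv, hv', map_add]
    ring

/-- The Demazure operator `u ↦ (u - s_i u) / α_i` on the symmetric algebra of `Λ`. -/
def symDemazure (i : ι) (u : SymmetricAlgebra ℤ Λ) : SymmetricAlgebra ℤ Λ :=
  Classical.choose (exists_symDemazure P i u)

variable {P}

/-- The composite `Δ_{i_1} ∘ ⋯ ∘ Δ_{i_k}` of Demazure operators on the symmetric algebra of `Λ`. -/
def symDemazureWord (b : P.Base) (I : List b.support) (u : SymmetricAlgebra ℤ Λ) :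
    SymmetricAlgebra ℤ Λ :=
  I.foldr (fun i v => symDemazure P i v) u

/-- The torsion index of the root datum: the non-negative generator of the ideal
`Δ_I (S^N(Λ)) ⊆ ℤ`, where `I` is a reduced sequence of the longest element of the Weyl group and
`N` is the length of `I`. (It does not depend on the choice of simple roots and of `I`.) -/
def torsionIndex (b : P.Base) (I : List b.support) : ℕ :=
  (Submodule.IsPrincipal.generator (Ideal.span {d : ℤ |
    ∃ u ∈ (LinearMap.range (SymmetricAlgebra.ι ℤ Λ)) ^ I.length,
      symDemazureWord b I u = algebraMap ℤ (SymmetricAlgebra ℤ Λ) d})).natAbs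

end RootDatum

/-! ### The twisted formal group algebra, the Demazure algebra and the Hecke algebra -/

section Hecke

variable {R : Type*} [CommRing R] (F : FormalGroup R)
variable {ι Λ Λv : Type*} [AddCommGroup Λ] [AddCommGroup Λv] (P : RootPairing ι ℤ Λ Λv)

/-- `S = R⟦Γ ⊕ Λ⟧_F`, where `Γ = ℤ`, with generator `γ = 1`, carries the trivial action of the Weyl
group. -/
def S (_P : RootPairing ι ℤ Λ Λv) : Type _ := FGA F (ℤ × Λ)

instance : CommRing (S F P) := inferInstanceAs (CommRing (FGA F (ℤ × Λ)))

instance : Algebra R (S F P) := inferInstanceAs (Algebra R (FGA F (ℤ × Λ)))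

/-- `x_λ ∈ S` for `λ ∈ Γ ⊕ Λ`. -/
def S.x (l : ℤ × Λ) : S F P := FGA.x F l

/-- The action of `w` on `Γ ⊕ Λ`. -/
def weylHom (w : P.weylGroup) : ℤ × Λ →+ ℤ × Λ :=
  AddMonoidHom.prodMap (AddMonoidHom.id ℤ) (DistribSMul.toAddMonoidHom Λ w)

/-- The Weyl group acts on `S` by `w x_{(n, λ)} = x_{(n, w λ)}`. -/
instance : MulSemiringAction P.weylGroup (S F P) where
  smul w u := FGA.map F (weylHom P w) u
  one_smul u := by
    change FGA.map F (weylHom P 1) u = u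
    have h : weylHom P 1 = AddMonoidHom.id _ := by ext l <;> simp [weylHom]
    rw [h]
    exact FGA.map_id F u
  mul_smul w w' u := by
    change FGA.map F (weylHom P (w * w')) u = FGA.map F (weylHom P w) (FGA.map F (weylHom P w') u)
    have h : weylHom P (w * w') = (weylHom P w).comp (weylHom P w') := by
      ext l <;> simp [weylHom, mul_smul]
    rw [h]
    exact (FGA.map_map F (weylHom P w') (weylHom P w) u).symm
  smul_zero w := map_zero (FGA.map F (weylHom P w))
  smul_add w := map_add (FGA.map F (weylHom P w))
  smul_one w := map_one (FGA.map F (weylHom P w))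
  smul_mul w := map_mul (FGA.map F (weylHom P w))

lemma S.smul_x (w : P.weylGroup) (l : ℤ × Λ) : w • S.x F P l = S.x F P (l.1, w • l.2) :=
  FGA.map_x F (weylHom P w) l

lemma S.smul_algebraMap (w : P.weylGroup) (r : R) :
    w • algebraMap R (S F P) r = algebraMap R (S F P) r :=
  (FGA.map F (weylHom P w)).commutes r

/-- The element `x_α ∈ S` for the root `α` with index `i`. -/
def S.xRoot (i : ι) : S F P := S.x F P (0, P.root i)

/-- The element `x_γ ∈ S`. -/
def S.xGamma : S F P := S.x F P (1, 0)

lemma S.smul_xRoot (w : P.weylGroup) (i : ι) :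
    w • S.xRoot F P i = S.xRoot F P (P.weylGroupToPerm w i) := by
  rw [S.xRoot, S.smul_x, RootPairing.weylGroup_apply_root, S.xRoot]

/-- The multiplicative subset of `S` generated by the `x_α`, `α ∈ Σ`. -/
def rootSubmonoid : Submonoid (S F P) := Submonoid.closure (Set.range (S.xRoot F P))

/-- `Q = S[1 / x_α | α ∈ Σ]`. -/
def Q : Type _ := Localization (rootSubmonoid F P)

instance : CommRing (Q F P) := inferInstanceAs (CommRing (Localization (rootSubmonoid F P)))

instance : Algebra (S F P) (Q F P) :=
  inferInstanceAs (Algebra (S F P) (Localization (rootSubmonoid F P)))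

instance : IsLocalization (rootSubmonoid F P) (Q F P) :=
  inferInstanceAs (IsLocalization (rootSubmonoid F P) (Localization (rootSubmonoid F P)))

instance : Algebra R (Q F P) := ((algebraMap (S F P) (Q F P)).comp (algebraMap R (S F P))).toAlgebra

instance : IsScalarTower R (S F P) (Q F P) := IsScalarTower.of_algebraMap_eq fun _ => rfl

lemma rootSubmonoid_le_comap (w : P.weylGroup) :
    rootSubmonoid F P ≤
      (rootSubmonoid F P).comap (MulSemiringAction.toRingHom P.weylGroup (S F P) w) := by
  rw [rootSubmonoid, Submonoid.closure_le]
  rintro _ ⟨i, rfl⟩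
  rw [SetLike.mem_coe, Submonoid.mem_comap, MulSemiringAction.toRingHom_apply, S.smul_xRoot]
  exact Submonoid.subset_closure ⟨_, rfl⟩

/-- The ring homomorphism `Q → Q` that extends the action of `w` on `S`. -/
def Q.weylMap (w : P.weylGroup) : Q F P →+* Q F P :=
  IsLocalization.map (Q F P) (MulSemiringAction.toRingHom P.weylGroup (S F P) w)
    (rootSubmonoid_le_comap F P w)

lemma Q.weylMap_algebraMap (w : P.weylGroup) (u : S F P) :
    Q.weylMap F P w (algebraMap (S F P) (Q F P) u) = algebraMap (S F P) (Q F P) (w • u) :=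
  IsLocalization.map_eq (rootSubmonoid_le_comap F P w) u

/-- The action of the Weyl group on `Q` that extends the one on `S`. -/
instance : MulSemiringAction P.weylGroup (Q F P) where
  smul w q := Q.weylMap F P w q
  one_smul q := by
    change Q.weylMap F P 1 q = RingHom.id _ q
    congr 1
    refine IsLocalization.ringHom_ext (rootSubmonoid F P) (RingHom.ext fun u => ?_)
    simp [Q.weylMap_algebraMap]
  mul_smul w w' q := by
    change Q.weylMap F P (w * w') q = ((Q.weylMap F P w).comp (Q.weylMap F P w')) q
    congr 1
    refine IsLocalization.ringHom_ext (rootSubmonoid F P) (RingHom.ext fun u => ?_)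
    simp [Q.weylMap_algebraMap, mul_smul]
  smul_zero w := map_zero (Q.weylMap F P w)
  smul_add w := map_add (Q.weylMap F P w)
  smul_one w := map_one (Q.weylMap F P w)
  smul_mul w := map_mul (Q.weylMap F P w)

lemma Q.smul_algebraMap (w : P.weylGroup) (u : S F P) :
    w • algebraMap (S F P) (Q F P) u = algebraMap (S F P) (Q F P) (w • u) :=
  Q.weylMap_algebraMap F P w u

instance : SMulCommClass P.weylGroup R (Q F P) where
  smul_comm w r q := by
    rw [Algebra.smul_def, Algebra.smul_def, smul_mul', IsScalarTower.algebraMap_apply R (S F P),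
      Q.smul_algebraMap, S.smul_algebraMap]

/-- The twisted formal group algebra `Q_W`: the elements are the formal sums `∑ q_w δ_w`, where
`q δ_w` is `SkewMonoidAlgebra.single w q`, and `(q δ_w) (q' δ_w') = q w(q') δ_{w w'}`. -/
abbrev QW : Type _ := SkewMonoidAlgebra (Q F P) P.weylGroup

/-- The embedding `S → Q_W`, `u ↦ u δ_1` (through `Q`). -/
def ofS (u : S F P) : QW F P := SkewMonoidAlgebra.single 1 (algebraMap (S F P) (Q F P) u)

/-- `1 / x_α ∈ Q`. -/
def invRoot (i : ι) : Q F P :=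
  IsLocalization.mk' (Q F P) (1 : S F P)
    (⟨S.xRoot F P i, Submonoid.subset_closure ⟨i, rfl⟩⟩ : rootSubmonoid F P)

/-- The action of `Q_W` on `Q`: `(q δ_w) · u = q w(u)`. -/
def act (z : QW F P) (u : Q F P) : Q F P := z.sum fun w q => q * w • u

/-- The element `δ_α ∈ Q_W`. -/
def deltaElt (i : ι) : QW F P := SkewMonoidAlgebra.single (RootPairing.weylGroup.ofIdx P i) 1

/-- The formal Demazure element `X_α = 1 / x_α - (1 / x_α) δ_α`. -/
def XElt (i : ι) : QW F P :=
  SkewMonoidAlgebra.single 1 (invRoot F P i) -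
    SkewMonoidAlgebra.single 1 (invRoot F P i) * deltaElt F P i

/-- The Demazure-Lusztig element `T_α = x_γ X_α + δ_α`. -/
def TElt (i : ι) : QW F P := ofS F P (S.xGamma F P) * XElt F P i + deltaElt F P i

variable {P}

/-- `T_I = T_{i_1} ⋯ T_{i_k}`. -/
def TWord (b : P.Base) (I : List b.support) : QW F P := (I.map fun i => TElt F P i).prod

/-- The formal affine Demazure algebra: the `R`-subalgebra of `Q_W` generated by `S` and the `X_i`. -/
def demazureAlgebra (b : P.Base) : Subalgebra R (QW F P) :=
  Algebra.adjoin R (Set.range (ofS F P) ∪ Set.range fun i : b.support => XElt F P i)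

/-- The formal affine Hecke algebra: the `R`-subalgebra of `Q_W` generated by `S` and the `T_i`. -/
def heckeAlgebra (b : P.Base) : Subalgebra R (QW F P) :=
  Algebra.adjoin R (Set.range (ofS F P) ∪ Set.range fun i : b.support => TElt F P i)

/-- `z · S ⊆ S`, where `S` is viewed in `Q`. -/
def PreservesS (z : QW F P) : Prop :=
  ∀ u : S F P, act F P z (algebraMap (S F P) (Q F P) u) ∈ Set.range (algebraMap (S F P) (Q F P))

end Hecke

end FormalHecke

end

/-! The generators preserve `S`: X_α acts as the formal Demazure operator u ↦ (u - s_α u)/x_α, and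
T_α = 1 + (x_γ - x_α) X_α. This gives the easy inclusions; the content is the converse.

Arithmetic of S. A basis of Γ ⊕ Λ turns S into a power series ring over R (`FGA.equiv`), in which
the basis elements give the variables and x_λ is the linear form of λ up to order two. A root is a
basis vector or twice one (`exists_basis_root`). In the second case there is a component of type
C_l^sc (`hasComponentCsc_of_root_eq_add_self`), so 2 is invertible and x_{2e} = x_e (2 + ...) is
still x_e up to a unit. Hence each x_α is a variable up to a unit: it is regular, it divides u - s_α
u, and divisibility by it is tested by setting one variable to zero. Moreover x_γ - x_α is a unit
times x_{γ-α}, and γ - α completes any basis of Λ to one of Γ ⊕ Λ, so x_γ - x_α can be cancelled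
against every x_β in divisibilities.

Demazure algebra. With respect to the δ_w and the length, the X_{I_w} are triangular with diagonal
invertible in Q, so z = ∑ q_w X_{I_w}. If z preserves S and s is a common denominator, with s q_w =
c_w, then s divides ∑ c_w Δ_{I_w}(u) for every u in S. Take u = Δ_{I_{v⁻¹w₀}}(u₀), where u₀ lifts an
element of Sym^N Λ at which the torsion index is attained up to sign. The leading terms of the
formal operators are the Demazure operators on Sym Λ, where the composite along a word depends only
on its length and product and vanishes if the word is not reduced. So the matrix indexed by (w, v)
is, modulo the augmentation ideal, triangular with plus or minus the torsion index on the diagonal.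
Its determinant has regular constant term, and Cramer's rule gives s ∣ c_w
(`S.dvd_of_forall_dvd_sum`), that is, q_w ∈ S.

Hecke algebra. The coefficient of δ_w in T_{I_w} is a product of factors 1 - x_γ/x_β, which need not
be units in Q. The Q-span of the T_{I_w} consists of the elements whose coefficients are divisible
by these products (`IsLeadingDivisible.exists_eq_sum`). Expand z in both families and compare the
coefficients of δ_w for w of maximal length: u_w ∏ (x_γ - x_β) equals the X-coefficient, which is in
S, so u_w is in S. Subtracting the top terms and inducting on the length finishes the proof
(`mem_heckeAlgebra_of_preservesS`). -/

noncomputable section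

open MvPowerSeries Finsupp

namespace FormalHecke

/-! ### The order filtration on power series rings. -/

section OrderIdeal

variable {R : Type*} [CommRing R] {σ τ : Type*}

/-- The ideal of power series all of whose monomials have degree at least `n`. -/
def orderIdeal (σ R : Type*) [CommRing R] (n : ℕ) : Ideal (MvPowerSeries σ R) where
  carrier := {f | ∀ d : σ →₀ ℕ, degree d < n → coeff d f = 0}
  add_mem' hf hg d hd := by rw [map_add, hf d hd, hg d hd, add_zero]
  zero_mem' d _ := map_zero _
  smul_mem' c f hf d hd := by
    classical
    rw [smul_eq_mul, coeff_mul]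
    refine Finset.sum_eq_zero fun p hp => ?_
    rw [Finset.HasAntidiagonal.mem_antidiagonal] at hp
    have : degree p.1 + degree p.2 = degree d := by rw [← hp, map_add]
    rw [hf p.2 (by omega), mul_zero]

lemma mem_orderIdeal_zero (f : MvPowerSeries σ R) : f ∈ orderIdeal σ R 0 :=
  fun _ h => absurd h (Nat.not_lt_zero _)

lemma orderIdeal_anti {m n : ℕ} (h : m ≤ n) : orderIdeal σ R n ≤ orderIdeal σ R m :=
  fun _ hf d hd => hf d (hd.trans_le h)

lemma mul_mem_orderIdeal {m n : ℕ} {f g : MvPowerSeries σ R} (hf : f ∈ orderIdeal σ R m)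
    (hg : g ∈ orderIdeal σ R n) : f * g ∈ orderIdeal σ R (m + n) := by
  classical
  intro d hd
  rw [coeff_mul]
  refine Finset.sum_eq_zero fun p hp => ?_
  rw [Finset.HasAntidiagonal.mem_antidiagonal] at hp
  have : degree p.1 + degree p.2 = degree d := by rw [← hp, map_add]
  by_cases h1 : degree p.1 < m
  · rw [hf p.1 h1, zero_mul]
  · rw [hg p.2 (by omega), mul_zero]

lemma mem_orderIdeal_one {f : MvPowerSeries σ R} :
    f ∈ orderIdeal σ R 1 ↔ constantCoeff f = 0 := by
  refine ⟨fun h => by simpa using h 0 (by simp), fun h d hd => ?_⟩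
  have : d = 0 := (degree_eq_zero_iff d).1 (Nat.lt_one_iff.1 hd)
  rw [this, coeff_zero_eq_constantCoeff_apply, h]

lemma X_mem_orderIdeal (s : σ) : (X s : MvPowerSeries σ R) ∈ orderIdeal σ R 1 :=
  mem_orderIdeal_one.2 (by simp)

lemma eq_zero_of_forall_mem_orderIdeal {f : MvPowerSeries σ R} (h : ∀ n, f ∈ orderIdeal σ R n) :
    f = 0 := by
  ext d
  exact h (degree d + 1) d (Nat.lt_succ_self _)

lemma truncTotal_eq_truncTotal_iff [Finite σ] {n : ℕ} {f g : MvPowerSeries σ R} :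
    truncTotal n f = truncTotal n g ↔ f - g ∈ orderIdeal σ R n := by
  constructor
  · intro h d hd
    rw [map_sub, ← coeff_truncTotal f hd, ← coeff_truncTotal g hd, h, sub_self]
  · intro h
    ext d
    by_cases hd : degree d < n
    · rw [coeff_truncTotal _ hd, coeff_truncTotal _ hd, ← sub_eq_zero, ← map_sub, h d hd]
    · rw [coeff_truncTotal_eq_zero _ (by omega), coeff_truncTotal_eq_zero _ (by omega)]

lemma sub_truncTotal_mem_orderIdeal [Finite σ] (n : ℕ) (f : MvPowerSeries σ R) :
    f - (truncTotal n f : MvPowerSeries σ R) ∈ orderIdeal σ R n := by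
  intro d hd
  rw [map_sub, MvPolynomial.coeff_coe, coeff_truncTotal _ hd, sub_self]

lemma subst_sub_subst_mem_orderIdeal [Finite σ] [Finite τ] {n : ℕ} {a a' : τ → MvPowerSeries σ R}
    (f : MvPowerSeries τ R)
    (ha : ∀ i, constantCoeff (a i) = 0) (ha' : ∀ i, constantCoeff (a' i) = 0)
    (h : ∀ i, a i - a' i ∈ orderIdeal σ R n) : f.subst a - f.subst a' ∈ orderIdeal σ R n := by
  rw [← truncTotal_eq_truncTotal_iff, truncTotal_subst ha, truncTotal_subst ha']
  simp_rw [truncTotal_eq_truncTotal_iff.2 (h _)]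

/-- Completeness for the order filtration; it provides the limit of the iteration that constructs
formal inverses. -/
lemma exists_sub_mem_orderIdeal (g : ℕ → MvPowerSeries σ R)
    (hg : ∀ n, g (n + 1) - g n ∈ orderIdeal σ R n) :
    ∃ f, ∀ n, f - g n ∈ orderIdeal σ R n := by
  have key : ∀ n k, g (n + k) - g n ∈ orderIdeal σ R n := by
    intro n k
    induction k with
    | zero => simp
    | succ k ih =>
      have := (orderIdeal σ R n).add_mem (orderIdeal_anti (Nat.le_add_right n k) (hg (n + k))) ih
      rwa [sub_add_sub_cancel] at this
  -- The coefficient at d no longer changes from index degree d + 1 on.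
  refine ⟨(fun d => coeff d (g (degree d + 1)) : MvPowerSeries σ R), fun n d hd => ?_⟩
  have h1 : coeff d (g n) = coeff d (g (degree d + 1)) := by
    obtain ⟨k, rfl⟩ := Nat.exists_eq_add_of_le (Nat.succ_le_of_lt hd)
    rw [← sub_eq_zero, ← map_sub]
    exact key _ k d (Nat.lt_succ_self _)
  change coeff d (g (degree d + 1)) - coeff d (g n) = 0
  rw [h1, sub_self]

end OrderIdeal

/-! ### Formal group laws: shape, inverses and the group of points. -/

section Points

variable {R : Type*} [CommRing R] (F : FormalGroup R) {σ : Type*}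

lemma hasSubst_of_constantCoeff {f : MvPowerSeries σ R} (hf : constantCoeff f = 0) :
    PowerSeries.HasSubst f := PowerSeries.HasSubst.of_constantCoeff_zero hf

lemma constantCoeff_cons {f g : MvPowerSeries σ R} (hf : constantCoeff f = 0)
    (hg : constantCoeff g = 0) (i : Fin 2) : constantCoeff (![f, g] i) = 0 := by
  fin_cases i
  · exact hf
  · exact hg

lemma constantCoeff_subst_formalGroup {f g : MvPowerSeries σ R} (hf : constantCoeff f = 0)
    (hg : constantCoeff g = 0) : constantCoeff (F.toPowerSeries.subst ![f, g]) = 0 :=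
  constantCoeff_subst_eq_zero (hasSubst_of_constantCoeff_zero (constantCoeff_cons hf hg))
    (constantCoeff_cons hf hg) F.zero_constantCoeff

/-- A formal group law has the form `X + Y + X Y H`. -/
lemma exists_formalGroup_eq : ∃ H : MvPowerSeries (Fin 2) R,
    F.toPowerSeries = X 0 + X 1 + X 0 * X 1 * H := by
  have h0 : ∀ m : Fin 2 →₀ ℕ, m 1 = 0 → coeff m (F.toPowerSeries - X 0) = 0 := by
    intro m hm
    have h : F.toPowerSeries.subst ![(X 0 : MvPowerSeries (Fin 2) R), 0] = X 0 :=
      F.add_zero (hasSubst_of_constantCoeff (constantCoeff_X (0 : Fin 2)))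
    rw [map_sub, sub_eq_zero]
    refine Eq.trans ?_ (congrArg (coeff m) h)
    rw [coeff_subst HasSubst.X_zero, finsum_eq_single _ m]
    · rw [Finsupp.prod_fintype _ _ (by simp), Fin.prod_univ_two]
      simp only [Matrix.cons_val_zero, Matrix.cons_val_one, hm, pow_zero, mul_one]
      rw [coeff_X_pow, if_pos, smul_eq_mul, mul_one]
      ext i; fin_cases i <;> simp [hm]
    · intro d hd
      rw [Finsupp.prod_fintype _ _ (by simp), Fin.prod_univ_two]
      simp only [Matrix.cons_val_zero, Matrix.cons_val_one]
      rcases Nat.eq_zero_or_pos (d 1) with h1 | h1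
      · rw [h1, pow_zero, mul_one, coeff_X_pow, if_neg, smul_zero]
        rintro rfl
        exact hd (by ext i; fin_cases i <;> simp [h1])
      · rw [zero_pow h1.ne', mul_zero, map_zero, smul_zero]
  have h1 : ∀ m : Fin 2 →₀ ℕ, m 0 = 0 → coeff m (F.toPowerSeries - X 1) = 0 := by
    intro m hm
    have h : F.toPowerSeries.subst ![0, (X 1 : MvPowerSeries (Fin 2) R)] = X 1 :=
      F.zero_add (hasSubst_of_constantCoeff (constantCoeff_X (1 : Fin 2)))
    rw [map_sub, sub_eq_zero]
    refine Eq.trans ?_ (congrArg (coeff m) h)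
    rw [coeff_subst HasSubst.zero_X, finsum_eq_single _ m]
    · rw [Finsupp.prod_fintype _ _ (by simp), Fin.prod_univ_two]
      simp only [Matrix.cons_val_zero, Matrix.cons_val_one, hm, pow_zero, one_mul]
      rw [coeff_X_pow, if_pos, smul_eq_mul, mul_one]
      ext i; fin_cases i <;> simp [hm]
    · intro d hd
      rw [Finsupp.prod_fintype _ _ (by simp), Fin.prod_univ_two]
      simp only [Matrix.cons_val_zero, Matrix.cons_val_one]
      rcases Nat.eq_zero_or_pos (d 0) with h1 | h1
      · rw [h1, pow_zero, one_mul, coeff_X_pow, if_neg, smul_zero]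
        rintro rfl
        exact hd (by ext i; fin_cases i <;> simp [h1])
      · rw [zero_pow h1.ne', zero_mul, map_zero, smul_zero]
  obtain ⟨A, hA⟩ := X_dvd_iff.2 h0
  have h2 : ∀ m : Fin 2 →₀ ℕ, m 0 = 0 → coeff m (A - 1) = 0 := by
    intro m hm
    -- F - X 1 = X 0 + X 1 (A - 1), and X 0 does not contribute at an exponent free of X 0; the
    -- shift by X 1 therefore reads off A - 1.
    have := h1 (single 1 1 + m) (by simp [hm])
    rw [sub_eq_iff_eq_add.1 hA, show (X 1 * A + X 0 - X 1 : MvPowerSeries (Fin 2) R)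
      = X 0 + X 1 * (A - 1) by ring, map_add, coeff_X, if_neg, zero_add, X,
      coeff_add_monomial_mul, one_mul] at this
    · exact this
    · intro h
      simpa [hm] using DFunLike.congr_fun h 0
  obtain ⟨H, hH⟩ := X_dvd_iff.2 h2
  refine ⟨H, ?_⟩
  rw [sub_eq_iff_eq_add.1 hA, sub_eq_iff_eq_add.1 hH]
  ring

lemma exists_subst_formalGroup_eq {f g : MvPowerSeries σ R} (hf : constantCoeff f = 0)
    (hg : constantCoeff g = 0) :
    ∃ h, F.toPowerSeries.subst ![f, g] = f + g + f * g * h := by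
  obtain ⟨H, hH⟩ := exists_formalGroup_eq F
  have hs := hasSubst_of_constantCoeff_zero (constantCoeff_cons hf hg)
  refine ⟨H.subst ![f, g], ?_⟩
  rw [hH, subst_add hs, subst_add hs, subst_mul hs, subst_mul hs, subst_X hs, subst_X hs]
  rfl

/-- Correct an approximate inverse g by adding, in the sense of F, the ordinary negative of the
error r = F(f, g). By associativity the new error is F(r, -r) = -r² h, because F = X + Y + X Y H, so
the order of the error grows and the iteration converges. -/
lemma exists_formalGroup_neg [Finite σ] {f : MvPowerSeries σ R} (hf : constantCoeff f = 0) :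
    ∃ g : MvPowerSeries σ R, constantCoeff g = 0 ∧ F.toPowerSeries.subst ![f, g] = 0 := by
  classical
  set G : MvPowerSeries σ R → MvPowerSeries σ R → MvPowerSeries σ R :=
    fun a b => F.toPowerSeries.subst ![a, b] with hG
  let g : ℕ → MvPowerSeries σ R := fun n => n.rec 0 fun _ a => G a (-G f a)
  have hg : ∀ n, g (n + 1) = G (g n) (-G f (g n)) := fun _ => rfl
  have hc : ∀ n, constantCoeff (g n) = 0 := by
    intro n
    induction n with
    | zero => exact map_zero _
    | succ n ih =>
      exact constantCoeff_subst_formalGroup F ih (by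
        rw [map_neg, constantCoeff_subst_formalGroup F hf ih, neg_zero])
  have hr : ∀ n, G f (g n) ∈ orderIdeal σ R (n + 1) := by
    intro n
    induction n with
    | zero => exact mem_orderIdeal_one.2 (constantCoeff_subst_formalGroup F hf (hc 0))
    | succ n ih =>
      have h1 := mem_orderIdeal_one.1 (orderIdeal_anti (Nat.le_add_left 1 n) ih)
      have h2 : constantCoeff (-G f (g n)) = 0 := by rw [map_neg, h1, neg_zero]
      have h3 : G f (g (n + 1)) = G (G f (g n)) (-G f (g n)) := by
        rw [hg]
        exact (F.assoc' (hasSubst_of_constantCoeff hf) (hasSubst_of_constantCoeff (hc n))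
          (hasSubst_of_constantCoeff h2)).symm
      obtain ⟨h, hh⟩ := exists_subst_formalGroup_eq F h1 h2
      rw [h3, hG]
      dsimp only
      rw [hh, add_neg_cancel, zero_add, mul_neg, neg_mul]
      refine neg_mem (Ideal.mul_mem_right _ _ ?_)
      exact orderIdeal_anti (by omega) (mul_mem_orderIdeal ih ih)
  have hd : ∀ n, g (n + 1) - g n ∈ orderIdeal σ R n := by
    intro n
    have h1 := mem_orderIdeal_one.1 (orderIdeal_anti (Nat.le_add_left 1 n) (hr n))
    have h2 : constantCoeff (-G f (g n)) = 0 := by rw [map_neg, h1, neg_zero]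
    obtain ⟨h, hh⟩ := exists_subst_formalGroup_eq F (hc n) h2
    rw [hg, hG]
    dsimp only
    rw [hh, show g n + -G f (g n) + g n * -G f (g n) * h - g n
      = (-1 - g n * h) * G f (g n) by ring]
    exact Ideal.mul_mem_left _ _ (orderIdeal_anti (Nat.le_succ n) (hr n))
  obtain ⟨y, hy⟩ := exists_sub_mem_orderIdeal g hd
  have hy0 : constantCoeff y = 0 := by
    have := mem_orderIdeal_one.1 (hy 1)
    rwa [map_sub, hc, sub_zero] at this
  refine ⟨y, hy0, eq_zero_of_forall_mem_orderIdeal fun n => ?_⟩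
  have h1 : G f y - G f (g n) ∈ orderIdeal σ R n := by
    refine subst_sub_subst_mem_orderIdeal _ (constantCoeff_cons hf hy0)
      (constantCoeff_cons hf (hc n)) fun i => ?_
    fin_cases i
    · simp
    · exact hy n
  have := add_mem h1 (orderIdeal_anti (Nat.le_succ n) (hr n))
  rwa [sub_add_cancel] at this

/-- The power series without constant term, with the group structure given by `F`. -/
@[ext]
structure FPoint (F : FormalGroup R) (σ : Type*) where
  /-- The underlying power series. -/
  val : MvPowerSeries σ R
  constantCoeff_val : constantCoeff val = 0

namespace FPoint

instance : Zero (FPoint F σ) := ⟨⟨0, map_zero _⟩⟩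

instance : Add (FPoint F σ) :=
  ⟨fun a b => ⟨F.toPowerSeries.subst ![a.val, b.val],
    constantCoeff_subst_formalGroup F a.constantCoeff_val b.constantCoeff_val⟩⟩

instance [Finite σ] : Neg (FPoint F σ) :=
  ⟨fun a => ⟨_, (exists_formalGroup_neg F a.constantCoeff_val).choose_spec.1⟩⟩

lemma val_zero : (0 : FPoint F σ).val = 0 := rfl

lemma val_add (a b : FPoint F σ) : (a + b).val = F.toPowerSeries.subst ![a.val, b.val] := rfl

lemma hasSubst (a : FPoint F σ) : PowerSeries.HasSubst a.val :=
  hasSubst_of_constantCoeff a.constantCoeff_val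

instance [F.IsComm] [Finite σ] : AddCommGroup (FPoint F σ) where
  add_assoc a b c := FPoint.ext (F.assoc' (hasSubst F a) (hasSubst F b) (hasSubst F c))
  zero_add a := FPoint.ext (F.zero_add (hasSubst F a))
  add_zero a := FPoint.ext (F.add_zero (hasSubst F a))
  add_comm a b := FPoint.ext (F.comm' (hasSubst F a) (hasSubst F b))
  neg_add_cancel a := FPoint.ext ((F.comm' (hasSubst F _) (hasSubst F a)).trans
    (exists_formalGroup_neg F a.constantCoeff_val).choose_spec.2)
  nsmul := nsmulRec
  zsmul := zsmulRec

/-- The point `X s`. -/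
def X (F : FormalGroup R) (s : σ) : FPoint F σ := ⟨MvPowerSeries.X s, by simp⟩

end FPoint

end Points

end FormalHecke
end

noncomputable section

open MvPowerSeries Finsupp

namespace FormalHecke

/-! ### Evaluation of power series at nilpotent elements. -/

section NilpotentEvaluation

variable {R : Type*} [CommRing R] {σ A : Type*} [Finite σ] [CommRing A] [Algebra R A]

omit [Finite σ] in
lemma aeval_eq_zero_of_mem_pow_idealOfVars {N : Ideal A} {k : ℕ} (hN : N ^ k = ⊥) {τ : σ → A}
    (hτ : ∀ i, τ i ∈ N) (p : MvPolynomial σ R) (hp : p ∈ MvPolynomial.idealOfVars σ R ^ k) :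
    MvPolynomial.aeval τ p = 0 := by
  have h : MvPolynomial.idealOfVars σ R ≤ N.comap (MvPolynomial.aeval (R := R) τ) := by
    rw [MvPolynomial.idealOfVars, Ideal.span_le]
    rintro _ ⟨i, rfl⟩
    simpa using hτ i
  have h2 := (Ideal.pow_right_mono h k).trans (Ideal.le_comap_pow _ k) hp
  rwa [hN] at h2

/-- Evaluation of power series at elements of an ideal whose `k`-th power vanishes. -/
def nilpotentEval {N : Ideal A} {k : ℕ} (hN : N ^ k = ⊥) {τ : σ → A}
    (hτ : ∀ i, τ i ∈ N) : MvPowerSeries σ R →ₐ[R] A :=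
  (Ideal.Quotient.liftₐ (MvPolynomial.idealOfVars σ R ^ k) (MvPolynomial.aeval τ)
    (aeval_eq_zero_of_mem_pow_idealOfVars hN hτ)).comp
    ((truncTotalAlgHom σ R k).restrictScalars R)

variable {N : Ideal A} {k : ℕ} (hN : N ^ k = ⊥) {τ : σ → A} (hτ : ∀ i, τ i ∈ N)

lemma nilpotentEval_apply (f : MvPowerSeries σ R) :
    nilpotentEval hN hτ f = MvPolynomial.aeval τ (truncTotal k f) := rfl

lemma nilpotentEval_eq {f g : MvPowerSeries σ R} (h : f - g ∈ orderIdeal σ R k) :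
    nilpotentEval hN hτ f = nilpotentEval hN hτ g := by
  rw [nilpotentEval_apply, nilpotentEval_apply, truncTotal_eq_truncTotal_iff.2 h]

lemma nilpotentEval_coe (p : MvPolynomial σ R) :
    nilpotentEval hN hτ (p : MvPowerSeries σ R) = MvPolynomial.aeval τ p := by
  rw [nilpotentEval, AlgHom.comp_apply, AlgHom.restrictScalars_apply]
  exact congrArg _ ((truncTotalAlgHom σ R k).commutes p)

lemma nilpotentEval_X (i : σ) : nilpotentEval hN hτ (X i : MvPowerSeries σ R) = τ i := by
  rw [← MvPolynomial.coe_X, nilpotentEval_coe, MvPolynomial.aeval_X]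

lemma subst_sub_aeval_truncTotal_mem {υ : Type*} [Finite υ] (k : ℕ) (f : MvPowerSeries υ R)
    {a : υ → MvPowerSeries σ R} (ha : ∀ i, constantCoeff (a i) = 0) :
    f.subst a - MvPolynomial.aeval a (truncTotal k f) ∈ orderIdeal σ R k := by
  rw [show MvPolynomial.aeval a (truncTotal k f) = (truncTotal k f : MvPowerSeries υ R).subst a from
    (subst_coe (truncTotal k f)).symm, ← truncTotal_eq_truncTotal_iff, truncTotal_subst ha,
    truncTotal_subst (f := (truncTotal k f : MvPowerSeries υ R)) ha]
  congr 3
  rw [truncTotal_eq_truncTotal_iff]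
  exact sub_truncTotal_mem_orderIdeal k f

lemma nilpotentEval_subst {υ : Type*} [Finite υ] (f : MvPowerSeries υ R)
    {a : υ → MvPowerSeries σ R} (ha : ∀ i, constantCoeff (a i) = 0) :
    nilpotentEval hN hτ (f.subst a) =
      MvPolynomial.aeval (fun i => nilpotentEval hN hτ (a i)) (truncTotal k f) := by
  rw [nilpotentEval_eq hN hτ (subst_sub_aeval_truncTotal_mem k f ha),
    MvPolynomial.comp_aeval_apply]

lemma nilpotentEval_subst_cons (f : MvPowerSeries (Fin 2) R) {a b : MvPowerSeries σ R}
    (ha : constantCoeff a = 0) (hb : constantCoeff b = 0) :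
    nilpotentEval hN hτ (f.subst ![a, b]) =
      MvPolynomial.aeval ![nilpotentEval hN hτ a, nilpotentEval hN hτ b] (truncTotal k f) := by
  rw [nilpotentEval_subst hN hτ f (constantCoeff_cons ha hb)]
  congr 2
  ext i
  fin_cases i <;> rfl

include hN in
/-- Inverses for a commutative formal group law are unique. -/
lemma formalGroup_neg_unique (F : FormalGroup R) [F.IsComm] {x y z : A} (hx : x ∈ N) (hy : y ∈ N)
    (hz : z ∈ N)
    (hxy : MvPolynomial.aeval ![x, y] (truncTotal k F.toPowerSeries) = 0)
    (hxz : MvPolynomial.aeval ![x, z] (truncTotal k F.toPowerSeries) = 0) : y = z := by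
  have hτ : ∀ i, ![x, y, z] i ∈ N := by
    intro i; fin_cases i <;> assumption
  set θ := nilpotentEval (R := R) hN hτ with hθ
  have c (i : Fin 3) : constantCoeff (X i : MvPowerSeries (Fin 3) R) = 0 := constantCoeff_X i
  have hc (i : Fin 3) : PowerSeries.HasSubst (X i : MvPowerSeries (Fin 3) R) :=
    hasSubst_of_constantCoeff (c i)
  have e (i : Fin 3) : θ (X i) = ![x, y, z] i := nilpotentEval_X hN hτ i
  have h0 (f : MvPowerSeries (Fin 3) R) (hf : constantCoeff f = 0) :
      MvPolynomial.aeval ![θ f, 0] (truncTotal k F.toPowerSeries) = θ f := by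
    have := nilpotentEval_subst_cons hN hτ F.toPowerSeries hf (map_zero _)
    rw [F.add_zero (hasSubst_of_constantCoeff hf)] at this
    rw [← hθ, map_zero] at this
    exact this.symm
  set G := F.toPowerSeries with hG
  -- This is z + (x + y) = y + (x + z) for the group law; both brackets evaluate to 0, which leaves
  -- z = y.
  have hassoc : G.subst ![X 2, G.subst ![X 0, X 1]] = G.subst ![X 1, G.subst ![X 0, (X 2 : MvPowerSeries (Fin 3) R)]] := by
    have h01 := constantCoeff_subst_formalGroup F (c 0) (c 1)
    rw [F.comm' (hc 2) (hasSubst_of_constantCoeff h01), F.comm' (hc 0) (hc 1),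
      F.assoc' (hc 1) (hc 0) (hc 2)]
  have h1 := congrArg θ hassoc
  rw [hθ, nilpotentEval_subst_cons hN hτ _ (c _) (constantCoeff_subst_formalGroup F (c _) (c _)),
    nilpotentEval_subst_cons hN hτ _ (c _) (constantCoeff_subst_formalGroup F (c _) (c _)),
    nilpotentEval_subst_cons hN hτ _ (c _) (c _), nilpotentEval_subst_cons hN hτ _ (c _) (c _),
    ← hθ] at h1
  have e0 : θ (X 0) = x := e 0
  have e1 : θ (X 1) = y := e 1
  have e2 : θ (X 2) = z := e 2
  have k1 := h0 _ (c 1)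
  have k2 := h0 _ (c 2)
  rw [e1] at k1
  rw [e2] at k2
  rw [e0, e1, e2, hxy, hxz, k1, k2] at h1
  exact h1.symm

end NilpotentEvaluation

end FormalHecke
end

noncomputable section

open MvPowerSeries Finsupp

namespace FormalHecke

/-! ### Homomorphisms from `R⟦x_M⟧` to power series, and their kernel. -/

section FormalGroupAlgebraEquiv

variable {R : Type*} [CommRing R] {M σ : Type*}

lemma pow_orderIdeal_one_le (n : ℕ) : orderIdeal σ R 1 ^ n ≤ orderIdeal σ R n := by
  induction n with
  | zero => exact fun f _ => mem_orderIdeal_zero f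
  | succ n ih =>
    rw [pow_succ, Ideal.mul_le]
    exact fun f hf g hg => mul_mem_orderIdeal (ih hf) hg

lemma aeval_mem_orderIdeal {ρ : M → MvPowerSeries σ R} (hρ : ∀ m, constantCoeff (ρ m) = 0) {n : ℕ}
    {p : MvPolynomial M R} (hp : p ∈ augIdeal R M ^ n) :
    MvPolynomial.aeval ρ p ∈ orderIdeal σ R n := by
  have h : (constantCoeff (σ := σ) (R := R)).comp
      ((MvPolynomial.aeval ρ : MvPolynomial M R →ₐ[R] _) : MvPolynomial M R →+* _) =
      MvPolynomial.constantCoeff := by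
    ext i
    · simp [MvPowerSeries.algebraMap_apply]
    · simp [hρ]
  have h1 : augIdeal R M ≤ (orderIdeal σ R 1).comap (MvPolynomial.aeval (R := R) ρ) := by
    intro q hq
    rw [Ideal.mem_comap, mem_orderIdeal_one]
    exact (RingHom.congr_fun h q).trans hq
  exact pow_orderIdeal_one_le n ((Ideal.pow_right_mono h1 n).trans (Ideal.le_comap_pow _ n) hp)

variable [Finite σ] (ρ : M → MvPowerSeries σ R) (hρ : ∀ m, constantCoeff (ρ m) = 0)

/-- The map `R[x_M] / (x_m)_m ^ n → R[σ] / (σ) ^ n` with `x_m ↦ ρ m`. -/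
def PowSeries.liftSeriesAux (n : ℕ) :
    (MvPolynomial M R ⧸ augIdeal R M ^ n) →ₐ[R]
      (MvPolynomial σ R ⧸ MvPolynomial.idealOfVars σ R ^ n) :=
  Ideal.Quotient.liftₐ (augIdeal R M ^ n)
    (((truncTotalAlgHom σ R n).restrictScalars R).comp (MvPolynomial.aeval ρ))
    (fun p hp => by
      change Ideal.Quotient.mk _ (truncTotal n (MvPolynomial.aeval ρ p)) = 0
      rw [truncTotal_eq_truncTotal_iff.2 (by rw [sub_zero]; exact aeval_mem_orderIdeal hρ hp),
        map_zero, map_zero])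

lemma PowSeries.liftSeriesAux_mk (n : ℕ) (p : MvPolynomial M R) :
    PowSeries.liftSeriesAux ρ hρ n (Ideal.Quotient.mk _ p) =
      Ideal.Quotient.mk _ (truncTotal n (MvPolynomial.aeval ρ p)) := rfl

lemma PowSeries.liftSeriesAux_compat {m n : ℕ} (hle : m ≤ n) :
    (Ideal.Quotient.factorₐ R
      (Ideal.pow_le_pow_right (I := MvPolynomial.idealOfVars σ R) hle)).comp
        ((PowSeries.liftSeriesAux ρ hρ n).comp
          ((AdicCompletion.evalₐ (augIdeal R M) n).restrictScalars R)) =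
      (PowSeries.liftSeriesAux ρ hρ m).comp
        ((AdicCompletion.evalₐ (augIdeal R M) m).restrictScalars R) := by
  ext a
  obtain ⟨a, rfl⟩ := AdicCompletion.mk_surjective _ _ a
  simp only [AlgHom.comp_apply, AlgHom.restrictScalars_apply, AdicCompletion.evalₐ_mk]
  rw [← AdicCompletion.Ideal.mk_eq_mk (augIdeal R M) hle a, PowSeries.liftSeriesAux_mk,
    PowSeries.liftSeriesAux_mk, Ideal.Quotient.factorₐ_apply_mk, Ideal.Quotient.eq]
  exact truncTotal_sub_truncTotal_mem_pow_idealOfVars hle le_rfl _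

lemma evalₐ_toAdicCompletion (n : ℕ) (f : MvPowerSeries σ R) :
    AdicCompletion.evalₐ (MvPolynomial.idealOfVars σ R) n (toAdicCompletion σ R f) =
      Ideal.Quotient.mk _ (truncTotal n f) :=
  AdicCompletion.evalₐ_liftAlgHom _ (truncTotalAlgHom σ R) (fun h => AlgHom.ext fun _ => by
    simpa [Ideal.Quotient.mk_eq_mk_iff_sub_mem] using
      truncTotal_sub_truncTotal_mem_pow_idealOfVars h (le_refl _) _) n f

/-- The continuous homomorphism `R⟦x_M⟧ → R⟦σ⟧` with `x_m ↦ ρ m`. -/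
def PowSeries.liftSeries : PowSeries R M →ₐ[R] MvPowerSeries σ R :=
  ((toAdicCompletionAlgEquiv σ R).symm.toAlgHom.restrictScalars R).comp
    (AdicCompletion.liftAlgHom (MvPolynomial.idealOfVars σ R)
      (fun n => (PowSeries.liftSeriesAux ρ hρ n).comp
        ((AdicCompletion.evalₐ (augIdeal R M) n).restrictScalars R))
      (PowSeries.liftSeriesAux_compat ρ hρ))

variable {ρ}

/-- Modulo order n the lift may be computed on any polynomial that represents a; identities for the
lift then follow from polynomial ones by letting n grow. -/
lemma PowSeries.liftSeries_sub_aeval_mem {n : ℕ} {a : PowSeries R M} {p : MvPolynomial M R}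
    (h : AdicCompletion.evalₐ (augIdeal R M) n a = Ideal.Quotient.mk _ p) :
    PowSeries.liftSeries ρ hρ a - MvPolynomial.aeval ρ p ∈ orderIdeal σ R n := by
  set f := PowSeries.liftSeries ρ hρ a with hf
  have h1 := congrArg (toAdicCompletionAlgEquiv σ R) hf
  rw [PowSeries.liftSeries, AlgHom.comp_apply] at h1
  have h2 := h1.trans ((toAdicCompletionAlgEquiv σ R).apply_symm_apply _)
  have h3 := congrArg (AdicCompletion.evalₐ (MvPolynomial.idealOfVars σ R) n) h2
  rw [AdicCompletion.evalₐ_liftAlgHom _ _ (PowSeries.liftSeriesAux_compat ρ hρ),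
    AlgHom.comp_apply, AlgHom.restrictScalars_apply, h, PowSeries.liftSeriesAux_mk,
    toAdicCompletionAlgEquiv_apply, evalₐ_toAdicCompletion, Ideal.Quotient.eq] at h3
  rw [MvPolynomial.mem_pow_idealOfVars_iff'] at h3
  intro d hd
  rw [map_sub, ← coeff_truncTotal _ hd, ← coeff_truncTotal _ hd, ← MvPolynomial.coeff_sub]
  exact h3 d hd

lemma PowSeries.liftSeries_of (p : MvPolynomial M R) :
    PowSeries.liftSeries ρ hρ (AdicCompletion.of _ _ p) = MvPolynomial.aeval ρ p :=
  sub_eq_zero.1 <| eq_zero_of_forall_mem_orderIdeal fun n =>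
    PowSeries.liftSeries_sub_aeval_mem hρ (AdicCompletion.evalₐ_of _ n p)

lemma PowSeries.liftSeries_variableX (m : M) :
    PowSeries.liftSeries ρ hρ (variableX R m) = ρ m := by
  rw [variableX, PowSeries.liftSeries_of, MvPolynomial.aeval_X]

lemma PowSeries.liftSeries_mem_orderIdeal {n : ℕ} {a : PowSeries R M}
    (h : AdicCompletion.evalₐ (augIdeal R M) n a = 0) :
    PowSeries.liftSeries ρ hρ a ∈ orderIdeal σ R n := by
  have := PowSeries.liftSeries_sub_aeval_mem hρ (n := n) (a := a) (p := 0) (by rw [h, map_zero])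
  rwa [map_zero, sub_zero] at this

lemma evalₐ_evalTwo (G : MvPowerSeries (Fin 2) R) (l m : M) (n : ℕ) :
    AdicCompletion.evalₐ (augIdeal R M) n (evalTwo G l m) =
      Ideal.Quotient.mk _ (MvPolynomial.aeval ![MvPolynomial.X l, MvPolynomial.X m]
        (truncTotal n G)) := by
  rw [evalTwo, AdicCompletion.evalₐ_mk]
  rfl

lemma PowSeries.liftSeries_evalTwo (G : MvPowerSeries (Fin 2) R) (l m : M) :
    PowSeries.liftSeries ρ hρ (evalTwo G l m) = G.subst ![ρ l, ρ m] := by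
  refine sub_eq_zero.1 <| eq_zero_of_forall_mem_orderIdeal fun n => ?_
  have h1 := PowSeries.liftSeries_sub_aeval_mem hρ (evalₐ_evalTwo G l m n)
  have h2 := subst_sub_aeval_truncTotal_mem n G (constantCoeff_cons (hρ l) (hρ m))
  rw [MvPolynomial.comp_aeval_apply] at h1
  have h3 : (fun i => MvPolynomial.aeval (R := R) ρ
      (![MvPolynomial.X l, MvPolynomial.X m] i : MvPolynomial M R)) = ![ρ l, ρ m] := by
    ext i : 1
    fin_cases i <;> simp
  rw [h3] at h1
  have := sub_mem h1 h2
  rwa [sub_sub_sub_cancel_right] at this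

variable [AddCommGroup M] {F : FormalGroup R}

lemma PowSeries.liftSeries_eq_zero (h0 : ρ 0 = 0)
    (hadd : ∀ l m, ρ (l + m) = F.toPowerSeries.subst ![ρ l, ρ m]) {a : PowSeries R M}
    (ha : a ∈ closedRelIdeal F M) : PowSeries.liftSeries ρ hρ a = 0 := by
  refine eq_zero_of_forall_mem_orderIdeal fun n => ?_
  rw [closedRelIdeal, Ideal.mem_iInf] at ha
  obtain ⟨b, hb, c, hc, rfl⟩ := Submodule.mem_sup.1 (ha n)
  have h : relIdeal F M ≤ RingHom.ker (PowSeries.liftSeries ρ hρ) := by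
    rw [relIdeal, Ideal.span_le]
    rintro _ (h | ⟨p, rfl⟩)
    · rw [Set.mem_singleton_iff] at h
      rw [h, SetLike.mem_coe, RingHom.mem_ker, PowSeries.liftSeries_variableX, h0]
    · rw [SetLike.mem_coe, RingHom.mem_ker, map_sub, PowSeries.liftSeries_variableX,
        PowSeries.liftSeries_evalTwo, hadd, sub_self]
  rw [map_add, h hb, zero_add]
  exact PowSeries.liftSeries_mem_orderIdeal hρ hc

/-- Modulo the relations and the k-th step of the filtration, the augmentation ideal is nilpotent,
so a power series can be evaluated at the classes of the x_{e i}. This evaluation θ sends ρ m to the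
class of x_m for every m, since both are compatible with F and they agree on a basis. Hence θ after
the lift is the projection, and an element killed by the lift is zero in every such quotient. -/
lemma PowSeries.mem_closedRelIdeal [F.IsComm] (h0 : ρ 0 = 0)
    (hadd : ∀ l m, ρ (l + m) = F.toPowerSeries.subst ![ρ l, ρ m])
    (e : Module.Basis σ ℤ M) (he : ∀ i, ρ (e i) = X i) {a : PowSeries R M}
    (ha : PowSeries.liftSeries ρ hρ a = 0) : a ∈ closedRelIdeal F M := by
  rw [closedRelIdeal, Ideal.mem_iInf]
  intro k
  set L : Ideal (PowSeries R M) :=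
    relIdeal F M ⊔ RingHom.ker (AdicCompletion.evalₐ (augIdeal R M) k) with hL
  let q : MvPolynomial M R →ₐ[R] PowSeries R M ⧸ L :=
    (Ideal.Quotient.mkₐ R L).comp (IsScalarTower.toAlgHom R (MvPolynomial M R) (PowSeries R M))
  have hq : ∀ p, q p = Ideal.Quotient.mk L (AdicCompletion.of _ _ p) := fun _ => rfl
  have hqe : ∀ (b : PowSeries R M) p,
      AdicCompletion.evalₐ (augIdeal R M) k b = Ideal.Quotient.mk _ p →
        Ideal.Quotient.mk L b = q p := by
    intro b p h
    rw [hq, Ideal.Quotient.eq]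
    refine Ideal.mem_sup_right ?_
    rw [RingHom.mem_ker, map_sub, h, AdicCompletion.evalₐ_of, sub_self]
  let N : Ideal (PowSeries R M ⧸ L) := (augIdeal R M).map q
  have hN : N ^ k = ⊥ := by
    rw [← Ideal.map_pow, Ideal.map_eq_bot_iff_le_ker]
    intro p hp
    rw [RingHom.mem_ker, ← map_zero q]
    refine ((hqe _ _ (AdicCompletion.evalₐ_of _ k p)).symm.trans (hqe _ 0 ?_))
    rw [AdicCompletion.evalₐ_of, map_zero]
    exact Ideal.Quotient.eq_zero_iff_mem.2 hp
  have hXN : ∀ m, q (MvPolynomial.X m) ∈ N := fun m =>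
    Ideal.mem_map_of_mem q (X_mem_augIdeal m)
  have hτ : ∀ i, q (MvPolynomial.X (e i)) ∈ N := fun i => hXN _
  set θ := nilpotentEval (R := R) hN hτ with hθ
  have hθN : ∀ f : MvPowerSeries σ R, constantCoeff f = 0 → θ f ∈ N := by
    intro f hf
    have h1 : truncTotal k f ∈ MvPolynomial.idealOfVars σ R := by
      rw [← pow_one (MvPolynomial.idealOfVars σ R), MvPolynomial.mem_pow_idealOfVars_iff']
      intro d hd
      rw [(degree_eq_zero_iff d).1 (Nat.lt_one_iff.1 hd)]
      refine (constantCoeff_truncTotal_eq_ite f).trans ?_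
      split_ifs
      · exact hf
      · rfl
    have h2 : MvPolynomial.idealOfVars σ R ≤
        N.comap (MvPolynomial.aeval (R := R) fun i => q (MvPolynomial.X (e i))) := by
      rw [MvPolynomial.idealOfVars, Ideal.span_le]
      rintro _ ⟨i, rfl⟩
      simpa using hτ i
    exact h2 h1
  have hrel0 : q (MvPolynomial.X 0) = 0 := by
    rw [hq, Ideal.Quotient.eq_zero_iff_mem]
    exact Ideal.mem_sup_left (Ideal.subset_span (Or.inl rfl))
  have hrel : ∀ l m, q (MvPolynomial.X (l + m)) = MvPolynomial.aeval
      ![q (MvPolynomial.X l), q (MvPolynomial.X m)] (truncTotal k F.toPowerSeries) := by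
    intro l m
    have h1 : Ideal.Quotient.mk L (evalTwo F.toPowerSeries l m) = q (MvPolynomial.X (l + m)) := by
      rw [hq, Ideal.Quotient.eq]
      exact Ideal.mem_sup_left (Ideal.subset_span (Or.inr ⟨(l, m), rfl⟩))
    rw [← h1, hqe _ _ (evalₐ_evalTwo _ l m k), MvPolynomial.comp_aeval_apply]
    congr 2
    ext i : 1
    fin_cases i <;> rfl
  have hθadd : ∀ l m, θ (ρ (l + m)) =
      MvPolynomial.aeval ![θ (ρ l), θ (ρ m)] (truncTotal k F.toPowerSeries) := by
    intro l m
    rw [hadd, hθ, nilpotentEval_subst_cons hN hτ _ (hρ _) (hρ _)]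
  let H : AddSubgroup M :=
    { carrier := {m | θ (ρ m) = q (MvPolynomial.X m)}
      add_mem' := fun {l m} hl hm => by
        rw [Set.mem_ofPred_eq] at hl hm ⊢
        rw [hθadd, hl, hm, hrel]
      zero_mem' := by rw [Set.mem_ofPred_eq, h0, map_zero, hrel0]
      neg_mem' := fun {m} hm => by
        rw [Set.mem_ofPred_eq] at hm ⊢
        -- Both θ (ρ (-m)) and the class of x_{-m} are inverses of the class of x_m for the formal
        -- group law.
        refine formalGroup_neg_unique hN F (hXN m) (hθN _ (hρ _)) (hXN _) ?_ ?_
        · rw [← hm, ← hθadd, add_neg_cancel, h0, map_zero]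
        · rw [← hrel, add_neg_cancel, hrel0] }
  have hH : ∀ m, θ (ρ m) = q (MvPolynomial.X m) := by
    intro m
    change m ∈ H
    have := Fintype.ofFinite σ
    rw [← e.sum_repr m]
    refine H.sum_mem fun i _ => H.zsmul_mem ?_ _
    change θ (ρ (e i)) = _
    rw [he, hθ, nilpotentEval_X]
  obtain ⟨p, hp⟩ := Ideal.Quotient.mk_surjective (AdicCompletion.evalₐ (augIdeal R M) k a)
  have h1 := PowSeries.liftSeries_sub_aeval_mem hρ hp.symm
  rw [ha] at h1
  have h2 := nilpotentEval_eq hN hτ h1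
  rw [map_zero, ← hθ, MvPolynomial.comp_aeval_apply] at h2
  rw [← Ideal.Quotient.eq_zero_iff_mem, hqe a p hp.symm, h2]
  simp_rw [hH, ← MvPolynomial.comp_aeval_apply]
  simp

end FormalGroupAlgebraEquiv
end FormalHecke
end

noncomputable section

open MvPowerSeries Finsupp

namespace FormalHecke

/-! ### The formal group algebra of a lattice as a power series ring. -/

section FormalGroupAlgebraStructure

variable {R : Type*} [CommRing R] (F : FormalGroup R) [F.IsComm]
variable {M σ : Type*} [AddCommGroup M] [Finite σ] (e : Module.Basis σ ℤ M)

omit [F.IsComm] [AddCommGroup M] [Finite σ] in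
lemma aeval_X_comp_mem_pow_augIdeal (c : σ → M) {n : ℕ} {p : MvPolynomial σ R}
    (hp : p ∈ MvPolynomial.idealOfVars σ R ^ n) :
    MvPolynomial.aeval (fun i => (MvPolynomial.X (c i) : MvPolynomial M R)) p ∈
      augIdeal R M ^ n := by
  have h : MvPolynomial.idealOfVars σ R ≤ (augIdeal R M).comap
      (MvPolynomial.aeval (R := R) fun i => (MvPolynomial.X (c i) : MvPolynomial M R)) := by
    rw [MvPolynomial.idealOfVars, Ideal.span_le]
    rintro _ ⟨i, rfl⟩
    simpa using X_mem_augIdeal (R := R) (c i)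
  exact (Ideal.pow_right_mono h n).trans (Ideal.le_comap_pow _ n) hp

omit [F.IsComm] [AddCommGroup M] in
/-- The value in `R⟦x_M⟧` of a power series at the variables `x_{c i}`. -/
lemma exists_powSeries (c : σ → M) (f : MvPowerSeries σ R) : ∃ a : PowSeries R M, ∀ n,
    AdicCompletion.evalₐ (augIdeal R M) n a =
      Ideal.Quotient.mk _ (MvPolynomial.aeval (fun i => MvPolynomial.X (c i)) (truncTotal n f)) := by
  refine ⟨AdicCompletion.mk _ _ (AdicCompletion.AdicCauchySequence.mk (augIdeal R M)
    (MvPolynomial M R)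
    (fun n => MvPolynomial.aeval (fun i => MvPolynomial.X (c i)) (truncTotal n f)) fun n => ?_),
    fun n => ?_⟩
  · rw [SModEq.sub_mem, ← map_sub, smul_eq_mul, Ideal.mul_top]
    exact aeval_X_comp_mem_pow_augIdeal c
      (truncTotal_sub_truncTotal_mem_pow_idealOfVars le_rfl (Nat.le_succ n) f)
  · rw [AdicCompletion.evalₐ_mk]
    rfl

omit [Finite σ] in
lemma coe_eq_aeval_X (p : MvPolynomial σ R) :
    (p : MvPowerSeries σ R) = MvPolynomial.aeval X p := by
  induction p using MvPolynomial.induction_on with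
  | C r => simp [MvPowerSeries.algebraMap_apply]
  | add p q hp hq => simp [hp, hq]
  | mul_X p i hp => simp [hp]

/-- The power series attached to `m`: the sum of the variables with multiplicities the coordinates
of `m`, with respect to the formal group law. -/
def pointOf : M →+ FPoint F σ := (e.constr ℤ (FPoint.X F)).toAddMonoidHom

lemma pointOf_basis (i : σ) : pointOf F e (e i) = FPoint.X F i :=
  e.constr_basis ℤ _ i

lemma liftSeries_pointOf_eq {a : PowSeries R M} {f : MvPowerSeries σ R} (h : ∀ n,
    AdicCompletion.evalₐ (augIdeal R M) n a = Ideal.Quotient.mk _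
      (MvPolynomial.aeval (fun i => MvPolynomial.X (e i)) (truncTotal n f))) :
    PowSeries.liftSeries (fun m => (pointOf F e m).val)
      (fun m => (pointOf F e m).constantCoeff_val) a = f := by
  refine sub_eq_zero.1 <| eq_zero_of_forall_mem_orderIdeal fun n => ?_
  have h1 := PowSeries.liftSeries_sub_aeval_mem (ρ := fun m => (pointOf F e m).val)
    (fun m => (pointOf F e m).constantCoeff_val) (h n)
  rw [MvPolynomial.comp_aeval_apply] at h1
  simp only [MvPolynomial.aeval_X, pointOf_basis] at h1
  have h2 : (truncTotal n f : MvPowerSeries σ R) =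
      MvPolynomial.aeval (fun i => (FPoint.X F i).val) (truncTotal n f) :=
    coe_eq_aeval_X _
  rw [← h2] at h1
  have := sub_mem h1 (sub_truncTotal_mem_orderIdeal n f)
  rwa [sub_sub_sub_cancel_right] at this

/-- The homomorphism `R⟦M⟧_F → R⟦σ⟧` given by a basis of `M`. -/
def FGA.toSeries : FGA F M →ₐ[R] MvPowerSeries σ R :=
  Ideal.Quotient.liftₐ (closedRelIdeal F M)
    (PowSeries.liftSeries (fun m => (pointOf F e m).val) fun m => (pointOf F e m).constantCoeff_val)
    fun _ ha => PowSeries.liftSeries_eq_zero _ (by rw [map_zero, FPoint.val_zero])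
      (fun l m => by rw [map_add, FPoint.val_add]) ha

lemma FGA.toSeries_bijective : Function.Bijective (FGA.toSeries F e) := by
  constructor
  · rw [injective_iff_map_eq_zero]
    intro u hu
    obtain ⟨a, rfl⟩ := FGA.proj_surjective F M u
    exact Ideal.Quotient.eq_zero_iff_mem.2 (PowSeries.mem_closedRelIdeal _
      (by rw [map_zero, FPoint.val_zero]) (fun l m => by rw [map_add, FPoint.val_add]) e
      (fun i => by rw [pointOf_basis]; rfl) hu)
  · intro f
    obtain ⟨a, ha⟩ := exists_powSeries (R := R) (fun i => e i) f
    exact ⟨FGA.proj F M a, liftSeries_pointOf_eq F e ha⟩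

/-- The isomorphism `R⟦M⟧_F → R⟦σ⟧` given by a basis of `M`. -/
def FGA.equiv : FGA F M ≃ₐ[R] MvPowerSeries σ R :=
  AlgEquiv.ofBijective (FGA.toSeries F e) (FGA.toSeries_bijective F e)

lemma FGA.equiv_proj (a : PowSeries R M) : FGA.equiv F e (FGA.proj F M a) =
    PowSeries.liftSeries (fun m => (pointOf F e m).val)
      (fun m => (pointOf F e m).constantCoeff_val) a := rfl

lemma FGA.equiv_x (m : M) : FGA.equiv F e (FGA.x F m) = (pointOf F e m).val := by
  rw [FGA.x, FGA.equiv_proj, PowSeries.liftSeries_variableX]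

lemma FGA.equiv_x_basis (i : σ) : FGA.equiv F e (FGA.x F (e i)) = X i := by
  rw [FGA.equiv_x, pointOf_basis]; rfl

lemma FGA.constantCoeff_equiv_x (m : M) : constantCoeff (FGA.equiv F e (FGA.x F m)) = 0 := by
  rw [FGA.equiv_x, FPoint.constantCoeff_val]

omit [F.IsComm] in
lemma FGA.x_zero : FGA.x F (0 : M) = 0 := by
  refine Ideal.Quotient.eq_zero_iff_mem.2 ?_
  rw [closedRelIdeal, Ideal.mem_iInf]
  exact fun k => Ideal.mem_sup_left (Ideal.subset_span (Or.inl rfl))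

include e in
lemma FGA.exists_x_add_eq (l m : M) :
    ∃ h, FGA.x F (l + m) = FGA.x F l + FGA.x F m + FGA.x F l * FGA.x F m * h := by
  obtain ⟨h, hh⟩ := exists_subst_formalGroup_eq F (pointOf F e l).constantCoeff_val
    (pointOf F e m).constantCoeff_val
  refine ⟨(FGA.equiv F e).symm h, (FGA.equiv F e).injective ?_⟩
  rw [map_add, map_add, map_mul, map_mul, AlgEquiv.apply_symm_apply, FGA.equiv_x, FGA.equiv_x,
    FGA.equiv_x, map_add, FPoint.val_add, hh]

lemma FGA.isUnit_of_constantCoeff {u : FGA F M}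
    (h : IsUnit (constantCoeff (FGA.equiv F e u))) : IsUnit u :=
  (MulEquiv.isUnit_map (FGA.equiv F e)).1 (MvPowerSeries.isUnit_iff_constantCoeff.2 h)

include e in
-- From x_{l+m} = x_l + x_m + x_l x_m h, the quotient is 1 + x_m h, with constant term 1. It serves
-- to recognise x_γ - x_α as x_{γ-α} up to a unit.
lemma FGA.exists_isUnit_x_add_sub (l m : M) :
    ∃ v, IsUnit v ∧ FGA.x F (l + m) - FGA.x F m = FGA.x F l * v := by
  obtain ⟨h, hh⟩ := FGA.exists_x_add_eq F e l m
  refine ⟨1 + FGA.x F m * h, FGA.isUnit_of_constantCoeff F e ?_, by rw [hh]; ring⟩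
  rw [map_add, map_add, map_mul, map_mul, FGA.constantCoeff_equiv_x, map_one, map_one, zero_mul,
    add_zero]
  exact isUnit_one

include e in
-- The quotient is 2 + x_m h. This is where the invertibility of 2 enters: a root that is twice a
-- lattice vector still gives a variable up to a unit.
lemma FGA.exists_isUnit_x_add_self (h2 : IsUnit (2 : R)) (m : M) :
    ∃ v, IsUnit v ∧ FGA.x F (m + m) = FGA.x F m * v := by
  obtain ⟨h, hh⟩ := FGA.exists_x_add_eq F e m m
  refine ⟨2 + FGA.x F m * h, FGA.isUnit_of_constantCoeff F e ?_, by rw [hh]; ring⟩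
  rw [map_add, map_add, map_mul, map_mul, FGA.constantCoeff_equiv_x, zero_mul,
    add_zero, map_ofNat, map_ofNat]
  exact h2

/-- The map that sends `m` to the linear form `∑ m_i X_i`, where the `m_i` are the coordinates
of `m`. -/
def linearForm (R : Type*) [CommRing R] : M →ₗ[ℤ] MvPowerSeries σ R := e.constr ℤ X

omit [Finite σ] in
lemma linearForm_basis (i : σ) : linearForm e R (e i) = X i := e.constr_basis ℤ _ i

/-- Since F is X + Y up to order two, the elements m for which this holds form a subgroup, and it
contains the basis. -/
lemma FGA.equiv_x_sub_linearForm_mem (m : M) :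
    FGA.equiv F e (FGA.x F m) - linearForm e R m ∈ orderIdeal σ R 2 := by
  have h1 : ∀ m, FGA.equiv F e (FGA.x F m) ∈ orderIdeal σ R 1 := fun m =>
    mem_orderIdeal_one.2 (FGA.constantCoeff_equiv_x F e m)
  have hadd : ∀ l m, FGA.equiv F e (FGA.x F (l + m)) - FGA.equiv F e (FGA.x F l) -
      FGA.equiv F e (FGA.x F m) ∈ orderIdeal σ R 2 := by
    intro l m
    obtain ⟨h, hh⟩ := FGA.exists_x_add_eq F e l m
    rw [hh, map_add, map_add, add_assoc, add_sub_cancel_left, add_sub_cancel_left, map_mul,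
      map_mul]
    exact Ideal.mul_mem_right _ _ (mul_mem_orderIdeal (h1 l) (h1 m))
  let H : AddSubgroup M :=
    { carrier := {m | FGA.equiv F e (FGA.x F m) - linearForm e R m ∈ orderIdeal σ R 2}
      add_mem' := fun {l m} hl hm => by
        rw [Set.mem_ofPred_eq] at hl hm ⊢
        have := add_mem (add_mem (hadd l m) hl) hm
        rw [map_add]
        convert! this using 1
        ring
      zero_mem' := by
        rw [Set.mem_ofPred_eq, FGA.x_zero, map_zero, map_zero, sub_zero]
        exact zero_mem _
      neg_mem' := fun {m} hm => by
        rw [Set.mem_ofPred_eq] at hm ⊢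
        have := neg_mem (add_mem (hadd m (-m)) hm)
        rw [map_neg]
        rw [add_neg_cancel, FGA.x_zero, map_zero] at this
        convert! this using 1
        ring }
  change m ∈ H
  have := Fintype.ofFinite σ
  rw [← e.sum_repr m]
  refine H.sum_mem fun i _ => H.zsmul_mem ?_ _
  change FGA.equiv F e (FGA.x F (e i)) - linearForm e R (e i) ∈ orderIdeal σ R 2
  rw [FGA.equiv_x_basis, linearForm_basis, sub_self]
  exact zero_mem _

/-- The ideal of `R⟦M⟧_F` of elements of order at least `k`. -/
def FGA.filt (F : FormalGroup R) (M : Type*) [AddCommGroup M] (k : ℕ) : Ideal (FGA F M) :=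
  (RingHom.ker (AdicCompletion.evalₐ (augIdeal R M) k)).map (FGA.proj F M)

lemma FGA.mem_filt_iff {k : ℕ} {u : FGA F M} :
    u ∈ FGA.filt F M k ↔ FGA.equiv F e u ∈ orderIdeal σ R k := by
  constructor
  · intro h
    have : FGA.filt F M k ≤ (orderIdeal σ R k).comap (FGA.equiv F e) := by
      rw [FGA.filt, Ideal.map_le_iff_le_comap]
      intro a ha
      rw [Ideal.mem_comap, Ideal.mem_comap, FGA.equiv_proj]
      exact PowSeries.liftSeries_mem_orderIdeal _ ha
    exact this h
  · intro h
    obtain ⟨a, ha⟩ := exists_powSeries (R := R) (fun i => e i) (FGA.equiv F e u)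
    have h1 : FGA.proj F M a = u := (FGA.equiv F e).injective (liftSeries_pointOf_eq F e ha)
    rw [← h1]
    refine Ideal.mem_map_of_mem _ ?_
    rw [RingHom.mem_ker, ha, (truncTotal_eq_truncTotal_iff (g := 0)).2 (by rwa [sub_zero]),
      map_zero, map_zero, map_zero]

omit [F.IsComm] in
lemma FGA.map_mem_filt {M' : Type*} [AddCommGroup M'] (f : M →+ M') {k : ℕ} {u : FGA F M}
    (h : u ∈ FGA.filt F M k) : FGA.map F f u ∈ FGA.filt F M' k := by
  have : FGA.filt F M k ≤ (FGA.filt F M' k).comap (FGA.map F f) := by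
    rw [FGA.filt, Ideal.map_le_iff_le_comap]
    intro a ha
    rw [Ideal.mem_comap, Ideal.mem_comap, FGA.map_proj]
    refine Ideal.mem_map_of_mem _ ?_
    rw [RingHom.mem_ker] at ha ⊢
    rw [PowSeries.evalₐ_rename, ha, map_zero]
  exact this h

lemma FGA.exists_sub_aeval_mem_filt (u : FGA F M) (k : ℕ) : ∃ p : MvPolynomial σ R,
    u - MvPolynomial.aeval (fun i => FGA.x F (e i)) p ∈ FGA.filt F M k := by
  refine ⟨truncTotal k (FGA.equiv F e u), (FGA.mem_filt_iff F e).2 ?_⟩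
  rw [map_sub]
  convert! sub_truncTotal_mem_orderIdeal k (FGA.equiv F e u) using 2
  rw [← AlgEquiv.coe_toAlgHom, MvPolynomial.comp_aeval_apply, coe_eq_aeval_X]
  simp only [AlgEquiv.coe_toAlgHom, FGA.equiv_x_basis]

/-- An endomorphism of `M` that only changes the coordinate `i` of the basis `e`, killing `e i`,
changes an element of `R⟦M⟧_F` by a multiple of `x_{e i}`. -/
lemma FGA.x_dvd_sub_map (i : σ) (f : M →+ M) (hi : f (e i) = 0) (hf : ∀ j, j ≠ i → f (e j) = e j)
    (u : FGA F M) : FGA.x F (e i) ∣ u - FGA.map F f u := by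
  rw [← map_dvd_iff (FGA.equiv F e), FGA.equiv_x_basis, X_dvd_iff]
  intro d hd
  -- Only the coefficient at d matters, so u may be replaced modulo order degree d + 1 by a
  -- polynomial in the x_{e j}, for which the divisibility is checked on variables.
  obtain ⟨p, hp⟩ := FGA.exists_sub_aeval_mem_filt F e u (degree d + 1)
  have h1 := sub_mem hp (FGA.map_mem_filt F f hp)
  have h2 : FGA.x F (e i) ∣ MvPolynomial.aeval (fun i => FGA.x F (e i)) p -
      FGA.map F f (MvPolynomial.aeval (fun i => FGA.x F (e i)) p) := by
    rw [← Ideal.mem_span_singleton, ← Ideal.Quotient.eq, MvPolynomial.comp_aeval_apply]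
    simp only [← Ideal.Quotient.mkₐ_eq_mk R, MvPolynomial.comp_aeval_apply]
    congr 2
    ext j : 1
    rw [FGA.map_x]
    by_cases hj : j = i
    · rw [hj, hi, FGA.x_zero, map_zero]
      exact Ideal.Quotient.eq_zero_iff_mem.2 (Ideal.mem_span_singleton_self _)
    · rw [hf j hj]
  obtain ⟨c, hc⟩ := h2
  have h3 := (FGA.mem_filt_iff F e).1 h1 d (Nat.lt_succ_self _)
  rw [map_sub (FGA.map F f), show ∀ a b c d : FGA F M, a - b - (c - d) = a - c - (b - d) from
    fun a b c d => by ring, hc, map_sub, map_sub, map_mul, FGA.equiv_x_basis,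
    X_dvd_iff.1 ⟨_, rfl⟩ d hd, sub_zero] at h3
  exact h3

end FormalGroupAlgebraStructure
end FormalHecke
end

noncomputable section

namespace FormalHecke

/-! ### The Weyl group: inversions, length and exchange. -/

section Weyl

variable {ι Λ Λv : Type*} [AddCommGroup Λ] [AddCommGroup Λv] {P : RootPairing ι ℤ Λ Λv}

lemma weylGroup_ext {w w' : P.weylGroup} (h : ∀ x : Λ, w • x = w' • x) : w = w' := by
  apply Subtype.ext
  apply RootPairing.Equiv.weightHom_injective P
  ext x
  exact h x

lemma toLinearMap_smul_coroot (w : P.weylGroup) (x : Λ) (i : ι) :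
    P.toLinearMap (w • x) (P.coroot (P.weylGroupToPerm w i)) = P.toLinearMap x (P.coroot i) := by
  have h1 := LinearMap.congr_fun (RootPairing.Hom.weight_coweight_transpose_apply P P
    (P.coroot (P.weylGroupToPerm w i)) w.1.toHom) x
  rw [RootPairing.Hom.coroot_coweightMap_apply] at h1
  refine h1.trans (congrArg (fun j => P.toLinearMap x (P.coroot j)) ?_)
  exact w.1.indexEquiv.symm_apply_apply i

lemma mul_ofIdx_mul_inv (w : P.weylGroup) (i : ι) :
    w * RootPairing.weylGroup.ofIdx P i * w⁻¹ =
      RootPairing.weylGroup.ofIdx P (P.weylGroupToPerm w i) := by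
  refine weylGroup_ext fun x => ?_
  have h : ∀ (j : ι) (y : Λ), RootPairing.weylGroup.ofIdx P j • y =
      y - P.toLinearMap y (P.coroot j) • P.root j := fun j y => P.reflection_apply j y
  rw [mul_smul, mul_smul, h, h, smul_sub, smul_inv_smul, ← toLinearMap_smul_coroot w,
    smul_inv_smul, smul_comm, RootPairing.weylGroup_apply_root]

lemma ofIdx_mul_self (i : ι) :
    RootPairing.weylGroup.ofIdx P i * RootPairing.weylGroup.ofIdx P i = 1 :=
  weylGroup_ext fun x => by
    rw [mul_smul, one_smul]
    exact P.reflection_same i x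

lemma inv_ofIdx (i : ι) :
    (RootPairing.weylGroup.ofIdx P i)⁻¹ = RootPairing.weylGroup.ofIdx P i :=
  inv_eq_of_mul_eq_one_left (ofIdx_mul_self i)

lemma weylGroupToPerm_ofIdx (i j : ι) :
    P.weylGroupToPerm (RootPairing.weylGroup.ofIdx P i) j = P.reflectionPerm i j := rfl

lemma weylGroupToPerm_apply_inv (w : P.weylGroup) (i : ι) :
    P.weylGroupToPerm w (P.weylGroupToPerm w⁻¹ i) = i := by
  rw [← Equiv.Perm.mul_apply, ← map_mul, mul_inv_cancel, map_one, Equiv.Perm.one_apply]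

lemma weylGroupToPerm_inv_apply (w : P.weylGroup) (i : ι) :
    P.weylGroupToPerm w⁻¹ (P.weylGroupToPerm w i) = i := by
  rw [← Equiv.Perm.mul_apply, ← map_mul, inv_mul_cancel, map_one, Equiv.Perm.one_apply]

/-- `P.reflectionPerm i i` is the index of the root opposite to the one of index `i`; it plays the
role of the sign throughout. -/
lemma weylGroupToPerm_neg (w : P.weylGroup) (i : ι) :
    P.weylGroupToPerm w (P.reflectionPerm i i) =
      P.reflectionPerm (P.weylGroupToPerm w i) (P.weylGroupToPerm w i) := by
  refine P.root.injective ?_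
  rw [← RootPairing.weylGroup_apply_root]
  simp only [RootPairing.root_reflectionPerm, RootPairing.reflection_apply_self]
  rw [smul_neg, RootPairing.weylGroup_apply_root]

lemma neg_neg_idx (i : ι) : P.reflectionPerm (P.reflectionPerm i i) (P.reflectionPerm i i) = i := by
  refine P.root.injective ?_
  rw [P.root_reflectionPerm, P.reflection_apply_self, P.root_reflectionPerm,
    P.reflection_apply_self, neg_neg]

variable (b : P.Base)

lemma isPos_neg_iff (i : ι) : b.IsPos (P.reflectionPerm i i) ↔ ¬ b.IsPos i :=
  RootPairing.Base.IsPos.neg_iff_not b i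

lemma wordProd_nil : wordProd b [] = 1 := rfl

lemma wordProd_cons (i : b.support) (J : List b.support) :
    wordProd b (i :: J) = RootPairing.weylGroup.ofIdx P i * wordProd b J := List.prod_cons

lemma wordProd_append (J K : List b.support) :
    wordProd b (J ++ K) = wordProd b J * wordProd b K := by
  induction J with
  | nil => rw [List.nil_append, wordProd_nil, one_mul]
  | cons i J ih => rw [List.cons_append, wordProd_cons, wordProd_cons, ih, mul_assoc]

lemma wordProd_singleton (i : b.support) :
    wordProd b [i] = RootPairing.weylGroup.ofIdx P i := List.prod_singleton

variable [Finite ι] [P.IsReduced]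

/-- The positive roots which `w` sends to negative roots. -/
def inversions (w : P.weylGroup) : Finset ι :=
  (Set.toFinite {i | b.IsPos i ∧ ¬ b.IsPos (P.weylGroupToPerm w i)}).toFinset

variable {b}

omit [P.IsReduced] in
lemma mem_inversions {w : P.weylGroup} {i : ι} :
    i ∈ inversions b w ↔ b.IsPos i ∧ ¬ b.IsPos (P.weylGroupToPerm w i) := by
  simp [inversions]

lemma eq_of_isPos_of_not_isPos_reflectionPerm {i j : ι} (hi : b.IsPos i) (hj : j ∈ b.support)
    (h : ¬ b.IsPos (P.reflectionPerm j i)) : i = j := by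
  by_contra hne
  exact h (hi.reflectionPerm hj hne)

open Classical in
/-- How the inversions change on multiplication by a simple reflection from the left. -/
lemma inversions_ofIdx_mul {j : ι} (hj : j ∈ b.support) {w : P.weylGroup}
    (h : b.IsPos (P.weylGroupToPerm w⁻¹ j)) :
    P.weylGroupToPerm w⁻¹ j ∉ inversions b w ∧
    inversions b (RootPairing.weylGroup.ofIdx P j * w) =
      insert (P.weylGroupToPerm w⁻¹ j) (inversions b w) := by
  have hw : P.weylGroupToPerm w (P.weylGroupToPerm w⁻¹ j) = j := by
    rw [← Equiv.Perm.mul_apply, ← map_mul, mul_inv_cancel, map_one, Equiv.Perm.one_apply]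
  have hjp := RootPairing.Base.isPos_of_mem_support hj
  refine ⟨fun h' => (mem_inversions.1 h').2 (by rwa [hw]), ?_⟩
  ext i
  rw [Finset.mem_insert, mem_inversions, mem_inversions, map_mul, Equiv.Perm.mul_apply,
    weylGroupToPerm_ofIdx]
  constructor
  · rintro ⟨h1, h2⟩
    by_cases h3 : b.IsPos (P.weylGroupToPerm w i)
    · left
      have := eq_of_isPos_of_not_isPos_reflectionPerm h3 hj h2
      rw [← this, ← Equiv.Perm.mul_apply, ← map_mul, inv_mul_cancel, map_one,
        Equiv.Perm.one_apply]
    · exact Or.inr ⟨h1, h3⟩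
  · rintro (rfl | ⟨h1, h2⟩)
    · refine ⟨h, ?_⟩
      rw [hw, isPos_neg_iff]
      exact not_not.2 hjp
    · refine ⟨h1, fun h3 => ?_⟩
      have h4 : ¬ b.IsPos (P.reflectionPerm j (P.reflectionPerm j (P.weylGroupToPerm w i))) := by
        rwa [P.reflectionPerm_self]
      have h5 := eq_of_isPos_of_not_isPos_reflectionPerm h3 hj h4
      have h6 : P.weylGroupToPerm w i = P.reflectionPerm j j := by
        rw [← P.reflectionPerm_self j (P.weylGroupToPerm w i), h5]
      have h7 : i = P.reflectionPerm (P.weylGroupToPerm w⁻¹ j) (P.weylGroupToPerm w⁻¹ j) := by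
        rw [← weylGroupToPerm_neg, ← h6, ← Equiv.Perm.mul_apply, ← map_mul, inv_mul_cancel,
          map_one, Equiv.Perm.one_apply]
      rw [h7, isPos_neg_iff] at h1
      exact h1 h

variable (b) in
/-- The length of an element of the Weyl group: the number of its inversions. -/
def weylLength (w : P.weylGroup) : ℕ := (inversions b w).card

lemma weylLength_ofIdx_mul_of_isPos {j : ι} (hj : j ∈ b.support) {w : P.weylGroup}
    (h : b.IsPos (P.weylGroupToPerm w⁻¹ j)) :
    weylLength b (RootPairing.weylGroup.ofIdx P j * w) = weylLength b w + 1 := by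
  classical
  obtain ⟨h1, h2⟩ := inversions_ofIdx_mul hj h
  rw [weylLength, h2, Finset.card_insert_of_notMem h1, weylLength]

lemma weylLength_of_not_isPos {j : ι} (hj : j ∈ b.support) {w : P.weylGroup}
    (h : ¬ b.IsPos (P.weylGroupToPerm w⁻¹ j)) :
    weylLength b w = weylLength b (RootPairing.weylGroup.ofIdx P j * w) + 1 := by
  rw [← weylLength_ofIdx_mul_of_isPos hj, ← mul_assoc, ofIdx_mul_self, one_mul]
  rw [mul_inv_rev, inv_ofIdx, map_mul, Equiv.Perm.mul_apply, weylGroupToPerm_ofIdx,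
    weylGroupToPerm_neg, isPos_neg_iff]
  exact h

omit [P.IsReduced] in
lemma inversions_one : inversions b (1 : P.weylGroup) = ∅ := by
  ext i
  rw [mem_inversions, map_one, Equiv.Perm.one_apply]
  simp

omit [P.IsReduced] in
lemma weylLength_one : weylLength b (1 : P.weylGroup) = 0 := by
  rw [weylLength, inversions_one, Finset.card_empty]

omit [P.IsReduced] in
-- The map α ↦ -wα is a bijection from the inversions of w to those of w⁻¹.
lemma weylLength_inv (w : P.weylGroup) : weylLength b w⁻¹ = weylLength b w := by
  refine Finset.card_bij'
    (fun i _ => P.reflectionPerm (P.weylGroupToPerm w⁻¹ i) (P.weylGroupToPerm w⁻¹ i))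
    (fun i _ => P.reflectionPerm (P.weylGroupToPerm w i) (P.weylGroupToPerm w i)) ?_ ?_ ?_ ?_
  · intro i hi
    rw [mem_inversions] at hi ⊢
    rw [weylGroupToPerm_neg, isPos_neg_iff, isPos_neg_iff, ← Equiv.Perm.mul_apply, ← map_mul,
      mul_inv_cancel, map_one, Equiv.Perm.one_apply, not_not]
    exact ⟨hi.2, hi.1⟩
  · intro i hi
    rw [mem_inversions] at hi ⊢
    rw [weylGroupToPerm_neg, isPos_neg_iff, isPos_neg_iff, ← Equiv.Perm.mul_apply, ← map_mul,
      inv_mul_cancel, map_one, Equiv.Perm.one_apply, not_not]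
    exact ⟨hi.2, hi.1⟩
  · intro i hi
    rw [weylGroupToPerm_neg, weylGroupToPerm_apply_inv, neg_neg_idx]
  · intro i hi
    rw [weylGroupToPerm_neg, weylGroupToPerm_inv_apply, neg_neg_idx]

lemma weylLength_wordProd_le (J : List b.support) : weylLength b (wordProd b J) ≤ J.length := by
  induction J with
  | nil => rw [wordProd_nil, weylLength_one]; exact Nat.zero_le _
  | cons i J ih =>
    rw [wordProd_cons, List.length_cons]
    by_cases h : b.IsPos (P.weylGroupToPerm (wordProd b J)⁻¹ i)
    · rw [weylLength_ofIdx_mul_of_isPos i.2 h]; omega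
    · have := weylLength_of_not_isPos i.2 h; omega

/-- Each letter changes the length by one, up or down. So a word exceeds a reduced word of its
product by an even number of letters. -/
lemma weylLength_wordProd_mod_two (J : List b.support) :
    weylLength b (wordProd b J) % 2 = J.length % 2 := by
  induction J with
  | nil => rw [wordProd_nil, weylLength_one]; rfl
  | cons i J ih =>
    rw [wordProd_cons, List.length_cons]
    by_cases h : b.IsPos (P.weylGroupToPerm (wordProd b J)⁻¹ i)
    · rw [weylLength_ofIdx_mul_of_isPos i.2 h]; omega
    · have := weylLength_of_not_isPos i.2 h; omega

/-- The exchange condition. -/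
lemma exists_wordProd_eq_ofIdx_mul (J : List b.support) (i : b.support)
    (h : ¬ b.IsPos (P.weylGroupToPerm (wordProd b J)⁻¹ i)) :
    ∃ J', wordProd b J' = RootPairing.weylGroup.ofIdx P i * wordProd b J ∧
      J'.length + 1 = J.length := by
  induction J using List.reverseRecOn with
  | nil =>
    rw [wordProd_nil, inv_one, map_one, Equiv.Perm.one_apply] at h
    exact absurd (RootPairing.Base.isPos_of_mem_support i.2) h
  | append_singleton J j ih =>
    rw [wordProd_append, wordProd_singleton, mul_inv_rev, inv_ofIdx, map_mul,
      Equiv.Perm.mul_apply, weylGroupToPerm_ofIdx] at h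
    by_cases hJ : b.IsPos (P.weylGroupToPerm (wordProd b J)⁻¹ i)
    -- Here s_j makes the positive root w⁻¹ α_i negative, w being the product of the word without
    -- its last letter. So this root is α_j, whence s_i w = w s_j, and the last letter can be
    -- dropped.
    · have h1 := eq_of_isPos_of_not_isPos_reflectionPerm hJ j.2 h
      refine ⟨J, ?_, by simp⟩
      have h2 := mul_ofIdx_mul_inv (wordProd b J)⁻¹ (i : ι)
      rw [h1, inv_inv] at h2
      rw [wordProd_append, wordProd_singleton, ← h2]
      have := ofIdx_mul_self (P := P) (i : ι)
      rw [mul_assoc (wordProd b J)⁻¹, mul_inv_cancel_left, ← mul_assoc, this, one_mul]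
    · obtain ⟨J', h1, h2⟩ := ih hJ
      refine ⟨J' ++ [j], ?_, by simpa using h2⟩
      rw [wordProd_append, wordProd_append, h1, mul_assoc]

lemma exists_wordProd_eq_length_eq (J : List b.support) :
    ∃ J', wordProd b J' = wordProd b J ∧ J'.length = weylLength b (wordProd b J) := by
  induction J with
  | nil => exact ⟨[], rfl, by rw [wordProd_nil, weylLength_one]; rfl⟩
  | cons i J ih =>
    obtain ⟨J', h1, h2⟩ := ih
    rw [wordProd_cons]
    by_cases h : b.IsPos (P.weylGroupToPerm (wordProd b J)⁻¹ i)
    · refine ⟨i :: J', by rw [wordProd_cons, h1], ?_⟩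
      rw [weylLength_ofIdx_mul_of_isPos i.2 h, List.length_cons, h2]
    · have h3 := weylLength_of_not_isPos i.2 h
      obtain ⟨K, h4, h5⟩ := exists_wordProd_eq_ofIdx_mul J' i (by rwa [h1])
      exact ⟨K, by rw [h4, h1], by omega⟩

lemma IsReducedWord.length_eq {w : P.weylGroup} {J : List b.support} (h : IsReducedWord b w J) :
    J.length = weylLength b w := by
  obtain ⟨J', h1, h2⟩ := exists_wordProd_eq_length_eq J
  rw [h.1] at h1 h2
  refine le_antisymm (h2 ▸ h.2 J' h1) ?_
  have := weylLength_wordProd_le J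
  rwa [h.1] at this

lemma eq_one_of_weylLength_eq_zero {w : P.weylGroup} {J : List b.support}
    (h : IsReducedWord b w J) (h0 : weylLength b w = 0) : w = 1 := by
  have := h.length_eq
  rw [h0, List.length_eq_zero_iff] at this
  rw [← h.1, this, wordProd_nil]

/-- An element of maximal length makes all positive roots negative. -/
lemma not_isPos_of_forall_weylLength_le {w₀ : P.weylGroup}
    (h : ∀ w, weylLength b w ≤ weylLength b w₀) {i : ι} (hi : b.IsPos i) :
    ¬ b.IsPos (P.weylGroupToPerm w₀ i) := by
  have hs : ∀ j ∈ b.support, ¬ b.IsPos (P.weylGroupToPerm w₀ j) := by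
    intro j hj hp
    have h1 := weylLength_ofIdx_mul_of_isPos (w := w₀⁻¹) hj (by rwa [inv_inv])
    have h2 := h (RootPairing.weylGroup.ofIdx P j * w₀⁻¹)⁻¹
    rw [weylLength_inv, h1, weylLength_inv] at h2
    omega
  refine hi.induction_on_add (p := fun i => ¬ b.IsPos (P.weylGroupToPerm w₀ i)) hs
    (fun i j k hk hi hj => ?_)
  have hk' : P.root (P.weylGroupToPerm w₀ k) =
      P.root (P.weylGroupToPerm w₀ i) + P.root (P.weylGroupToPerm w₀ j) := by
    simp only [← RootPairing.weylGroup_apply_root]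
    rw [hk, smul_add]
  have h1 := hs j hj
  rw [RootPairing.Base.isPos_iff] at hi h1 ⊢
  rw [b.height_add hk']
  omega

/-- As w₀ makes all positive roots negative, its inversions split according to whether v⁻¹ w₀ makes
them negative or positive. The first are the inversions of v⁻¹ w₀; the second correspond under α ↦
-w₀ α to the inversions of v⁻¹. -/
lemma weylLength_inv_mul_add {w₀ : P.weylGroup} (h : ∀ w, weylLength b w ≤ weylLength b w₀)
    (v : P.weylGroup) : weylLength b (v⁻¹ * w₀) + weylLength b v = weylLength b w₀ := by
  classical
  have h' : ∀ w, weylLength b w ≤ weylLength b w₀⁻¹ := fun w => by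
    rw [weylLength_inv]; exact h w
  rw [← weylLength_inv v]
  have h1 : inversions b (v⁻¹ * w₀) =
      (inversions b w₀).filter fun i => ¬ b.IsPos (P.weylGroupToPerm (v⁻¹ * w₀) i) := by
    ext i
    rw [Finset.mem_filter, mem_inversions, mem_inversions]
    exact ⟨fun hi => ⟨⟨hi.1, not_isPos_of_forall_weylLength_le h hi.1⟩, hi.2⟩,
      fun hi => ⟨hi.1.1, hi.2⟩⟩
  have h2 : (inversions b v⁻¹).card =
      ((inversions b w₀).filter fun i => b.IsPos (P.weylGroupToPerm (v⁻¹ * w₀) i)).card := by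
    refine Finset.card_bij'
      (fun i _ => P.reflectionPerm (P.weylGroupToPerm w₀⁻¹ i) (P.weylGroupToPerm w₀⁻¹ i))
      (fun i _ => P.reflectionPerm (P.weylGroupToPerm w₀ i) (P.weylGroupToPerm w₀ i)) ?_ ?_ ?_ ?_
    · intro i hi
      rw [mem_inversions] at hi
      rw [Finset.mem_filter, mem_inversions, weylGroupToPerm_neg, isPos_neg_iff, isPos_neg_iff,
        weylGroupToPerm_neg, isPos_neg_iff, ← Equiv.Perm.mul_apply, ← map_mul,
        mul_inv_cancel, map_one, Equiv.Perm.one_apply, ← Equiv.Perm.mul_apply, ← map_mul,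
        mul_assoc, mul_inv_cancel, mul_one, not_not]
      exact ⟨⟨not_isPos_of_forall_weylLength_le h' hi.1, hi.1⟩, hi.2⟩
    · intro i hi
      rw [Finset.mem_filter, mem_inversions] at hi
      rw [mem_inversions, weylGroupToPerm_neg, isPos_neg_iff, isPos_neg_iff,
        ← Equiv.Perm.mul_apply, ← map_mul, not_not]
      exact ⟨hi.1.2, hi.2⟩
    · intro i hi
      rw [weylGroupToPerm_neg, weylGroupToPerm_apply_inv, neg_neg_idx]
    · intro i hi
      rw [weylGroupToPerm_neg, weylGroupToPerm_inv_apply, neg_neg_idx]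
  rw [weylLength, weylLength, weylLength, h1, h2, add_comm]
  exact Finset.card_filter_add_card_filter_not _

end Weyl
end FormalHecke
end

noncomputable section

namespace FormalHecke

/-! ### Demazure operators on the symmetric algebra. -/

section SymmetricDemazure

variable {ι Λ Λv : Type*} [AddCommGroup Λ] [AddCommGroup Λv] {P : RootPairing ι ℤ Λ Λv}

lemma symReflection_ι (i : ι) (x : Λ) :
    symReflection P i (SymmetricAlgebra.ι ℤ Λ x) = SymmetricAlgebra.ι ℤ Λ (P.reflection i x) := by
  rw [symReflection, SymmetricAlgebra.lift_ι_apply]; rfl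

lemma symDemazure_spec (i : ι) (u : SymmetricAlgebra ℤ Λ) :
    SymmetricAlgebra.ι ℤ Λ (P.root i) * symDemazure P i u = u - symReflection P i u :=
  Classical.choose_spec (exists_symDemazure P i u)

variable [Module.Free ℤ Λ]

instance : IsDomain (SymmetricAlgebra ℤ Λ) :=
  (SymmetricAlgebra.equivMvPolynomial (Module.Free.chooseBasis ℤ Λ)).toMulEquiv.isDomain _

lemma symAlgebra_ι_ne_zero {x : Λ} (hx : x ≠ 0) : SymmetricAlgebra.ι ℤ Λ x ≠ 0 := by
  intro h
  refine hx ((Module.Free.chooseBasis ℤ Λ).forall_coord_eq_zero_iff.1 fun i => ?_)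
  have := congrArg (SymmetricAlgebra.lift ((Module.Free.chooseBasis ℤ Λ).coord i)) h
  rwa [SymmetricAlgebra.lift_ι_apply, map_zero] at this

lemma symDemazure_eq_of_mul_eq {i : ι} {u v : SymmetricAlgebra ℤ Λ}
    (h : SymmetricAlgebra.ι ℤ Λ (P.root i) * v = u - symReflection P i u) :
    symDemazure P i u = v :=
  mul_left_cancel₀ (symAlgebra_ι_ne_zero (P.ne_zero i)) ((symDemazure_spec i u).trans h.symm)

lemma symDemazure_add (i : ι) (u v : SymmetricAlgebra ℤ Λ) :
    symDemazure P i (u + v) = symDemazure P i u + symDemazure P i v :=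
  symDemazure_eq_of_mul_eq (by rw [mul_add, symDemazure_spec, symDemazure_spec, map_add]; ring)

lemma symDemazure_zsmul (i : ι) (c : ℤ) (u : SymmetricAlgebra ℤ Λ) :
    symDemazure P i (c • u) = c • symDemazure P i u :=
  symDemazure_eq_of_mul_eq (by rw [mul_smul_comm, symDemazure_spec, map_zsmul, smul_sub])

lemma symDemazure_algebraMap (i : ι) (c : ℤ) :
    symDemazure P i (algebraMap ℤ (SymmetricAlgebra ℤ Λ) c) = 0 :=
  symDemazure_eq_of_mul_eq (by rw [AlgHom.commutes, sub_self, mul_zero])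

lemma symDemazure_ι_mul (i : ι) (x : Λ) (u : SymmetricAlgebra ℤ Λ) :
    symDemazure P i (SymmetricAlgebra.ι ℤ Λ x * u) =
      SymmetricAlgebra.ι ℤ Λ (P.reflection i x) * symDemazure P i u +
        P.toLinearMap x (P.coroot i) • u := by
  refine symDemazure_eq_of_mul_eq ?_
  rw [map_mul, symReflection_ι, mul_add, mul_left_comm, symDemazure_spec]
  have : SymmetricAlgebra.ι ℤ Λ x = SymmetricAlgebra.ι ℤ Λ (P.reflection i x) +
      P.toLinearMap x (P.coroot i) • SymmetricAlgebra.ι ℤ Λ (P.root i) := by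
    have h : P.reflection i x + P.toLinearMap x (P.coroot i) • P.root i = x := by
      rw [P.reflection_apply]
      simp
    rw [← map_zsmul, ← map_add, h]
  rw [this]
  rw [mul_smul_comm, add_mul, smul_mul_assoc]
  ring

lemma symDemazure_symDemazure (i : ι) (u : SymmetricAlgebra ℤ Λ) :
    symDemazure P i (symDemazure P i u) = 0 := by
  refine symDemazure_eq_of_mul_eq ?_
  have h1 := congrArg (symReflection P i) (symDemazure_spec (P := P) i u)
  have h2 : symReflection P i (symReflection P i u) = u := by
    have : (symReflection P i).comp (symReflection P i) = AlgHom.id ℤ _ := by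
      refine SymmetricAlgebra.algHom_ext (LinearMap.ext fun (x : Λ) => ?_)
      simp [symReflection_ι, P.reflection_same]
    exact DFunLike.congr_fun this u
  rw [map_mul, symReflection_ι, P.reflection_apply_self, map_neg, map_sub, h2, neg_mul] at h1
  have h3 : SymmetricAlgebra.ι ℤ Λ (P.root i) * symReflection P i (symDemazure P i u) =
      SymmetricAlgebra.ι ℤ Λ (P.root i) * symDemazure P i u := by
    rw [symDemazure_spec, ← neg_inj, h1, neg_sub]
  rw [mul_zero, mul_left_cancel₀ (symAlgebra_ι_ne_zero (P.ne_zero i)) h3, sub_self]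

lemma symDemazure_mem_pow (i : ι) (k : ℕ) {u : SymmetricAlgebra ℤ Λ}
    (hu : u ∈ (LinearMap.range (SymmetricAlgebra.ι ℤ Λ)) ^ (k + 1)) :
    symDemazure P i u ∈ (LinearMap.range (SymmetricAlgebra.ι ℤ Λ)) ^ k := by
  induction k generalizing u with
  | zero =>
    rw [zero_add, pow_one] at hu
    obtain ⟨x, rfl⟩ := hu
    have := symDemazure_ι_mul (P := P) i x 1
    rw [mul_one] at this
    rw [this, ← map_one (algebraMap ℤ (SymmetricAlgebra ℤ Λ)), symDemazure_algebraMap, mul_zero,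
      zero_add, pow_zero]
    exact Submodule.smul_mem _ _ (Submodule.one_le.1 le_rfl)
  | succ k ih =>
    rw [pow_succ'] at hu
    induction hu using Submodule.mul_induction_on' with
    | mem_mul_mem m hm n hn =>
      obtain ⟨x, rfl⟩ := hm
      rw [symDemazure_ι_mul]
      refine add_mem ?_ (Submodule.smul_mem _ _ hn)
      rw [pow_succ']
      exact Submodule.mul_mem_mul ⟨_, rfl⟩ (ih hn)
    | add x hx y hy h1 h2 => rw [symDemazure_add]; exact add_mem h1 h2

variable (b : P.Base)

omit [Module.Free ℤ Λ] in
lemma symDemazureWord_nil (u : SymmetricAlgebra ℤ Λ) : symDemazureWord b [] u = u := rfl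

omit [Module.Free ℤ Λ] in
lemma symDemazureWord_cons (i : b.support) (J : List b.support) (u : SymmetricAlgebra ℤ Λ) :
    symDemazureWord b (i :: J) u = symDemazure P i (symDemazureWord b J u) := rfl

omit [Module.Free ℤ Λ] in
lemma symDemazureWord_append (J K : List b.support) (u : SymmetricAlgebra ℤ Λ) :
    symDemazureWord b (J ++ K) u = symDemazureWord b J (symDemazureWord b K u) := by
  induction J with
  | nil => rfl
  | cons i J ih => rw [List.cons_append, symDemazureWord_cons, symDemazureWord_cons, ih]

lemma symDemazureWord_add (J : List b.support) (u v : SymmetricAlgebra ℤ Λ) :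
    symDemazureWord b J (u + v) = symDemazureWord b J u + symDemazureWord b J v := by
  induction J with
  | nil => rfl
  | cons i J ih => simp only [symDemazureWord_cons, ih, symDemazure_add]

lemma symDemazureWord_zsmul (J : List b.support) (c : ℤ) (u : SymmetricAlgebra ℤ Λ) :
    symDemazureWord b J (c • u) = c • symDemazureWord b J u := by
  induction J with
  | nil => rfl
  | cons i J ih => simp only [symDemazureWord_cons, ih, symDemazure_zsmul]

/-- The difference between `Δ_J ∘ x` and `w(x) ∘ Δ_J`, where `w` is the product of `J`. -/
def symCommutator (x : Λ) (u : SymmetricAlgebra ℤ Λ) : List b.support → SymmetricAlgebra ℤ Λ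
  | [] => 0
  | j :: J => P.toLinearMap (wordProd b J • x) (P.coroot j) • symDemazureWord b J u +
      symDemazure P j (symCommutator x u J)

lemma symDemazureWord_ι_mul (J : List b.support) (x : Λ) (u : SymmetricAlgebra ℤ Λ) :
    symDemazureWord b J (SymmetricAlgebra.ι ℤ Λ x * u) =
      SymmetricAlgebra.ι ℤ Λ (wordProd b J • x) * symDemazureWord b J u +
        symCommutator b x u J := by
  induction J with
  | nil => rw [wordProd_nil, one_smul, symCommutator, add_zero]; rfl
  | cons j J ih =>
    rw [symDemazureWord_cons, symDemazureWord_cons, ih, symDemazure_add, symDemazure_ι_mul,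
      symCommutator, wordProd_cons, mul_smul, add_assoc]
    rfl

variable [Finite ι] [P.IsReduced]

/-- Moving x past Δ_K leaves one term per deleted letter. Deleting a letter j followed by a tail
with product w changes the product of K into itself times s_β, with β = w⁻¹ α_j, so the term depends
only on β. If β is negative, then -β is an inversion that this letter removes, and the sign of the
coroot makes the two terms cancel. Thus the sum depends on K only through its product. -/
lemma symDemazureWord_symCommutator (h : P.weylGroup → SymmetricAlgebra ℤ Λ) (x : Λ)
    (u : SymmetricAlgebra ℤ Λ) (n : ℕ)
    (hn : ∀ J : List b.support, J.length + 1 = n → symDemazureWord b J u = h (wordProd b J))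
    (K : List b.support) : ∀ J : List b.support, J.length + K.length = n →
    symDemazureWord b J (symCommutator b x u K) = ∑ i ∈ inversions b (wordProd b K),
      P.toLinearMap x (P.coroot i) •
        h (wordProd b J * wordProd b K * RootPairing.weylGroup.ofIdx P i) := by
  classical
  induction K with
  | nil =>
    intro J hJ
    rw [wordProd_nil, inversions_one, Finset.sum_empty, symCommutator]
    simpa using symDemazureWord_zsmul b J 0 0
  | cons j K ih =>
    intro J hJ
    rw [List.length_cons] at hJ
    have h1 := ih (J ++ [j]) (by simp; omega)
    rw [symCommutator, symDemazureWord_add, symDemazureWord_zsmul]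
    rw [symDemazureWord_append, wordProd_append, wordProd_singleton,
      symDemazureWord_cons, symDemazureWord_nil] at h1
    rw [h1, ← symDemazureWord_append, hn _ (by simp; omega), wordProd_append, wordProd_cons]
    set w := wordProd b K with hw
    have h2 : P.toLinearMap (w • x) (P.coroot j) =
        P.toLinearMap x (P.coroot (P.weylGroupToPerm w⁻¹ j)) := by
      have := toLinearMap_smul_coroot w x (P.weylGroupToPerm w⁻¹ j)
      rwa [weylGroupToPerm_apply_inv] at this
    have h3 : wordProd b J * (RootPairing.weylGroup.ofIdx P j * w) *
        RootPairing.weylGroup.ofIdx P (P.weylGroupToPerm w⁻¹ j) = wordProd b J * w := by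
      have h6 := ofIdx_mul_self (P := P) (j : ι)
      rw [← mul_ofIdx_mul_inv, inv_inv]
      calc _ = wordProd b J * ((RootPairing.weylGroup.ofIdx P j *
            RootPairing.weylGroup.ofIdx P j) * w) := by group
        _ = _ := by rw [h6, one_mul]
    rw [mul_assoc (wordProd b J)]
    by_cases hpos : b.IsPos (P.weylGroupToPerm w⁻¹ j)
    · obtain ⟨h4, h5⟩ := inversions_ofIdx_mul j.2 hpos
      rw [h5, Finset.sum_insert h4, h2, h3]
    · have hneg : P.weylGroupToPerm (RootPairing.weylGroup.ofIdx P j * w)⁻¹ j =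
          P.reflectionPerm (P.weylGroupToPerm w⁻¹ j) (P.weylGroupToPerm w⁻¹ j) := by
        rw [mul_inv_rev, inv_ofIdx, map_mul, Equiv.Perm.mul_apply, weylGroupToPerm_ofIdx,
          weylGroupToPerm_neg]
      have hpos' : b.IsPos (P.weylGroupToPerm (RootPairing.weylGroup.ofIdx P j * w)⁻¹ j) := by
        rw [hneg, isPos_neg_iff]
        exact hpos
      obtain ⟨h4, h5⟩ := inversions_ofIdx_mul j.2 hpos'
      rw [← mul_assoc, ofIdx_mul_self, one_mul] at h5
      have h7 : RootPairing.weylGroup.ofIdx P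
          (P.reflectionPerm (P.weylGroupToPerm w⁻¹ j) (P.weylGroupToPerm w⁻¹ j)) =
          RootPairing.weylGroup.ofIdx P (P.weylGroupToPerm w⁻¹ j) := by
        rw [← weylGroupToPerm_ofIdx, ← mul_ofIdx_mul_inv, mul_assoc, mul_inv_cancel, mul_one]
      rw [h5, Finset.sum_insert h4, hneg, h7, h3, P.coroot_reflectionPerm,
        P.coreflection_apply_self, h2, map_neg, neg_smul]
      abel

/-- This replaces braid relations, and the words need not be reduced. By induction on the length,
the two operators have the same commutator with every linear form, and both kill 1; the algebra is
generated by linear forms, so they agree. -/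
theorem symDemazureWord_eq_of_wordProd_eq (n : ℕ) : ∀ J K : List b.support,
    J.length = n → K.length = n → wordProd b J = wordProd b K → ∀ u,
      symDemazureWord b J u = symDemazureWord b K u := by
  classical
  induction n with
  | zero =>
    intro J K hJ hK _ u
    rw [List.length_eq_zero_iff.1 hJ, List.length_eq_zero_iff.1 hK]
  | succ n ih =>
    intro J K hJ hK hJK u
    have hC : ∀ x v, symCommutator b x v J = symCommutator b x v K := by
      intro x v
      -- By the induction hypothesis the operator of a word of n letters is a function of its
      -- product. The value 0 at elements that are no such product is never used.
      let h : P.weylGroup → SymmetricAlgebra ℤ Λ := fun w =>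
        if hw : ∃ L : List b.support, L.length = n ∧ wordProd b L = w then
          symDemazureWord b hw.choose v else 0
      have hh : ∀ L : List b.support, L.length + 1 = n + 1 →
          symDemazureWord b L v = h (wordProd b L) := by
        intro L hL
        have hw : ∃ L' : List b.support, L'.length = n ∧ wordProd b L' = wordProd b L :=
          ⟨L, by omega, rfl⟩
        rw [show h (wordProd b L) = symDemazureWord b hw.choose v from dif_pos hw]
        exact ih _ _ (by omega) hw.choose_spec.1 hw.choose_spec.2.symm v
      have h1 := symDemazureWord_symCommutator b h x v (n + 1) hh J [] (by simpa using hJ)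
      have h2 := symDemazureWord_symCommutator b h x v (n + 1) hh K [] (by simpa using hK)
      rw [← hJK] at h2
      exact h1.trans h2.symm
    have h0 : ∀ L : List b.support, L.length = n + 1 → symDemazureWord b L 1 = 0 := by
      intro L hL
      induction L using List.reverseRecOn with
      | nil => simp at hL
      | append_singleton L i _ =>
        rw [symDemazureWord_append, symDemazureWord_cons, symDemazureWord_nil,
          ← map_one (algebraMap ℤ (SymmetricAlgebra ℤ Λ)), symDemazure_algebraMap]
        simpa using symDemazureWord_zsmul b L 0 0
    have key : ∀ u v, symDemazureWord b J v = symDemazureWord b K v →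
        symDemazureWord b J (u * v) = symDemazureWord b K (u * v) := by
      intro u
      induction u using SymmetricAlgebra.induction with
      | algebraMap r =>
        intro v hv
        rw [← Algebra.smul_def, symDemazureWord_zsmul, symDemazureWord_zsmul, hv]
      | ι x =>
        intro v hv
        rw [symDemazureWord_ι_mul, symDemazureWord_ι_mul, hv, hJK, hC]
      | mul a c ha hc =>
        intro v hv
        rw [mul_assoc]
        exact ha _ (hc _ hv)
      | add a c ha hc =>
        intro v hv
        rw [add_mul, symDemazureWord_add, symDemazureWord_add, ha _ hv, hc _ hv]
    have := key u 1 (by rw [h0 J hJ, h0 K hK])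
    rwa [mul_one] at this

/-- By parity a reduced word of the same product can be padded with an even number of copies of one
letter to the given length. The padded word has the same operator, which vanishes because Δ_i² = 0.
-/
theorem symDemazureWord_eq_zero {J : List b.support}
    (h : weylLength b (wordProd b J) < J.length) (u : SymmetricAlgebra ℤ Λ) :
    symDemazureWord b J u = 0 := by
  obtain ⟨K, h1, h2⟩ := exists_wordProd_eq_length_eq J
  have h3 := weylLength_wordProd_mod_two J
  obtain ⟨m, hm⟩ : ∃ m, J.length = K.length + 2 * (m + 1) :=
    ⟨(J.length - K.length) / 2 - 1, by omega⟩
  obtain ⟨i, _⟩ : ∃ i, i ∈ J := List.exists_mem_of_length_pos (by omega)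
  have h4 : ∀ m, wordProd b (List.replicate (2 * m) i) = 1 := by
    intro m
    induction m with
    | zero => rfl
    | succ m ih =>
      rw [Nat.mul_succ, List.replicate_succ, List.replicate_succ, wordProd_cons, wordProd_cons, ih,
        mul_one, ofIdx_mul_self]
  rw [symDemazureWord_eq_of_wordProd_eq b J.length J (K ++ List.replicate (2 * (m + 1)) i) rfl
    (by rw [List.length_append, List.length_replicate, hm])
    (by rw [wordProd_append, h4, mul_one, h1]), symDemazureWord_append, Nat.mul_succ,
    List.replicate_succ, List.replicate_succ, symDemazureWord_cons, symDemazureWord_cons,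
    symDemazure_symDemazure]
  simpa using symDemazureWord_zsmul b K 0 0

end SymmetricDemazure
end FormalHecke
end

noncomputable section

open MvPowerSeries Finsupp

namespace FormalHecke

/-! ### Divisibility by the variables of a formal group algebra. -/

section Divisibility

variable {R : Type*} [CommRing R] (F : FormalGroup R) [F.IsComm]
variable {M σ : Type*} [AddCommGroup M] [Finite σ] (e : Module.Basis σ ℤ M)

open Classical in
/-- The endomorphism of `M` which kills one element of a basis and fixes the other ones. -/
def killBasis (i : σ) : M →+ M := (e.constr ℤ (Function.update e i 0)).toAddMonoidHom

omit [Finite σ] in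
lemma killBasis_self (i : σ) : killBasis e i (e i) = 0 := by
  classical
  exact (e.constr_basis ℤ _ i).trans (Function.update_self ..)

omit [Finite σ] in
lemma killBasis_of_ne {i j : σ} (h : j ≠ i) : killBasis e i (e j) = e j := by
  classical
  exact (e.constr_basis ℤ _ j).trans (Function.update_of_ne h ..)

/-- Killing e_i amounts to setting the variable x_{e i} to zero, and this changes an element only by
a multiple of that variable. Divisibility thereby becomes the vanishing of a ring homomorphism,
which the cancellation lemmas use. -/
lemma FGA.x_basis_dvd_iff (i : σ) (u : FGA F M) :
    FGA.x F (e i) ∣ u ↔ FGA.map F (killBasis e i) u = 0 := by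
  constructor
  · rintro ⟨v, rfl⟩
    rw [map_mul, FGA.map_x, killBasis_self, FGA.x_zero, zero_mul]
  · intro h
    have := FGA.x_dvd_sub_map F e i (killBasis e i) (killBasis_self e i)
      (fun j hj => killBasis_of_ne e hj) u
    rwa [h, sub_zero] at this

lemma FGA.x_basis_dvd_sub_map (i : σ) (f : M →+ M)
    (h : (killBasis e i).comp f = killBasis e i) (u : FGA F M) :
    FGA.x F (e i) ∣ u - FGA.map F f u := by
  rw [FGA.x_basis_dvd_iff, map_sub, FGA.map_map, h, sub_self]

lemma FGA.isRegular_of_equiv {u : FGA F M} (h : IsRegular (FGA.equiv F e u)) : IsRegular u := by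
  rw [isRegular_iff_mem_nonZeroDivisors, mem_nonZeroDivisors_iff_right] at h ⊢
  intro v hv
  refine (FGA.equiv F e).injective ?_
  rw [map_zero]
  exact h _ (by rw [← map_mul, hv, map_zero])

lemma FGA.isRegular_x_basis (i : σ) : IsRegular (FGA.x F (e i)) := by
  refine FGA.isRegular_of_equiv F e ?_
  rw [FGA.equiv_x_basis, isRegular_iff_mem_nonZeroDivisors]
  exact MvPowerSeries.X_mem_nonzeroDivisors

include e in
lemma FGA.isRegular_of_sub_mem_filt {u : FGA F M} {r : R} (hr : IsRegular r)
    (h : u - algebraMap R _ r ∈ FGA.filt F M 1) : IsRegular u := by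
  refine FGA.isRegular_of_equiv F e ?_
  rw [FGA.mem_filt_iff F e, mem_orderIdeal_one, map_sub, map_sub, AlgEquiv.commutes,
    MvPowerSeries.algebraMap_apply, constantCoeff_C, sub_eq_zero] at h
  rw [isRegular_iff_mem_nonZeroDivisors]
  refine MvPowerSeries.mem_nonZeroDivisors_of_constantCoeff ?_
  rw [h]
  exact isRegular_iff_mem_nonZeroDivisors.1 hr

/-- An element with regular constant term keeps that constant term when a variable is set to zero,
hence stays regular there and can be cancelled. -/
lemma FGA.x_basis_dvd_of_dvd_mul (i : σ) {u v : FGA F M} {r : R} (hr : IsRegular r)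
    (h : u - algebraMap R _ r ∈ FGA.filt F M 1) (hd : FGA.x F (e i) ∣ u * v) :
    FGA.x F (e i) ∣ v := by
  rw [FGA.x_basis_dvd_iff, map_mul] at hd
  rw [FGA.x_basis_dvd_iff]
  refine (FGA.isRegular_of_sub_mem_filt F e hr ?_).left (hd.trans (mul_zero _).symm)
  have := FGA.map_mem_filt F (killBasis e i) h
  rwa [map_sub, AlgHom.commutes] at this

lemma FGA.x_basis_dvd_of_dvd_x_mul {i j : σ} (hij : j ≠ i) {v : FGA F M}
    (hd : FGA.x F (e i) ∣ FGA.x F (e j) * v) : FGA.x F (e i) ∣ v := by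
  rw [FGA.x_basis_dvd_iff, map_mul, FGA.map_x, killBasis_of_ne e hij] at hd
  rw [FGA.x_basis_dvd_iff]
  exact (FGA.isRegular_x_basis F e j).left (hd.trans (mul_zero _).symm)

omit [Finite σ] in
lemma X_mul_mem_orderIdeal_iff {i : σ} {k : ℕ} {f : MvPowerSeries σ R} :
    X i * f ∈ orderIdeal σ R (k + 1) ↔ f ∈ orderIdeal σ R k := by
  classical
  constructor
  · intro h d hd
    have := h (single i 1 + d) (by rw [map_add, degree_single]; omega)
    rwa [X, coeff_add_monomial_mul, one_mul] at this
  · intro h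
    rw [add_comm]
    exact mul_mem_orderIdeal (X_mem_orderIdeal i) h

lemma FGA.mem_filt_of_x_basis_mul_mem {i : σ} {k : ℕ} {u : FGA F M}
    (h : FGA.x F (e i) * u ∈ FGA.filt F M (k + 1)) : u ∈ FGA.filt F M k := by
  rw [FGA.mem_filt_iff F e, map_mul, FGA.equiv_x_basis, X_mul_mem_orderIdeal_iff] at h
  rwa [FGA.mem_filt_iff F e]

include e in
lemma FGA.mul_mem_filt {k l : ℕ} {u v : FGA F M} (hu : u ∈ FGA.filt F M k)
    (hv : v ∈ FGA.filt F M l) : u * v ∈ FGA.filt F M (k + l) := by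
  rw [FGA.mem_filt_iff F e] at *
  rw [map_mul]
  exact mul_mem_orderIdeal hu hv

include e in
lemma FGA.filt_anti {k l : ℕ} (h : k ≤ l) : FGA.filt F M l ≤ FGA.filt F M k := by
  intro u hu
  rw [FGA.mem_filt_iff F e] at *
  exact orderIdeal_anti h hu

include e in
lemma FGA.mem_filt_zero (u : FGA F M) : u ∈ FGA.filt F M 0 :=
  (FGA.mem_filt_iff F e).2 (mem_orderIdeal_zero _)

include e in
lemma FGA.x_mem_filt_one (m : M) : FGA.x F m ∈ FGA.filt F M 1 := by
  rw [FGA.mem_filt_iff F e, mem_orderIdeal_one, FGA.constantCoeff_equiv_x]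

/-- A linear approximation of `m ↦ x_m`. -/
def FGA.linear : M →ₗ[ℤ] FGA F M :=
  ((FGA.equiv F e).symm.toLinearMap.restrictScalars ℤ) ∘ₗ linearForm e R

lemma FGA.x_sub_linear_mem (m : M) : FGA.x F m - FGA.linear F e m ∈ FGA.filt F M 2 := by
  rw [FGA.mem_filt_iff F e, map_sub]
  have : FGA.equiv F e (FGA.linear F e m) = linearForm e R m := AlgEquiv.apply_symm_apply _ _
  rw [this]
  exact FGA.equiv_x_sub_linearForm_mem F e m

end Divisibility

/-! ### Roots as members of lattice bases. -/

section BasisOfRoot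

variable {ι Λ Λv : Type*} [AddCommGroup Λ] [AddCommGroup Λv] (P : RootPairing ι ℤ Λ Λv)
variable [Module.Free ℤ Λ] [Module.Finite ℤ Λ]

/-- A root, or the half of it, is a member of a basis. -/
lemma exists_basis_root (i : ι) : ∃ (n : ℕ) (e : Module.Basis (Fin n) ℤ Λ) (j : Fin n),
    P.root i = e j ∨ P.root i = e j + e j := by
  obtain ⟨n, s⟩ := Submodule.smithNormalForm (Module.finBasis ℤ Λ) (ℤ ∙ P.root i)
  have hmem : P.root i ∈ ℤ ∙ P.root i := Submodule.mem_span_singleton_self _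
  have hne : P.root i ≠ 0 := P.ne_zero i
  have hn : n = 1 := by
    have h1 := Module.finrank_eq_card_basis s.bN
    rw [Fintype.card_fin, ← (LinearEquiv.toSpanNonzeroSingleton ℤ Λ _ hne).finrank_eq,
      Module.finrank_self] at h1
    exact h1.symm
  subst hn
  have h1 := congrArg Subtype.val (s.bN.sum_repr ⟨_, hmem⟩)
  rw [Fin.sum_univ_one, Submodule.coe_smul, s.snf, smul_smul] at h1
  set c := (s.bN.repr ⟨_, hmem⟩) 0 * s.a 0 with hc
  have h1 : c • s.bM (s.f 0) = P.root i := h1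
  have h2 := P.root_coroot_two i
  rw [← h1, map_smul, LinearMap.smul_apply, smul_eq_mul] at h2
  -- The Smith normal form gives α = c e with e in a basis. Pairing with the coroot yields c ∣ 2; a
  -- negative sign is absorbed by negating the basis.
  have h3 : c ∣ 2 := ⟨_, h2.symm⟩
  have h4 : c.natAbs = 1 ∨ c.natAbs = 2 :=
    (Nat.dvd_prime Nat.prime_two).1 (Int.natAbs_dvd_natAbs.2 h3)
  rcases h4 with h4 | h4 <;> rcases Int.natAbs_eq c with h5 | h5 <;> rw [h4] at h5 <;>
    rw [h5] at h1
  · exact ⟨_, s.bM, s.f 0, Or.inl (h1.symm.trans (by simp))⟩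
  · exact ⟨_, s.bM.map (LinearEquiv.neg ℤ), s.f 0, Or.inl (h1.symm.trans (by simp))⟩
  · exact ⟨_, s.bM, s.f 0, Or.inr (h1.symm.trans (by simp [two_smul]))⟩
  · exact ⟨_, s.bM.map (LinearEquiv.neg ℤ), s.f 0, Or.inr (h1.symm.trans (by simp [two_smul]))⟩

variable {P}
omit [Module.Free ℤ Λ] [Module.Finite ℤ Λ]

/-- A basis of `ℤ × Λ` made of `(1, -β)` and the `(0, e j)`. -/
def prodBasis {n : ℕ} (e : Module.Basis (Fin n) ℤ Λ) (β : Λ) :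
    Module.Basis (Unit ⊕ Fin n) ℤ (ℤ × Λ) :=
  ((Module.Basis.singleton Unit ℤ).prod e).map
    { toFun := fun p => (p.1, p.2 - p.1 • β)
      invFun := fun p => (p.1, p.2 + p.1 • β)
      map_add' := fun p q => by ext <;> simp [add_smul]; abel
      map_smul' := fun c p => by ext <;> simp [smul_sub, mul_smul]
      left_inv := fun p => by simp
      right_inv := fun p => by simp }

lemma prodBasis_inl {n : ℕ} (e : Module.Basis (Fin n) ℤ Λ) (β : Λ) :
    prodBasis e β (Sum.inl ()) = (1, -β) := by
  simp [prodBasis]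

lemma prodBasis_inr {n : ℕ} (e : Module.Basis (Fin n) ℤ Λ) (β : Λ) (j : Fin n) :
    prodBasis e β (Sum.inr j) = (0, e j) := by
  simp [prodBasis]

end BasisOfRoot

/-! ### Formal Demazure operators on S and their leading terms. -/

section FormalDemazure

variable {R : Type*} [CommRing R] (F : FormalGroup R)
variable {ι Λ Λv : Type*} [AddCommGroup Λ] [AddCommGroup Λv] (P : RootPairing ι ℤ Λ Λv)

/-- The filtration of `S` by the powers of the augmentation ideal. -/
def S.filt (k : ℕ) : Ideal (S F P) := FGA.filt F (ℤ × Λ) k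

variable {F P} in
lemma S.smul_mem_filt (w : P.weylGroup) {k : ℕ} {u : S F P} (h : u ∈ S.filt F P k) :
    w • u ∈ S.filt F P k :=
  FGA.map_mem_filt F (weylHom P w) h

variable [F.IsComm] [Module.Free ℤ Λ] [Module.Finite ℤ Λ]

lemma S.mul_mem_filt {k l : ℕ} {u v : S F P} (hu : u ∈ S.filt F P k)
    (hv : v ∈ S.filt F P l) : u * v ∈ S.filt F P (k + l) :=
  FGA.mul_mem_filt F (Module.finBasis ℤ (ℤ × Λ)) hu hv

lemma S.filt_anti {k l : ℕ} (h : k ≤ l) : S.filt F P l ≤ S.filt F P k :=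
  FGA.filt_anti F (Module.finBasis ℤ (ℤ × Λ)) h

lemma S.mem_filt_zero (u : S F P) : u ∈ S.filt F P 0 :=
  FGA.mem_filt_zero F (Module.finBasis ℤ (ℤ × Λ)) u

variable {P} (h2 : ∀ i, (∃ m : Λ, P.root i = m + m) → IsUnit (2 : R))

include h2 in
/-- `x_α` is, up to a unit, the variable attached to a member of a basis of `Λ`. -/
lemma S.exists_xRoot_eq (i : ι) : ∃ (n : ℕ) (e : Module.Basis (Fin n) ℤ Λ) (j : Fin n),
    Associated (S.x F P (0, e j)) (S.xRoot F P i) ∧ ∃ c : ℤ, P.root i = c • e j := by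
  obtain ⟨n, e, j, h | h⟩ := exists_basis_root P i
  · exact ⟨n, e, j, by rw [S.xRoot, h], 1, by rw [h, one_smul]⟩
  · refine ⟨n, e, j, ?_, 2, by rw [h, two_smul]⟩
    obtain ⟨v, hv, hx⟩ := FGA.exists_isUnit_x_add_self F (Module.finBasis ℤ (ℤ × Λ))
      (h2 i ⟨_, h⟩) (0, e j)
    refine ⟨hv.unit, ?_⟩
    rw [S.xRoot, h]
    refine hx.symm.trans ?_
    rw [Prod.mk_add_mk, zero_add]
    rfl

include h2 in
lemma S.isRegular_xRoot (i : ι) : IsRegular (S.xRoot F P i) := by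
  obtain ⟨n, e, j, ⟨v, hv⟩, _⟩ := S.exists_xRoot_eq F h2 i
  rw [← hv, ← prodBasis_inr e 0]
  exact IsRegular.mul (FGA.isRegular_x_basis F (prodBasis e 0) _) v.isUnit.isRegular

include h2 in
-- The reflection moves a lattice element by a multiple of α, which is itself a multiple of e_j. So
-- it becomes the identity once e_j is killed, that is, modulo x_{e j}.
lemma S.xRoot_dvd_sub_smul (i : ι) (u : S F P) :
    S.xRoot F P i ∣ u - RootPairing.weylGroup.ofIdx P i • u := by
  obtain ⟨n, e, j, h, c, hc⟩ := S.exists_xRoot_eq F h2 i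
  rw [← h.dvd_iff_dvd_left, ← prodBasis_inr e 0]
  refine FGA.x_basis_dvd_sub_map F (prodBasis e 0) _ (weylHom P _) ?_ u
  have h0 : killBasis (prodBasis e 0) (Sum.inr j) (0, P.root i) = 0 := by
    have := killBasis_self (prodBasis e 0) (Sum.inr j)
    rw [prodBasis_inr] at this
    rw [hc, show ((0 : ℤ), c • e j) = c • ((0 : ℤ), e j) by simp, map_zsmul, this, smul_zero]
  refine AddMonoidHom.ext fun p => ?_
  have h1 : weylHom P (RootPairing.weylGroup.ofIdx P i) p =
      p - P.toLinearMap p.2 (P.coroot i) • ((0 : ℤ), P.root i) := by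
    refine Prod.ext ?_ ?_
    · simp [weylHom]
    · exact (P.reflection_apply i p.2).trans (by simp)
  rw [AddMonoidHom.comp_apply, h1, map_sub, map_zsmul, h0, smul_zero, sub_zero]

include h2 in
lemma S.mem_filt_of_xRoot_mul_mem {i : ι} {k : ℕ} {u : S F P}
    (h : S.xRoot F P i * u ∈ S.filt F P (k + 1)) : u ∈ S.filt F P k := by
  obtain ⟨n, e, j, ⟨v, hv⟩, _⟩ := S.exists_xRoot_eq F h2 i
  rw [← hv, mul_assoc, ← prodBasis_inr e 0] at h
  have h3 : (v : S F P) * u ∈ S.filt F P k := FGA.mem_filt_of_x_basis_mul_mem F (prodBasis e 0) h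
  exact (Ideal.unit_mul_mem_iff_mem _ v.isUnit).1 h3

include h2 in
lemma S.xRoot_dvd_of_dvd_mul {i : ι} {u v : S F P} {r : R} (hr : IsRegular r)
    (h : u - algebraMap R _ r ∈ S.filt F P 1) (hd : S.xRoot F P i ∣ u * v) :
    S.xRoot F P i ∣ v := by
  obtain ⟨n, e, j, h1, _⟩ := S.exists_xRoot_eq F h2 i
  rw [← h1.dvd_iff_dvd_left, ← prodBasis_inr e 0] at hd ⊢
  exact FGA.x_basis_dvd_of_dvd_mul F (prodBasis e 0) _ hr h hd

/-- Since γ = (γ - α) + α, the difference x_γ - x_α is x_{γ-α} times a unit, and γ - α is a vector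
of `prodBasis`. -/
lemma S.associated_xGamma_sub_xRoot (i : ι) :
    Associated (S.x F P (1, -P.root i)) (S.xGamma F P - S.xRoot F P i) := by
  obtain ⟨v, hv, h⟩ := FGA.exists_isUnit_x_add_sub F (Module.finBasis ℤ (ℤ × Λ))
    (1, -P.root i) (0, P.root i)
  refine ⟨hv.unit, h.symm.trans ?_⟩
  rw [Prod.mk_add_mk, add_zero, neg_add_cancel]
  rfl

lemma S.isRegular_xGamma_sub_xRoot (i : ι) : IsRegular (S.xGamma F P - S.xRoot F P i) := by
  obtain ⟨v, hv⟩ := S.associated_xGamma_sub_xRoot F (P := P) i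
  rw [← hv, ← prodBasis_inl (Module.finBasis ℤ Λ)]
  exact IsRegular.mul (FGA.isRegular_x_basis F (prodBasis (Module.finBasis ℤ Λ) (P.root i)) _)
    v.isUnit.isRegular

include h2 in
-- Up to units, x_γ - x_{α_i} and x_{α_j} are two different variables for one basis of Γ ⊕ Λ, namely
-- a basis of Λ adapted to α_j together with γ - α_i.
lemma S.xGamma_sub_xRoot_dvd_of_dvd_mul {i j : ι} {u : S F P}
    (h : S.xGamma F P - S.xRoot F P i ∣ S.xRoot F P j * u) :
    S.xGamma F P - S.xRoot F P i ∣ u := by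
  obtain ⟨n, e, k, ⟨v, hv⟩, _⟩ := S.exists_xRoot_eq F h2 j
  rw [← (S.associated_xGamma_sub_xRoot F i).dvd_iff_dvd_left, ← prodBasis_inl e] at h ⊢
  rw [← hv, mul_assoc, ← prodBasis_inr e (P.root i)] at h
  have h3 : S.x F P (prodBasis e (P.root i) (Sum.inl ())) ∣ v * u :=
    FGA.x_basis_dvd_of_dvd_x_mul F (prodBasis e (P.root i)) (by simp) h
  exact (v.isUnit.dvd_mul_left).1 h3

variable (P) in
open Classical in
/-- The formal Demazure operator `u ↦ (u - s_α u) / x_α` on `S`. -/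
def S.demazure (i : ι) (u : S F P) : S F P :=
  if h : S.xRoot F P i ∣ u - RootPairing.weylGroup.ofIdx P i • u then h.choose else 0

include h2 in
lemma S.demazure_spec (i : ι) (u : S F P) :
    S.xRoot F P i * S.demazure F P i u = u - RootPairing.weylGroup.ofIdx P i • u := by
  have h := S.xRoot_dvd_sub_smul F h2 i u
  rw [S.demazure, dif_pos h]
  exact h.choose_spec.symm

variable (P) in
/-- A linear approximation of `λ ↦ x_λ`. -/
def S.linear : Λ →ₗ[ℤ] S F P :=
  AddMonoidHom.toIntLinearMap
    { toFun := fun l => FGA.linear F (Module.finBasis ℤ (ℤ × Λ)) (0, l)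
      map_zero' := map_zero (FGA.linear F (Module.finBasis ℤ (ℤ × Λ)))
      map_add' := fun l m => by
        refine Eq.trans ?_ (map_add (FGA.linear F (Module.finBasis ℤ (ℤ × Λ))) (0, l) (0, m))
        rw [Prod.mk_add_mk, zero_add] }

variable (P) in
/-- An algebra map `Sym Λ → S` which approximates `x ↦ x_λ`. -/
def S.symHom : SymmetricAlgebra ℤ Λ →ₐ[ℤ] S F P :=
  SymmetricAlgebra.lift (S.linear F P)

lemma S.x_sub_symHom_ι_mem (l : Λ) :
    S.x F P (0, l) - S.symHom F P (SymmetricAlgebra.ι ℤ Λ l) ∈ S.filt F P 2 := by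
  rw [S.symHom, SymmetricAlgebra.lift_ι_apply]
  exact FGA.x_sub_linear_mem F (Module.finBasis ℤ (ℤ × Λ)) (0, l)

lemma S.x_mem_filt_one (l : ℤ × Λ) : S.x F P l ∈ S.filt F P 1 :=
  FGA.x_mem_filt_one F (Module.finBasis ℤ (ℤ × Λ)) l

lemma S.symHom_ι_mem (l : Λ) : S.symHom F P (SymmetricAlgebra.ι ℤ Λ l) ∈ S.filt F P 1 := by
  have h := sub_mem (S.x_mem_filt_one F (P := P) (0, l))
    (S.filt_anti F P one_le_two (S.x_sub_symHom_ι_mem F l))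
  rwa [sub_sub_cancel] at h

lemma S.symHom_mem_filt {k : ℕ} {f : SymmetricAlgebra ℤ Λ}
    (hf : f ∈ (LinearMap.range (SymmetricAlgebra.ι ℤ Λ)) ^ k) :
    S.symHom F P f ∈ S.filt F P k := by
  induction k generalizing f with
  | zero => exact S.mem_filt_zero F P _
  | succ k ih =>
    rw [pow_succ'] at hf
    induction hf using Submodule.mul_induction_on' with
    | mem_mul_mem m hm n hn =>
      obtain ⟨x, rfl⟩ := hm
      rw [map_mul, add_comm]
      exact S.mul_mem_filt F P (S.symHom_ι_mem F x) (ih hn)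
    | add x hx y hy h1 h2 => rw [map_add]; exact add_mem h1 h2

/-- `S.symHom` need not be equivariant. On linear forms it is so up to order two, because s_i x_λ =
x_{s_i λ}, and the product rule keeps the error one order above the degree. -/
lemma S.smul_symHom_sub_mem (i : ι) {k : ℕ} {f : SymmetricAlgebra ℤ Λ}
    (hf : f ∈ (LinearMap.range (SymmetricAlgebra.ι ℤ Λ)) ^ k) :
    RootPairing.weylGroup.ofIdx P i • S.symHom F P f - S.symHom F P (symReflection P i f) ∈
      S.filt F P (k + 1) := by
  induction k generalizing f with
  | zero =>
    rw [pow_zero] at hf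
    obtain ⟨c, rfl⟩ := Submodule.mem_one.1 hf
    rw [AlgHom.commutes, AlgHom.commutes, eq_intCast, AlgHom.commutes, eq_intCast,
      ← MulSemiringAction.toRingHom_apply, map_intCast, sub_self]
    exact zero_mem _
  | succ k ih =>
    rw [pow_succ'] at hf
    induction hf using Submodule.mul_induction_on' with
    | mem_mul_mem m hm n hn =>
      obtain ⟨x, rfl⟩ := hm
      have h1 := S.smul_mem_filt (RootPairing.weylGroup.ofIdx P i) (S.symHom_mem_filt F (P := P) hn)
      have h2 : RootPairing.weylGroup.ofIdx P i • S.symHom F P (SymmetricAlgebra.ι ℤ Λ x) -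
          S.symHom F P (symReflection P i (SymmetricAlgebra.ι ℤ Λ x)) ∈ S.filt F P 2 := by
        have h3 := S.smul_mem_filt (RootPairing.weylGroup.ofIdx P i)
          (S.x_sub_symHom_ι_mem F (P := P) x)
        have h4 := S.x_sub_symHom_ι_mem F (P := P) (P.reflection i x)
        rw [smul_sub, S.smul_x] at h3
        rw [symReflection_ι]
        have h5 := sub_mem h4 h3
        rwa [show RootPairing.weylGroup.ofIdx P i • x = P.reflection i x from rfl,
          sub_sub_sub_cancel_left] at h5
      have h3 := S.mul_mem_filt F P h2 h1
      have h4 := S.mul_mem_filt F P (S.symHom_ι_mem F (P := P) (P.reflection i x)) (ih hn)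
      rw [show 2 + k = k + 1 + 1 by omega] at h3
      rw [show 1 + (k + 1) = k + 1 + 1 by omega, ← symReflection_ι] at h4
      have h5 := add_mem h3 h4
      rw [map_mul, map_mul, map_mul, smul_mul']
      convert h5 using 1
      ring
    | add x hx y hy h1 h2 =>
      rw [map_add, map_add, map_add, smul_add, add_sub_add_comm]; exact add_mem h1 h2

include h2 in
/-- The formal Demazure operators are approximated by the Demazure operators on `Sym Λ`. -/
lemma S.demazure_sub_symHom_mem (i : ι) {k : ℕ} {u : S F P} {f : SymmetricAlgebra ℤ Λ}
    (hf : f ∈ (LinearMap.range (SymmetricAlgebra.ι ℤ Λ)) ^ (k + 1))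
    (hu : u - S.symHom F P f ∈ S.filt F P (k + 2)) :
    S.demazure F P i u - S.symHom F P (symDemazure P i f) ∈ S.filt F P (k + 1) := by
  refine S.mem_filt_of_xRoot_mul_mem F h2 (i := i) ?_
  have h1 := S.smul_mem_filt (RootPairing.weylGroup.ofIdx P i) hu
  have h3 := S.smul_symHom_sub_mem (P := P) F i hf
  have h4 := S.mul_mem_filt F P (S.x_sub_symHom_ι_mem F (P := P) (P.root i))
    (S.symHom_mem_filt F (P := P) (symDemazure_mem_pow (P := P) i k hf))
  have h5 := congrArg (S.symHom F P) (symDemazure_spec (P := P) i f)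
  rw [map_mul, map_sub] at h5
  rw [mul_sub, S.demazure_spec F h2]
  rw [smul_sub] at h1
  rw [sub_mul, h5, add_comm] at h4
  convert! sub_mem (sub_mem (sub_mem hu h1) h3) h4 using 1
  rw [S.xRoot]
  ring

end FormalDemazure
end FormalHecke
end

noncomputable section

namespace FormalHecke

/-! ### Roots divisible by 2 force a component of type C_l^sc. -/

section DivisibleRoot

variable {ι Λ Λv : Type*} [AddCommGroup Λ] [AddCommGroup Λv] {P : RootPairing ι ℤ Λ Λv}
variable (b : P.Base) [Finite ι] [P.IsReduced]

/-- The positive roots `E j = a 0 + 2 a 1 + ⋯ + 2 a j`, `j ≤ m`, attached to a chain of simple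
roots, where `a (j + 1)` is the only simple root besides `a 0, …, a j` which is not orthogonal to
`E j`. -/
structure IsDoublingChain (m : ℕ) (a : ℕ → b.support) (E : ℕ → ι) : Prop where
  zero : E 0 = a 0
  root_succ : ∀ j < m, P.root (E (j + 1)) = P.root (E j) + (2 : ℤ) • P.root (a (j + 1))
  coroot_succ : ∀ j < m, P.coroot (E (j + 1)) = P.coroot (E j) + P.coroot (a (j + 1))
  inj : ∀ i j, i ≤ m → j ≤ m → a i = a j → i = j
  pairing_succ : ∀ j < m, P.pairing (E j) (a (j + 1)) = -2
  pairing_succ' : ∀ j < m, P.pairing (a (j + 1)) (E j) = -1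
  pairing_other : ∀ j < m, ∀ k : b.support, (∀ i ≤ j, k ≠ a i) → k ≠ a (j + 1) →
    P.pairing (E j) k = 0

omit [P.IsReduced] [Finite ι] in
lemma pairing_add_zsmul {i j k : ι} {c : ℤ} (h : P.root i = P.root j + c • P.root k) (l : ι) :
    P.pairing i l = P.pairing j l + c * P.pairing k l := by
  rw [← P.root_coroot_eq_pairing, h, map_add, map_smul]
  rfl

omit [P.IsReduced] [Finite ι] in
lemma pairing_coroot_add {i j k : ι} (h : P.coroot i = P.coroot j + P.coroot k) (l : ι) :
    P.pairing l i = P.pairing l j + P.pairing l k := by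
  rw [← P.root_coroot_eq_pairing, h, map_add]
  rfl

variable {b}

omit [P.IsReduced] in
lemma pairing_nonpos_of_ne {i j : b.support} (h : i ≠ j) : P.pairing i j ≤ 0 := by
  have := b.pairingIn_le_zero_of_ne (fun h' => h (Subtype.ext h')) i.2 j.2
  rwa [← P.algebraMap_pairingIn ℤ]

/-- Divisibility by 2 makes the first pairing even. Among the pairs of pairings in a reduced
crystallographic system with nonpositive even first entry, only (-2, -2) remains to be excluded; it
would make the roots opposite, which positivity forbids. -/
lemma pairing_of_even {i j : ι} (hi : b.IsPos i) (hj : b.IsPos j)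
    (he : ∃ x, P.root i = x + x) (h : P.pairing i j ≤ 0) :
    P.pairing i j = 0 ∨ P.pairing i j = -2 ∧ P.pairing j i = -1 := by
  obtain ⟨x, hx⟩ := he
  have h1 : P.pairing i j = 2 * P.toLinearMap x (P.coroot j) := by
    rw [← P.root_coroot_eq_pairing, hx, map_add, two_mul]; rfl
  have h2 := P.pairingIn_pairingIn_mem_set_of_isCrystal_of_isRed i j
  have h4 : ∀ k l, P.pairingIn ℤ k l = P.pairing k l := fun k l => P.algebraMap_pairingIn ℤ k l
  have h3 : ¬ (P.pairing i j = -2 ∧ P.pairing j i = -2) := by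
    intro h3
    have h5 : P.root i = -P.root j := by
      by_contra hne
      have hne' : P.root i ≠ P.root j := by
        intro he
        rw [P.root.injective he, P.pairing_same] at h3
        omega
      have h6 := P.pairingIn_pairingIn_mem_set_of_isCrystal_of_isRed' i j hne' hne
      rw [h4, h4, h3.1, h3.2] at h6
      simp at h6
    have h6 : P.reflectionPerm j j = i := P.root.injective (by
      rw [P.root_reflectionPerm, P.reflection_apply_self, h5])
    rw [← h6, isPos_neg_iff] at hi
    exact hi hj
  rw [h4, h4] at h2
  simp only [Set.mem_insert_iff, Set.mem_singleton_iff, Prod.mk.injEq] at h2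
  omega

namespace IsDoublingChain

variable {m : ℕ} {a : ℕ → b.support} {E : ℕ → ι} (h : IsDoublingChain b m a E)
include h

omit [P.IsReduced] [Finite ι] in
lemma isPos {j : ℕ} (hj : j ≤ m) : b.IsPos (E j) := by
  induction j with
  | zero => rw [h.zero]; exact RootPairing.Base.isPos_of_mem_support (a 0).2
  | succ j ih =>
    have h1 := b.height_add_zsmul (h.root_succ j hj)
    have h2 := ih (by omega)
    rw [RootPairing.Base.height_one_of_mem_support (a (j + 1)).2] at h1
    rw [RootPairing.Base.isPos_iff] at h2 ⊢
    simp at h1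
    omega

omit [P.IsReduced] [Finite ι] in
lemma exists_half (h0 : ∃ x, P.root (a 0) = x + x) {j : ℕ} (hj : j ≤ m) :
    ∃ x, P.root (E j) = x + x := by
  induction j with
  | zero => rw [h.zero]; exact h0
  | succ j ih =>
    obtain ⟨x, hx⟩ := ih (by omega)
    exact ⟨x + P.root (a (j + 1)), by rw [h.root_succ j hj, hx, two_smul]; abel⟩

omit [P.IsReduced] in
lemma pairing_nonpos {j : ℕ} (hj : j ≤ m) {k : b.support} (hk : ∀ i ≤ j, k ≠ a i) :
    P.pairing (E j) k ≤ 0 := by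
  induction j with
  | zero => rw [h.zero]; exact pairing_nonpos_of_ne (hk 0 le_rfl).symm
  | succ j ih =>
    have h1 := ih (by omega) fun i hi => hk i (by omega)
    have h2 := pairing_nonpos_of_ne (hk (j + 1) le_rfl).symm
    rw [pairing_add_zsmul (h.root_succ j hj)]
    omega

/-- Two different neighbours k and l would make E_m + 2 α_k + 2 α_l a positive root, whose pairings
with E_m are both -2. So the chain does not branch. -/
lemma eq_of_pairing_ne_zero (h0 : ∃ x, P.root (a 0) = x + x) {k l : b.support}
    (hk : ∀ i ≤ m, k ≠ a i) (hl : ∀ i ≤ m, l ≠ a i) (hkE : P.pairing (E m) k ≠ 0)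
    (hlE : P.pairing (E m) l ≠ 0) : l = k := by
  by_contra hne
  have hpk := RootPairing.Base.isPos_of_mem_support k.2
  have hpl := RootPairing.Base.isPos_of_mem_support l.2
  have hpE := h.isPos le_rfl
  have he := h.exists_half h0 le_rfl
  obtain ⟨h1, h1'⟩ := (pairing_of_even hpE hpk he (h.pairing_nonpos le_rfl hk)).resolve_left hkE
  obtain ⟨h2, h2'⟩ := (pairing_of_even hpE hpl he (h.pairing_nonpos le_rfl hl)).resolve_left hlE
  have h3 := pairing_nonpos_of_ne (P := P) hne
  have h3' := pairing_nonpos_of_ne (P := P) (Ne.symm hne)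
  set E1 := P.reflectionPerm k (E m) with hE1
  have hr1 : P.root E1 = P.root (E m) + (2 : ℤ) • P.root k := by
    rw [hE1, P.root_reflectionPerm, P.reflection_apply_root, h1, neg_smul, sub_neg_eq_add]
  have hc1 : P.coroot E1 = P.coroot (E m) + P.coroot k := by
    rw [hE1, P.coroot_reflectionPerm, P.coreflection_apply_coroot, h1', neg_smul, one_smul,
      sub_neg_eq_add]
  have hp1 : b.IsPos E1 := by
    have h4 := b.height_add_zsmul hr1
    rw [RootPairing.Base.height_one_of_mem_support k.2] at h4
    rw [RootPairing.Base.isPos_iff] at hpE ⊢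
    simp at h4
    omega
  have he1 : ∃ x, P.root E1 = x + x := by
    obtain ⟨x, hx⟩ := he
    exact ⟨x + P.root k, by rw [hr1, hx, two_smul]; abel⟩
  have h5 := pairing_add_zsmul hr1 l
  have h6 : P.pairing E1 l = -2 ∧ P.pairing l E1 = -1 := by
    refine (pairing_of_even hp1 hpl he1 (by omega)).resolve_left (by omega)
  have h7 := pairing_coroot_add hc1 l
  set E2 := P.reflectionPerm l E1 with hE2
  have hr2 : P.root E2 = P.root E1 + (2 : ℤ) • P.root l := by
    rw [hE2, P.root_reflectionPerm, P.reflection_apply_root, h6.1, neg_smul, sub_neg_eq_add]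
  have hc2 : P.coroot E2 = P.coroot E1 + P.coroot l := by
    rw [hE2, P.coroot_reflectionPerm, P.coreflection_apply_coroot, h6.2, neg_smul, one_smul,
      sub_neg_eq_add]
  have hp2 : b.IsPos E2 := by
    have h4 := b.height_add_zsmul hr2
    rw [RootPairing.Base.height_one_of_mem_support l.2] at h4
    rw [RootPairing.Base.isPos_iff] at hp1 ⊢
    simp at h4
    omega
  have h8 := pairing_add_zsmul hr2 (E m)
  have h9 := pairing_add_zsmul hr1 (E m)
  have h10 := pairing_coroot_add hc2 (E m)
  have h11 := pairing_coroot_add hc1 (E m)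
  rw [P.pairing_same] at h9 h11
  have h12 := pairing_of_even hpE hp2 he (by omega)
  omega

lemma succ (h0 : ∃ x, P.root (a 0) = x + x) {k : b.support}
    (hk : ∀ i ≤ m, k ≠ a i) (hkE : P.pairing (E m) k ≠ 0) :
    IsDoublingChain b (m + 1) (Function.update a (m + 1) k)
      (Function.update E (m + 1) (P.reflectionPerm k (E m))) := by
  obtain ⟨h1, h1'⟩ := (pairing_of_even (h.isPos le_rfl)
    (RootPairing.Base.isPos_of_mem_support k.2) (h.exists_half h0 le_rfl)
    (h.pairing_nonpos le_rfl hk)).resolve_left hkE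
  have ha : ∀ j ≤ m, Function.update a (m + 1) k j = a j := fun j hj =>
    Function.update_of_ne (by omega) ..
  have hE : ∀ j ≤ m, Function.update E (m + 1) (P.reflectionPerm k (E m)) j = E j := fun j hj =>
    Function.update_of_ne (by omega) ..
  have ha' : Function.update a (m + 1) k (m + 1) = k := Function.update_self ..
  have hE' : Function.update E (m + 1) (P.reflectionPerm k (E m)) (m + 1) =
    P.reflectionPerm k (E m) := Function.update_self ..
  have hcases : ∀ j < m + 1, j = m ∨ j < m := fun j hj => by omega
  refine ⟨?_, ?_, ?_, ?_, ?_, ?_, ?_⟩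
  · rw [ha 0 (by omega), hE 0 (by omega), h.zero]
  · intro j hj
    rcases hcases j hj with rfl | hj
    · rw [hE', ha', hE _ le_rfl, P.root_reflectionPerm, P.reflection_apply_root, h1, neg_smul,
        sub_neg_eq_add]
    · rw [hE _ hj, ha _ hj, hE _ hj.le, h.root_succ j hj]
  · intro j hj
    rcases hcases j hj with rfl | hj
    · rw [hE', ha', hE _ le_rfl, P.coroot_reflectionPerm, P.coreflection_apply_coroot, h1',
        neg_smul, one_smul, sub_neg_eq_add]
    · rw [hE _ hj, ha _ hj, hE _ hj.le, h.coroot_succ j hj]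
  · intro i j hi hj hij
    rcases Nat.lt_or_eq_of_le hi with hi | rfl <;> rcases Nat.lt_or_eq_of_le hj with hj | rfl
    · rw [ha _ (by omega), ha _ (by omega)] at hij
      exact h.inj i j (by omega) (by omega) hij
    · rw [ha _ (by omega), ha'] at hij
      exact absurd hij.symm (hk i (by omega))
    · rw [ha j (by omega), ha'] at hij
      exact absurd hij (hk j (by omega))
    · rfl
  · intro j hj
    rcases hcases j hj with rfl | hj
    · rw [ha', hE _ le_rfl, h1]
    · rw [ha _ hj, hE _ hj.le, h.pairing_succ j hj]
  · intro j hj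
    rcases hcases j hj with rfl | hj
    · rw [ha', hE _ le_rfl, h1']
    · rw [ha _ hj, hE _ hj.le, h.pairing_succ' j hj]
  · intro j hj l hl hl'
    rcases hcases j hj with rfl | hj
    · rw [hE _ le_rfl]
      rw [ha'] at hl'
      by_contra hne
      exact hl' (h.eq_of_pairing_ne_zero h0 hk (fun i hi => ha i hi ▸ hl i hi) hkE hne)
    · rw [hE _ hj.le]
      rw [ha _ hj] at hl'
      exact h.pairing_other j hj l (fun i hi => ha i (by omega) ▸ hl i hi) hl'

omit [Finite ι] [P.IsReduced] in
/-- The simple roots of a doubling chain which cannot be prolonged make up a component of type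
`C_l^{sc}`. -/
lemma hasComponentCsc [Module.Free ℤ Λ] (h0 : ∃ x, P.root (a 0) = x + x)
    (hend : ∀ k : b.support, (∀ i ≤ m, k ≠ a i) → P.pairing (E m) k = 0) :
    HasComponentCsc b := by
  have hne : ∀ i j, i ≤ m → j < i → a i ≠ a j := fun i j hi hj he =>
    hj.ne' (h.inj i j hi (by omega) he)
  have hB1 : ∀ j i, j < i → i ≤ m → P.pairing (a i) (E j) = if i = j + 1 then -1 else 0 := by
    intro j i hj hi
    split_ifs with hij
    · rw [hij]; exact h.pairing_succ' j (by omega)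
    · rw [P.pairing_eq_zero_iff]
      exact h.pairing_other j (by omega) (a i) (fun k hk => hne i k hi (by omega))
        (hne i (j + 1) hi (by omega))
  have hB : ∀ j i, j < i → i ≤ m → P.pairing (a i) (a j) = if i = j + 1 then -1 else 0 := by
    intro j i hj hi
    have h1 := hB1 j i hj hi
    cases j with
    | zero => rwa [h.zero] at h1
    | succ j =>
      rw [pairing_coroot_add (h.coroot_succ j (by omega)), hB1 j i (by omega) hi,
        if_neg (by omega), zero_add] at h1
      exact h1
  have hA1 : ∀ j i, j < i → i ≤ m → P.pairing (E j) (a i) = if i = j + 1 then -2 else 0 := by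
    intro j i hj hi
    split_ifs with hij
    · rw [hij]; exact h.pairing_succ j (by omega)
    · exact h.pairing_other j (by omega) (a i) (fun k hk => hne i k hi (by omega))
        (hne i (j + 1) hi (by omega))
  have hC : ∀ j i, j < i → i ≤ m →
      P.pairing (a j) (a i) = if i = j + 1 then (if j = 0 then -2 else -1) else 0 := by
    intro j i hj hi
    have h1 := hA1 j i hj hi
    cases j with
    | zero => rw [h.zero] at h1; rw [h1, if_pos rfl]
    | succ j =>
      rw [pairing_add_zsmul (h.root_succ j (by omega)), hA1 j i (by omega) hi,
        if_neg (by omega), zero_add] at h1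
      rw [if_neg (Nat.succ_ne_zero j)]
      split_ifs at h1 ⊢ <;> omega
  have hA2 : ∀ j ≤ m, P.pairing (E j) (a j) = 2 := by
    intro j hj
    cases j with
    | zero => rw [h.zero, P.pairing_same]
    | succ j =>
      rw [pairing_add_zsmul (h.root_succ j hj), h.pairing_succ j hj, P.pairing_same]
      norm_num
  have hA3 : ∀ j ≤ m, ∀ i < j, P.pairing (E j) (a i) = 0 := by
    intro j
    induction j with
    | zero => intro _ i hi; omega
    | succ j ih =>
      intro hj i hi
      rw [pairing_add_zsmul (h.root_succ j hj), hB i (j + 1) hi hj]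
      rcases Nat.lt_succ_iff_lt_or_eq.1 hi with hi' | rfl
      · rw [ih (by omega) i hi', if_neg (by omega)]; norm_num
      · rw [hA2 i (by omega), if_pos rfl]; norm_num
  -- In the coordinates of type C the E_j are the long roots 2ε. Their halves pair with the simple
  -- coroots as differences of consecutive indicator functions.
  have hA : ∀ j ≤ m, ∀ i ≤ m, P.pairing (E j) (a i) =
      2 * ((if i = j then 1 else 0) - (if i = j + 1 then 1 else 0)) := by
    intro j hj i hi
    rcases lt_trichotomy i j with hij | rfl | hij
    · rw [hA3 j hj i hij, if_neg (by omega), if_neg (by omega)]; norm_num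
    · rw [hA2 i hj, if_pos rfl, if_neg (by omega)]; norm_num
    · rw [hA1 j i hij hi]; split_ifs <;> omega
  have hout : ∀ k : b.support, (∀ i ≤ m, k ≠ a i) → ∀ j ≤ m, P.pairing (E j) k = 0 := by
    intro k hk j hj
    rcases Nat.lt_or_eq_of_le hj with hj | rfl
    · exact h.pairing_other j hj k (fun i hi => hk i (by omega)) (hk _ hj)
    · exact hend k hk
  have hout' : ∀ k : b.support, (∀ i ≤ m, k ≠ a i) → ∀ j ≤ m, P.pairing (a j) k = 0 := by
    intro k hk j hj
    have h1 := hout k hk j hj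
    cases j with
    | zero => rwa [h.zero] at h1
    | succ j =>
      rw [pairing_add_zsmul (h.root_succ j hj), hout k hk j (by omega)] at h1
      omega
  have hmu : ∀ j, ∃ x, j ≤ m → P.root (E j) = x + x := by
    intro j
    by_cases hj : j ≤ m
    · obtain ⟨x, hx⟩ := h.exists_half h0 hj
      exact ⟨x, fun _ => hx⟩
    · exact ⟨0, fun h => absurd h hj⟩
  choose x hx using hmu
  have hxp : ∀ j ≤ m, ∀ k : b.support, 2 * P.toLinearMap (x j) (P.coroot k) =
      P.pairing (E j) k := by
    intro j hj k
    rw [← P.root_coroot_eq_pairing, hx j hj, map_add, two_mul]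
    rfl
  -- `CartanMatrix.C` has its long simple root in the last place, while the chain starts with it, so
  -- the numbering is reversed.
  let f : Fin (m + 1) ↪ b.support := ⟨fun i => a (m - i), fun i j hij => by
    have := h.inj _ _ (by omega) (by omega) hij
    have := i.2
    have := j.2
    ext
    omega⟩
  have hf : ∀ i, f i = a (m - i) := fun _ => rfl
  have hfout : ∀ k : b.support, k ∉ Set.range f → ∀ i ≤ m, k ≠ a i := by
    rintro k hk i hi rfl
    refine hk ⟨⟨m - i, by omega⟩, ?_⟩
    rw [hf]
    congr 1
    dsimp
    omega
  refine ⟨m + 1, by omega, f, ?_, ?_, ?_⟩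
  · intro i j
    have hi := i.2
    have hj := j.2
    rw [hf, hf, CartanMatrix.C, Matrix.of_apply, Nat.add_sub_cancel]
    simp only [Fin.ext_iff]
    rcases lt_trichotomy (i : ℕ) j with hij | hij | hij
    · rw [hB _ _ (by omega) (by omega)]
      split_ifs <;> omega
    · rw [hij, P.pairing_same, if_pos rfl]
    · rw [hC _ _ (by omega) (by omega)]
      split_ifs <;> omega
  · intro i k hk
    exact hout' k (hfout k hk) _ (by omega)
  -- The fundamental weight is the sum of the halves of E_{m-i}, ..., E_m, that is, ε_1 + ... +
  -- ε_{i+1}; its pairings with the coroots of the chain telescope.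
  · refine ⟨fun i => ∑ j ∈ Finset.range (i + 1), x (m - i + j), ?_⟩
    have key : ∀ (i : Fin (m + 1)) (k : b.support), 2 * P.toLinearMap
        (∑ j ∈ Finset.range (i + 1), x (m - i + j)) (P.coroot k) =
        ∑ j ∈ Finset.range (i + 1), P.pairing (E (m - i + j)) k := by
      intro i k
      rw [map_sum, LinearMap.sum_apply, Finset.mul_sum]
      refine Finset.sum_congr rfl fun j hj => ?_
      rw [Finset.mem_range] at hj
      exact hxp _ (by have := i.2; omega) k
    have key' : ∀ (i : Fin (m + 1)) (l : ℕ), l ≤ m → P.toLinearMap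
        (∑ j ∈ Finset.range (i + 1), x (m - i + j)) (P.coroot (a l)) =
        if l = m - i then 1 else 0 := by
      intro i l hl
      have h1 := key i (a l)
      have h2 : ∑ j ∈ Finset.range (i + 1), P.pairing (E (m - i + j)) (a l) =
          2 * ∑ j ∈ Finset.range (i + 1), ((fun j => if l = m - i + j then (1 : ℤ) else 0) j -
            (fun j => if l = m - i + j then (1 : ℤ) else 0) (j + 1)) := by
        rw [Finset.mul_sum]
        refine Finset.sum_congr rfl fun j hj => ?_
        rw [Finset.mem_range] at hj
        exact hA _ (by have := i.2; omega) l hl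
      rw [h2, Finset.sum_range_sub'] at h1
      have h3 := mul_left_cancel₀ two_ne_zero h1
      rw [h3]
      have := i.2
      split_ifs <;> omega
    intro i
    have hi := i.2
    refine ⟨?_, fun k hk => ?_⟩
    · rw [hf]
      exact (key' i _ (by omega)).trans (if_pos rfl)
    · by_cases hk' : k ∈ Set.range f
      · obtain ⟨i', rfl⟩ := hk'
        have hi' := i'.2
        rw [hf]
        refine (key' i _ (by omega)).trans (if_neg fun he => hk ?_)
        congr 1
        ext
        omega
      · have h1 := key i k
        rw [Finset.sum_eq_zero fun j hj => hout k (hfout k hk') _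
          (by rw [Finset.mem_range] at hj; omega)] at h1
        exact (mul_eq_zero.1 h1).resolve_left two_ne_zero

end IsDoublingChain

/-- If a root is divisible by `2`, then there is a component of type `C_l^{sc}`. -/
theorem hasComponentCsc_of_root_eq_add_self [Module.Free ℤ Λ] {i : ι} (h : ∃ x, P.root i = x + x) :
    HasComponentCsc b := by
  classical
  have h1 : ∀ i j, (∃ x, P.root i = x + x) → ∃ x, P.root (P.reflectionPerm j i) = x + x := by
    rintro i j ⟨x, hx⟩
    exact ⟨P.reflection j x, by rw [P.root_reflectionPerm, hx, map_add]⟩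
  -- Divisibility by 2 is invariant under reflections, so it passes to a simple root.
  obtain ⟨i, h0⟩ : ∃ i : b.support, ∃ x, P.root i = x + x := by
    revert h
    refine b.induction_reflect i (p := fun i => (∃ x, P.root i = x + x) → _) ?_ ?_ ?_
    · intro i ih h
      refine ih ?_
      have := h1 _ i h
      rwa [P.reflectionPerm_self] at this
    · exact fun i hi h => ⟨⟨i, hi⟩, h⟩
    · intro i j ih _ h
      refine ih ?_
      have := h1 _ j h
      rwa [P.reflectionPerm_self] at this
  by_contra hC
  -- Without such a component every chain can be prolonged, which contradicts the finiteness of the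
  -- set of simple roots.
  have key : ∀ m, ∃ a E, IsDoublingChain b m a E ∧ ∃ x, P.root (a 0) = x + x := by
    intro m
    induction m with
    | zero =>
      refine ⟨fun _ => i, fun _ => i, ⟨rfl, ?_, ?_, ?_, ?_, ?_, ?_⟩, h0⟩ <;> intros <;> omega
    | succ m ih =>
      obtain ⟨a, E, hch, h0⟩ := ih
      by_cases hend : ∀ k : b.support, (∀ i ≤ m, k ≠ a i) → P.pairing (E m) k = 0
      · exact absurd (hch.hasComponentCsc h0 hend) hC
      · push Not at hend
        obtain ⟨k, hk, hkE⟩ := hend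
        refine ⟨_, _, hch.succ h0 hk hkE, ?_⟩
        rwa [Function.update_of_ne (by omega)]
  obtain ⟨a, E, hch, -⟩ := key (Nat.card b.support)
  have h2 : Function.Injective fun i : Fin (Nat.card b.support + 1) => a i := fun i j hij =>
    Fin.ext (hch.inj i j (by omega) (by omega) hij)
  have h3 := Nat.card_le_card_of_injective _ h2
  rw [Nat.card_fin] at h3
  omega

end DivisibleRoot

end FormalHecke
end

noncomputable section

namespace FormalHecke

/-! ### Where the torsion index is attained. -/

section TorsionIndex

variable {ι Λ Λv : Type*} [AddCommGroup Λ] [AddCommGroup Λv] {P : RootPairing ι ℤ Λ Λv}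
variable (b : P.Base) [Module.Free ℤ Λ]

/-- The torsion index is, up to sign, attained. -/
lemma exists_symDemazureWord_eq_torsionIndex (J : List b.support) :
    ∃ d : ℤ, d.natAbs = torsionIndex b J ∧
      ∃ u ∈ (LinearMap.range (SymmetricAlgebra.ι ℤ Λ)) ^ J.length,
        symDemazureWord b J u = algebraMap ℤ (SymmetricAlgebra ℤ Λ) d := by
  refine ⟨_, rfl, ?_⟩
  suffices hs : ∀ x ∈ Ideal.span {d : ℤ |
    ∃ u ∈ (LinearMap.range (SymmetricAlgebra.ι ℤ Λ)) ^ J.length,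
      symDemazureWord b J u = algebraMap ℤ (SymmetricAlgebra ℤ Λ) d},
      ∃ u ∈ (LinearMap.range (SymmetricAlgebra.ι ℤ Λ)) ^ J.length,
        symDemazureWord b J u = algebraMap ℤ (SymmetricAlgebra ℤ Λ) x from
    hs _ (Submodule.IsPrincipal.generator_mem _)
  intro x h
  induction h using Submodule.span_induction with
  | mem x hx => exact hx
  | zero => exact ⟨0, zero_mem _, by simpa using symDemazureWord_zsmul b J 0 0⟩
  | add x y _ _ hx hy =>
    obtain ⟨u, hu, hu'⟩ := hx
    obtain ⟨v, hv, hv'⟩ := hy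
    exact ⟨u + v, add_mem hu hv, by rw [symDemazureWord_add, hu', hv', map_add]⟩
  | smul c x _ hx =>
    obtain ⟨u, hu, hu'⟩ := hx
    refine ⟨c • u, Submodule.smul_mem _ c hu, ?_⟩
    rw [symDemazureWord_zsmul, hu', smul_eq_mul, map_mul, Algebra.smul_def]

lemma symDemazureWord_mem_pow (J : List b.support) (n : ℕ) {u : SymmetricAlgebra ℤ Λ}
    (hu : u ∈ (LinearMap.range (SymmetricAlgebra.ι ℤ Λ)) ^ (n + J.length)) :
    symDemazureWord b J u ∈ (LinearMap.range (SymmetricAlgebra.ι ℤ Λ)) ^ n := by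
  induction J generalizing n with
  | nil => exact hu
  | cons i J ih =>
    rw [symDemazureWord_cons]
    refine symDemazure_mem_pow (P := P) i n (ih (n + 1) ?_)
    rwa [List.length_cons, show n + (J.length + 1) = n + 1 + J.length by omega] at hu

end TorsionIndex

lemma FGA.exists_sub_algebraMap_mem_filt {R : Type*} [CommRing R] (F : FormalGroup R) [F.IsComm]
    {M σ : Type*} [AddCommGroup M] [Finite σ] (e : Module.Basis σ ℤ M) (u : FGA F M) :
    ∃ r : R, u - algebraMap R (FGA F M) r ∈ FGA.filt F M 1 := by
  refine ⟨MvPowerSeries.constantCoeff (FGA.equiv F e u), (FGA.mem_filt_iff F e).2 ?_⟩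
  rw [mem_orderIdeal_one, map_sub, map_sub, AlgEquiv.commutes, MvPowerSeries.algebraMap_apply,
    MvPowerSeries.constantCoeff_C]
  exact sub_self _

/-! ### The matrix of formal Demazure operators and Cramer's rule. -/

section DemazureMatrix

variable {R : Type*} [CommRing R] (F : FormalGroup R) [F.IsComm]
variable {ι Λ Λv : Type*} [AddCommGroup Λ] [AddCommGroup Λv] {P : RootPairing ι ℤ Λ Λv}
variable [Module.Free ℤ Λ] [Module.Finite ℤ Λ] (b : P.Base)

omit [F.IsComm] [Module.Free ℤ Λ] [Module.Finite ℤ Λ] in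
/-- The composite of the formal Demazure operators attached to a sequence of simple roots. -/
def S.demazureWord : List b.support → S F P → S F P
  | [], u => u
  | i :: J, u => S.demazure F P i (S.demazureWord J u)

variable (h2 : ∀ i, (∃ m : Λ, P.root i = m + m) → IsUnit (2 : R))

include h2 in
-- Each operator lowers both the degree of the leading term and the order of the error by one, so
-- the error stays one order above the leading term.
lemma S.demazureWord_sub_symHom_mem (J : List b.support) (n : ℕ) {u : S F P}
    {f : SymmetricAlgebra ℤ Λ}
    (hf : f ∈ (LinearMap.range (SymmetricAlgebra.ι ℤ Λ)) ^ (n + J.length))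
    (hu : u - S.symHom F P f ∈ S.filt F P (n + J.length + 1)) :
    S.demazureWord F b J u - S.symHom F P (symDemazureWord b J f) ∈ S.filt F P (n + 1) := by
  induction J generalizing n with
  | nil => exact hu
  | cons i J ih =>
    rw [symDemazureWord_cons, S.demazureWord]
    rw [List.length_cons, show n + (J.length + 1) = n + 1 + J.length by omega] at hf hu
    exact S.demazure_sub_symHom_mem F h2 i (symDemazureWord_mem_pow b J (n + 1) hf)
      (ih (n + 1) hf hu)

lemma S.exists_sub_algebraMap_mem_filt (u : S F P) :
    ∃ r : R, u - algebraMap R (S F P) r ∈ S.filt F P 1 :=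
  FGA.exists_sub_algebraMap_mem_filt F (Module.finBasis ℤ (ℤ × Λ)) u

omit [F.IsComm] [Module.Free ℤ Λ] [Module.Finite ℤ Λ] in
lemma S.demazureWord_append (J K : List b.support) (u : S F P) :
    S.demazureWord F b (J ++ K) u = S.demazureWord F b J (S.demazureWord F b K u) := by
  induction J with
  | nil => rfl
  | cons i J ih => rw [List.cons_append, S.demazureWord, S.demazureWord, ih]

variable [Finite ι] [P.IsReduced]

variable {b} {I : P.weylGroup → List b.support} (hI : ∀ w, IsReducedWord b w (I w))
variable {w₀ : P.weylGroup} (hw₀ : ∀ w, (I w).length ≤ (I w₀).length)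

omit [Module.Free ℤ Λ] [Module.Finite ℤ Λ] [P.IsReduced] in
include hI hw₀ in
lemma finite_weylGroup : Finite P.weylGroup := by
  have h1 : Finite {J : List b.support // J.length ≤ (I w₀).length} :=
    (List.finite_length_le _ _).to_subtype
  refine Finite.of_injective
    (fun w => (⟨I w, hw₀ w⟩ : {J : List b.support // J.length ≤ (I w₀).length})) fun w w' h => ?_
  have h : I w = I w' := congrArg Subtype.val h
  rw [← (hI w).1, ← (hI w').1, h]

include h2 hI hw₀ in
/-- Modulo the augmentation ideal, the matrix of the `Δ_{I_w} Δ_{I_v} u`, where `v` is replaced by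
`v⁻¹ w₀` and `u` lifts an element where the torsion index `±d` is attained, is triangular with
the torsion index on the diagonal. -/
lemma S.exists_demazureWord_sub_mem {d : ℤ} {f : SymmetricAlgebra ℤ Λ}
    (hf : f ∈ (LinearMap.range (SymmetricAlgebra.ι ℤ Λ)) ^ (I w₀).length)
    (hfd : symDemazureWord b (I w₀) f = algebraMap ℤ (SymmetricAlgebra ℤ Λ) d)
    (w v : P.weylGroup) : ∃ r : R,
      S.demazureWord F b (I w) (S.demazureWord F b (I (v⁻¹ * w₀)) (S.symHom F P f)) -
        algebraMap R (S F P) r ∈ S.filt F P 1 ∧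
      (weylLength b w ≤ weylLength b v → w ≠ v → r = 0) ∧ (w = v → r = d) := by
  have hmax : ∀ w, weylLength b w ≤ weylLength b w₀ := fun w => by
    rw [← (hI w).length_eq, ← (hI w₀).length_eq]; exact hw₀ w
  have hv := weylLength_inv_mul_add hmax v
  have hlen : (I w ++ I (v⁻¹ * w₀)).length = weylLength b w + weylLength b (v⁻¹ * w₀) := by
    rw [List.length_append, (hI _).length_eq, (hI _).length_eq]
  have hw0 := (hI w₀).length_eq
  have hprod : wordProd b (I w ++ I (v⁻¹ * w₀)) = w * v⁻¹ * w₀ := by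
    rw [wordProd_append, (hI _).1, (hI _).1, mul_assoc]
  rw [← S.demazureWord_append]
  by_cases hle : weylLength b w ≤ weylLength b v
  -- The word for the entry (w, v) has N - n letters, where N = ℓ(w₀); so n is the degree left over
  -- from f.
  · obtain ⟨n, hn⟩ := Nat.exists_eq_add_of_le hle
    have hlen' : (I w₀).length = n + (I w ++ I (v⁻¹ * w₀)).length := by omega
    rw [hlen'] at hf
    have h1 := S.demazureWord_sub_symHom_mem F b h2 (I w ++ I (v⁻¹ * w₀)) n hf
      (by rw [sub_self]; exact zero_mem _)
    have h3 := S.symHom_mem_filt F (P := P)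
      (symDemazureWord_mem_pow b (I w ++ I (v⁻¹ * w₀)) n hf)
    by_cases hwv : w = v
    · subst hwv
      rw [mul_inv_cancel, one_mul] at hprod
      refine ⟨d, ?_, fun _ h => absurd rfl h, fun _ => rfl⟩
      rw [symDemazureWord_eq_of_wordProd_eq b _ _ (I w₀) rfl (by omega)
        (hprod.trans (hI w₀).1.symm), hfd,
        AlgHom.commutes] at h1
      have hn0 : n = 0 := by omega
      rw [hn0] at h1
      simpa using h1
    · refine ⟨0, ?_, fun _ _ => rfl, fun h => absurd h hwv⟩
      rw [map_zero, sub_zero]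
      -- If n = 0, the word has N letters but its product w v⁻¹ w₀ has length N - ℓ(v w⁻¹) < N, so
      -- its operator vanishes on Sym Λ. If n > 0, the leading term has positive degree and lies in
      -- the augmentation ideal.
      rcases Nat.eq_zero_or_pos n with rfl | hn0
      · rw [symDemazureWord_eq_zero b, map_zero, sub_zero] at h1
        · exact h1
        · have h4 := weylLength_inv_mul_add hmax (v * w⁻¹)
          rw [mul_inv_rev, inv_inv] at h4
          have h5 : weylLength b (v * w⁻¹) ≠ 0 := by
            intro h6
            have h7 := eq_one_of_weylLength_eq_zero (hI _) h6
            exact hwv (mul_inv_eq_one.1 h7).symm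
          rw [hprod]
          omega
      · have h4 := add_mem (S.filt_anti F P (by omega) h1) (S.filt_anti F P hn0 h3)
        rwa [sub_add_cancel] at h4
  · obtain ⟨r, hr⟩ := S.exists_sub_algebraMap_mem_filt F
      (S.demazureWord F b (I w ++ I (v⁻¹ * w₀)) (S.symHom F P f))
    exact ⟨r, hr, fun h => absurd h hle, fun h => absurd (h ▸ le_rfl) hle⟩

omit [Finite ι] [P.IsReduced] in
-- The matrix is block triangular for the grading by l, and each diagonal block is the scalar matrix
-- d.
lemma isRegular_det_of_forall {n : Type*} [Fintype n] [DecidableEq n] (l : n → ℕ)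
    (m : Matrix n n R) {d : R} (hd : IsRegular d) (h0 : ∀ i j, l i ≤ l j → i ≠ j → m i j = 0)
    (h1 : ∀ i, m i i = d) : IsRegular m.det := by
  rw [← Matrix.det_transpose, Matrix.BlockTriangular.det (b := l)]
  · refine Finset.prod_induction _ IsRegular (fun _ _ h h' => h.mul h') isRegular_one fun a _ => ?_
    have : m.transpose.toSquareBlock l a = Matrix.diagonal fun _ => d := by
      ext i j
      rw [Matrix.toSquareBlock_def, Matrix.of_apply, Matrix.transpose_apply]
      by_cases h : i = j
      · rw [h, Matrix.diagonal_apply_eq, h1]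
      · rw [Matrix.diagonal_apply_ne _ h]
        exact h0 _ _ (j.2.trans i.2.symm).le fun h' => h (Subtype.ext h').symm
    rw [this, Matrix.det_diagonal, Finset.prod_const]
    exact hd.pow _
  · intro i j hij
    exact h0 j i hij.le (fun h => by rw [h] at hij; exact lt_irrefl _ hij)

include h2 hI hw₀ in
-- Testing on the elements Δ_{I_{v⁻¹w₀}} u₀ shows that x_α divides the row vector c times the
-- matrix. Multiplying by the adjugate, it divides det · c_w. The determinant has regular constant
-- term and can be cancelled.
lemma S.xRoot_dvd_of_forall_dvd_sum [Fintype P.weylGroup]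
    (ht : IsRegular ((torsionIndex b (I w₀) : ℕ) : R)) (i : ι)
    {c : P.weylGroup → S F P}
    (hc : ∀ u, S.xRoot F P i ∣ ∑ w, c w * S.demazureWord F b (I w) u) (w : P.weylGroup) :
    S.xRoot F P i ∣ c w := by
  classical
  obtain ⟨d, hd, f, hf, hfd⟩ := exists_symDemazureWord_eq_torsionIndex b (I w₀)
  have hdr : IsRegular (d : R) := by
    rw [← hd] at ht
    rcases Int.natAbs_eq d with h | h <;> rw [h]
    · rwa [Int.cast_natCast]
    · rw [Int.cast_neg, Int.cast_natCast]
      rw [neg_eq_neg_one_mul]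
      exact isUnit_one.neg.isRegular.mul ht
  choose r' hr hr0 hrd using S.exists_demazureWord_sub_mem F h2 hI hw₀ hf hfd
  let r : Matrix P.weylGroup P.weylGroup R := r'
  let m : Matrix P.weylGroup P.weylGroup (S F P) := fun w v =>
    S.demazureWord F b (I w) (S.demazureWord F b (I (v⁻¹ * w₀)) (S.symHom F P f))
  have hm : m.det - algebraMap R (S F P) (Matrix.det r) ∈ S.filt F P 1 := by
    rw [← Ideal.Quotient.eq, RingHom.map_det, RingHom.map_det (algebraMap R (S F P)),
      RingHom.map_det]
    congr 1
    ext w v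
    exact Ideal.Quotient.eq.2 (hr w v)
  have hdet : IsRegular (Matrix.det r) :=
    isRegular_det_of_forall (weylLength b) r hdr hr0 (fun w => hrd w w rfl)
  refine S.xRoot_dvd_of_dvd_mul F h2 hdet hm ?_
  have h1 : m.det * c w = (Matrix.vecMul (Matrix.vecMul c m) m.adjugate) w := by
    rw [Matrix.vecMul_vecMul, Matrix.mul_adjugate, Matrix.vecMul_smul, Matrix.vecMul_one]
    rfl
  rw [h1]
  exact Finset.dvd_sum fun v _ => Dvd.dvd.mul_right (hc _) _

include h2 in
omit [Finite ι] [P.IsReduced] in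
lemma S.isRegular_of_mem_rootSubmonoid {s : S F P} (hs : s ∈ rootSubmonoid F P) :
    IsRegular s := by
  induction hs using Submonoid.closure_induction with
  | mem x hx => obtain ⟨i, rfl⟩ := hx; exact S.isRegular_xRoot F h2 i
  | one => exact isRegular_one
  | mul x y _ _ hx hy => exact hx.mul hy

include h2 hI hw₀ in
-- The factors x_α of s are split off one at a time; regularity allows the hypothesis to be divided
-- by the factor already removed.
lemma S.dvd_of_forall_dvd_sum [Fintype P.weylGroup]
    (ht : IsRegular ((torsionIndex b (I w₀) : ℕ) : R)) {s : S F P} (hs : s ∈ rootSubmonoid F P)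
    {c : P.weylGroup → S F P}
    (hc : ∀ u, s ∣ ∑ w, c w * S.demazureWord F b (I w) u) (w : P.weylGroup) : s ∣ c w := by
  induction hs using Submonoid.closure_induction generalizing c w with
  | mem x hx =>
    obtain ⟨i, rfl⟩ := hx
    exact S.xRoot_dvd_of_forall_dvd_sum F h2 hI hw₀ ht i hc w
  | one => exact one_dvd _
  | mul x y hx hy ihx ihy =>
    choose d hd using fun w => ihx (fun u => (dvd_mul_right x y).trans (hc u)) w
    rw [hd]
    refine mul_dvd_mul_left x (ihy (fun u => ?_) w)
    obtain ⟨e, he⟩ := hc u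
    refine ⟨e, (S.isRegular_of_mem_rootSubmonoid F h2 hx).left ?_⟩
    dsimp only
    rw [← mul_assoc, ← he, Finset.mul_sum]
    exact Finset.sum_congr rfl fun w _ => by rw [hd w, mul_assoc]

end DemazureMatrix

end FormalHecke
end

noncomputable section

namespace FormalHecke

/-! ### Triangularity of products along reduced words, for the X and the T at once. -/

section TwistedWords

open SkewMonoidAlgebra

variable {R : Type*} [CommRing R] (F : FormalGroup R)
variable {ι Λ Λv : Type*} [AddCommGroup Λ] [AddCommGroup Λv] {P : RootPairing ι ℤ Λ Λv}
variable (b : P.Base)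

/-- The product of the `p_j + c_j δ_j` along a sequence of simple roots. -/
def twistedWord (p c : ι → Q F P) : List b.support → QW F P
  | [] => 1
  | j :: J => (single 1 (p j) + single (RootPairing.weylGroup.ofIdx P j) (c j)) *
      twistedWord p c J

lemma coeff_single_add_single_mul (p q : Q F P) (j : ι) (z : QW F P) (v : P.weylGroup) :
    ((single 1 p + single (RootPairing.weylGroup.ofIdx P j) q) * z).coeff v =
      p * z.coeff v + q * RootPairing.weylGroup.ofIdx P j •
        z.coeff (RootPairing.weylGroup.ofIdx P j * v) := by
  rw [add_mul, coeff_add, Finsupp.add_apply, coeff_single_mul, coeff_single_mul, inv_one, one_mul,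
    one_smul, inv_ofIdx]

lemma coeff_finset_sum {α : Type*} (s : Finset α) (f : α → QW F P) (v : P.weylGroup) :
    (∑ i ∈ s, f i).coeff v = ∑ i ∈ s, (f i).coeff v := by
  rw [← coeffAddEquiv_apply, _root_.map_sum, Finsupp.finsetSum_apply]
  rfl

variable [Finite ι] [P.IsReduced]

/-- The product over the inversions of `w` which appears as coefficient of `δ_w` in the product of
the `p_j + c_j δ_j` along a reduced sequence of `w`. -/
def leadingCoeff (c : ι → Q F P) (w : P.weylGroup) : Q F P :=
  ∏ i ∈ inversions b w, c (P.weylGroupToPerm w (P.reflectionPerm i i))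

omit [P.IsReduced] in
lemma leadingCoeff_one (c : ι → Q F P) : leadingCoeff F b c 1 = 1 := by
  rw [leadingCoeff, inversions_one, Finset.prod_empty]

variable {F b}

lemma leadingCoeff_ofIdx_mul {c : ι → Q F P}
    (hc : ∀ (w : P.weylGroup) i, w • c i = c (P.weylGroupToPerm w i)) {j : ι} (hj : j ∈ b.support)
    {w : P.weylGroup} (h : b.IsPos (P.weylGroupToPerm w⁻¹ j)) :
    leadingCoeff F b c (RootPairing.weylGroup.ofIdx P j * w) =
      c j * RootPairing.weylGroup.ofIdx P j • leadingCoeff F b c w := by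
  classical
  obtain ⟨h1, h2⟩ := inversions_ofIdx_mul hj h
  rw [leadingCoeff, h2, Finset.prod_insert h1, leadingCoeff, Finset.smul_prod', map_mul,
    Equiv.Perm.mul_apply, weylGroupToPerm_neg w, weylGroupToPerm_apply_inv, weylGroupToPerm_ofIdx,
    P.reflectionPerm_self]
  congr 1
  exact Finset.prod_congr rfl fun i _ => (hc _ _).symm

omit [P.IsReduced] [Finite ι] in
lemma weylGroup_ofIdx_mul_cancel (j : ι) (w : P.weylGroup) :
    RootPairing.weylGroup.ofIdx P j * (RootPairing.weylGroup.ofIdx P j * w) = w := by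
  rw [← mul_assoc, ofIdx_mul_self, one_mul]

lemma weylLength_ofIdx_mul_le (j : b.support) (w : P.weylGroup) :
    weylLength b (RootPairing.weylGroup.ofIdx P j * w) ≤ weylLength b w + 1 := by
  by_cases h : b.IsPos (P.weylGroupToPerm w⁻¹ j)
  · exact (weylLength_ofIdx_mul_of_isPos j.2 h).le
  · have := weylLength_of_not_isPos j.2 h
    omega

/-- Only products of subwords occur in the expansion, and a proper subword has a product of length
less than that of the word. -/
lemma coeff_twistedWord_eq_zero (p c : ι → Q F P) (J : List b.support) {v : P.weylGroup}
    (hv : v ≠ wordProd b J) (hl : J.length ≤ weylLength b v) :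
    (twistedWord F b p c J).coeff v = 0 := by
  classical
  induction J generalizing v with
  | nil =>
    rw [twistedWord, coeff_one, Finsupp.single_apply, if_neg]
    exact fun h => hv h.symm
  | cons j J ih =>
    rw [List.length_cons] at hl
    rw [wordProd_cons] at hv
    have h1 := weylLength_wordProd_le J
    have h3 := weylLength_ofIdx_mul_le j (RootPairing.weylGroup.ofIdx P j * v)
    rw [weylGroup_ofIdx_mul_cancel] at h3
    rw [twistedWord, coeff_single_add_single_mul, ih (v := v) (fun h => by rw [h] at hl; omega)
      (by omega), ih (fun h => hv (by rw [← h, weylGroup_ofIdx_mul_cancel])) (by omega), smul_zero,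
      mul_zero, mul_zero, add_zero]

lemma coeff_twistedWord_wordProd (p : ι → Q F P) {c : ι → Q F P}
    (hc : ∀ (w : P.weylGroup) i, w • c i = c (P.weylGroupToPerm w i)) (J : List b.support)
    (hJ : weylLength b (wordProd b J) = J.length) :
    (twistedWord F b p c J).coeff (wordProd b J) = leadingCoeff F b c (wordProd b J) := by
  induction J with
  | nil => rw [twistedWord, wordProd_nil, coeff_one, Finsupp.single_eq_same,
    leadingCoeff_one]
  | cons j J ih =>
    rw [wordProd_cons, List.length_cons] at hJ
    have h1 := weylLength_wordProd_le J
    have h2 := weylLength_ofIdx_mul_le j (wordProd b J)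
    have hpos : b.IsPos (P.weylGroupToPerm (wordProd b J)⁻¹ j) := by
      by_contra h
      have := weylLength_of_not_isPos j.2 h
      omega
    rw [wordProd_cons, twistedWord, coeff_single_add_single_mul, weylGroup_ofIdx_mul_cancel,
      ih (by omega), leadingCoeff_ofIdx_mul hc j.2 hpos, coeff_twistedWord_eq_zero, mul_zero,
      zero_add]
    · intro h
      rw [h] at hJ
      omega
    · omega

variable (b) in
/-- The coefficients of `z` are divisible by the leading coefficients. -/
def IsLeadingDivisible (c : ι → Q F P) (z : QW F P) : Prop :=
  ∀ v, leadingCoeff F b c v ∣ z.coeff v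

omit [P.IsReduced] in
lemma IsLeadingDivisible.one (c : ι → Q F P) : IsLeadingDivisible b c 1 := by
  classical
  intro v
  by_cases h : v = 1
  · rw [h, leadingCoeff_one]; exact one_dvd _
  · rw [coeff_one, Finsupp.single_apply, if_neg (Ne.symm h)]; exact dvd_zero _

omit [P.IsReduced] in
lemma IsLeadingDivisible.add {c : ι → Q F P} {z z' : QW F P} (h : IsLeadingDivisible b c z)
    (h' : IsLeadingDivisible b c z') : IsLeadingDivisible b c (z + z') := fun v => by
  rw [coeff_add, Finsupp.add_apply]
  exact dvd_add (h v) (h' v)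

omit [P.IsReduced] in
lemma IsLeadingDivisible.sub {c : ι → Q F P} {z z' : QW F P} (h : IsLeadingDivisible b c z)
    (h' : IsLeadingDivisible b c z') : IsLeadingDivisible b c (z - z') := fun v => by
  rw [coeff_sub, Finsupp.sub_apply]
  exact dvd_sub (h v) (h' v)

omit [P.IsReduced] in
lemma IsLeadingDivisible.single_one_mul {c : ι → Q F P} {z : QW F P}
    (h : IsLeadingDivisible b c z) (q : Q F P) : IsLeadingDivisible b c (single 1 q * z) :=
  fun v => by
    rw [coeff_single_one_mul]
    exact (h v).mul_left q

omit [P.IsReduced] in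
lemma IsLeadingDivisible.sum {c : ι → Q F P} {α : Type*} {s : Finset α} {f : α → QW F P}
    (h : ∀ i ∈ s, IsLeadingDivisible b c (f i)) : IsLeadingDivisible b c (∑ i ∈ s, f i) :=
  fun v => by
    rw [coeff_finset_sum]
    exact Finset.dvd_sum fun i hi => h i hi v

/-- At v the new contribution is c_j s_j(z_{s_j v}). If s_j v is longer than v, the leading
coefficient at s_j v is c_j s_j(that at v), and applying s_j recovers the one at v as a factor.
Otherwise the leading coefficient at v is c_j s_j(that at s_j v). -/
lemma IsLeadingDivisible.mul {c : ι → Q F P}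
    (hc : ∀ (w : P.weylGroup) i, w • c i = c (P.weylGroupToPerm w i)) {z : QW F P}
    (h : IsLeadingDivisible b c z) (p : Q F P) (j : b.support) :
    IsLeadingDivisible b c
      ((single 1 p + single (RootPairing.weylGroup.ofIdx P j) (c j)) * z) := by
  intro v
  rw [coeff_single_add_single_mul]
  refine dvd_add ((h v).mul_left p) ?_
  obtain ⟨e, he⟩ := h (RootPairing.weylGroup.ofIdx P j * v)
  rw [he, smul_mul', ← mul_assoc]
  refine Dvd.dvd.mul_right ?_ _
  by_cases hpos : b.IsPos (P.weylGroupToPerm v⁻¹ j)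
  · rw [leadingCoeff_ofIdx_mul hc j.2 hpos, smul_mul', ← mul_smul, ofIdx_mul_self, one_smul]
    exact dvd_mul_of_dvd_right (dvd_mul_left _ _) _
  · rw [← leadingCoeff_ofIdx_mul hc j.2, weylGroup_ofIdx_mul_cancel]
    rw [mul_inv_rev, inv_ofIdx, map_mul, Equiv.Perm.mul_apply, weylGroupToPerm_ofIdx,
      weylGroupToPerm_neg, isPos_neg_iff]
    exact hpos

lemma isLeadingDivisible_twistedWord (p : ι → Q F P) {c : ι → Q F P}
    (hc : ∀ (w : P.weylGroup) i, w • c i = c (P.weylGroupToPerm w i)) (J : List b.support) :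
    IsLeadingDivisible b c (twistedWord F b p c J) := by
  induction J with
  | nil => exact IsLeadingDivisible.one c
  | cons j J ih => exact ih.mul hc _ j

/-- The elements whose coefficients are divisible by the leading coefficients are linear
combinations of the products along reduced sequences. -/
theorem IsLeadingDivisible.exists_eq_sum [Fintype P.weylGroup] (p : ι → Q F P) {c : ι → Q F P}
    (hc : ∀ (w : P.weylGroup) i, w • c i = c (P.weylGroupToPerm w i))
    {I : P.weylGroup → List b.support} (hI : ∀ w, IsReducedWord b w (I w)) (n : ℕ) {z : QW F P}
    (hz : IsLeadingDivisible b c z) (hn : ∀ v, n ≤ weylLength b v → z.coeff v = 0) :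
    ∃ u : P.weylGroup → Q F P, (∀ w, n ≤ weylLength b w → u w = 0) ∧
      z = ∑ w, single 1 (u w) * twistedWord F b p c (I w) := by
  induction n generalizing z with
  | zero =>
    refine ⟨0, fun _ _ => rfl, ?_⟩
    have : z = 0 := ext fun v => hn v (Nat.zero_le _)
    rw [this]
    simp
  | succ n ih =>
    choose q hq using hz
    -- The quotients by the leading coefficients, restricted to length n: in this length the words
    -- do not interact, so subtracting their combination removes the whole top layer.
    let u : P.weylGroup → Q F P := fun w => if weylLength b w = n then q w else 0
    have h1 : ∀ v, n ≤ weylLength b v →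
        (z - ∑ w, single 1 (u w) * twistedWord F b p c (I w)).coeff v = 0 := by
      intro v hv
      have h2 : ∀ w, w ≠ v → (single 1 (u w) * twistedWord F b p c (I w)).coeff v = 0 := by
        intro w hw
        rw [coeff_single_one_mul]
        by_cases hwn : weylLength b w = n
        · rw [coeff_twistedWord_eq_zero, mul_zero]
          · rw [(hI w).1]; exact hw.symm
          · rw [(hI w).length_eq, hwn]; exact hv
        · simp only [u]
          rw [if_neg hwn, zero_mul]
      rw [coeff_sub, Finsupp.sub_apply, coeff_finset_sum, Finset.sum_eq_single v
        (fun w _ hw => h2 w hw) (fun h => absurd (Finset.mem_univ v) h), coeff_single_one_mul]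
      by_cases hvn : weylLength b v = n
      · have h3 := coeff_twistedWord_wordProd p hc (I v)
          (by rw [(hI v).1, (hI v).length_eq])
        rw [(hI v).1] at h3
        simp only [u]
        rw [if_pos hvn, h3, hq, mul_comm, sub_self]
      · rw [hn v (by omega)]
        simp only [u]
        rw [if_neg hvn, zero_mul, sub_zero]
    obtain ⟨u', hu', hu''⟩ := ih (z := z - ∑ w, single 1 (u w) * twistedWord F b p c (I w))
      (IsLeadingDivisible.sub (fun v => ⟨q v, hq v⟩) (IsLeadingDivisible.sum fun w _ =>
        (isLeadingDivisible_twistedWord p hc (I w)).single_one_mul _)) h1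
    refine ⟨u' + u, fun w hw => ?_, ?_⟩
    · rw [Pi.add_apply, hu' w (by omega), zero_add]
      exact if_neg (by omega)
    · rw [sub_eq_iff_eq_add] at hu''
      rw [hu'', ← Finset.sum_add_distrib]
      refine Finset.sum_congr rfl fun w _ => ?_
      rw [Pi.add_apply, single_add, add_mul]

end TwistedWords

end FormalHecke
end

noncomputable section

namespace FormalHecke

/-! ### The action on S and the two structure theorems. -/

section Action

open SkewMonoidAlgebra

variable {R : Type*} [CommRing R] (F : FormalGroup R)
variable {ι Λ Λv : Type*} [AddCommGroup Λ] [AddCommGroup Λv] {P : RootPairing ι ℤ Λ Λv}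

lemma act_add (z z' : QW F P) (u : Q F P) : act F P (z + z') u = act F P z u + act F P z' u :=
  sum_add_index' (fun _ => zero_mul _) fun _ _ _ => add_mul _ _ _

lemma act_zero (u : Q F P) : act F P 0 u = 0 := sum_zero_index

lemma act_single (w : P.weylGroup) (q u : Q F P) : act F P (single w q) u = q * w • u :=
  sum_single_index (zero_mul _)

lemma act_neg (z : QW F P) (u : Q F P) : act F P (-z) u = -act F P z u := by
  rw [eq_neg_iff_add_eq_zero, ← act_add, neg_add_cancel, act_zero]

lemma act_sub (z z' : QW F P) (u : Q F P) : act F P (z - z') u = act F P z u - act F P z' u := by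
  rw [sub_eq_add_neg, act_add, act_neg, ← sub_eq_add_neg]

lemma act_sum {α : Type*} (s : Finset α) (f : α → QW F P) (u : Q F P) :
    act F P (∑ i ∈ s, f i) u = ∑ i ∈ s, act F P (f i) u := by
  classical
  induction s using Finset.induction_on with
  | empty => exact act_zero F u
  | insert i s hi ih => rw [Finset.sum_insert hi, Finset.sum_insert hi, act_add, ih]

lemma act_mul (z z' : QW F P) (u : Q F P) : act F P (z * z') u = act F P z (act F P z' u) := by
  induction z using SkewMonoidAlgebra.induction_on' with
  | single w q =>
    induction z' using SkewMonoidAlgebra.induction_on' with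
    | single w' q' =>
      rw [single_mul_single, act_single, act_single, act_single, smul_mul', mul_smul, mul_assoc]
    | add f g hf hg =>
      rw [mul_add, act_add, hf, hg, act_add, act_single, act_single, act_single, smul_add, mul_add]
  | add f g hf hg => rw [add_mul, act_add, hf, hg, act_add]

lemma act_one (u : Q F P) : act F P 1 u = u := by
  rw [one_def, act_single, one_smul, one_mul]

lemma act_ofS (s : S F P) (u : Q F P) : act F P (ofS F P s) u = algebraMap _ _ s * u := by
  rw [ofS, act_single, one_smul]

lemma algebraMap_xRoot_mul_invRoot (i : ι) :
    algebraMap (S F P) (Q F P) (S.xRoot F P i) * invRoot F P i = 1 := by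
  rw [invRoot]
  exact (IsLocalization.mk'_spec' (Q F P) (1 : S F P)
    (⟨S.xRoot F P i, Submonoid.subset_closure ⟨i, rfl⟩⟩ : rootSubmonoid F P)).trans (map_one _)

lemma smul_invRoot (w : P.weylGroup) (i : ι) :
    w • invRoot F P i = invRoot F P (P.weylGroupToPerm w i) := by
  have h1 : w • (algebraMap (S F P) (Q F P) (S.xRoot F P i) * invRoot F P i) = w • (1 : Q F P) :=
    congrArg _ (algebraMap_xRoot_mul_invRoot F i)
  rw [smul_mul', Q.smul_algebraMap, S.smul_xRoot, smul_one] at h1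
  exact left_inv_eq_right_inv ((mul_comm _ _).trans h1) (algebraMap_xRoot_mul_invRoot F _)

lemma smul_xGamma (w : P.weylGroup) : w • S.xGamma F P = S.xGamma F P := by
  refine (S.smul_x F P w (1, 0)).trans ?_
  rw [smul_zero, S.xGamma]

/-- The coefficient `1 - x_γ / x_α` of `δ_α` in `T_α`. -/
def heckeCoeff (i : ι) : Q F P := 1 - algebraMap (S F P) (Q F P) (S.xGamma F P) * invRoot F P i

lemma smul_heckeCoeff (w : P.weylGroup) (i : ι) :
    w • heckeCoeff F (P := P) i = heckeCoeff F (P.weylGroupToPerm w i) := by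
  rw [heckeCoeff, smul_sub, smul_one, smul_mul', Q.smul_algebraMap, smul_xGamma, smul_invRoot, heckeCoeff]

lemma smul_neg_invRoot (w : P.weylGroup) (i : ι) :
    w • (-invRoot F P i) = -invRoot F P (P.weylGroupToPerm w i) := by
  rw [smul_neg, smul_invRoot]

lemma XElt_eq (i : ι) : XElt F P i =
    single 1 (invRoot F P i) + single (RootPairing.weylGroup.ofIdx P i) (-invRoot F P i) := by
  rw [XElt, deltaElt, single_mul_single, one_mul, one_smul, mul_one, single_neg, ← sub_eq_add_neg]

lemma TElt_eq (i : ι) : TElt F P i =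
    single 1 (algebraMap (S F P) (Q F P) (S.xGamma F P) * invRoot F P i) +
      single (RootPairing.weylGroup.ofIdx P i) (heckeCoeff F i) := by
  rw [TElt, XElt_eq, ofS, deltaElt, mul_add, single_mul_single, single_mul_single, one_mul, one_mul,
    one_smul, one_smul, add_assoc, ← single_add, heckeCoeff]
  congr 2
  ring

/-- This form shows that T_α preserves S, since X_α does. -/
lemma TElt_eq_one_add (i : ι) : TElt F P i =
    1 + ofS F P (S.xGamma F P - S.xRoot F P i) * XElt F P i := by
  have h := algebraMap_xRoot_mul_invRoot F (P := P) i
  rw [TElt_eq, XElt_eq, ofS, mul_add, single_mul_single, single_mul_single, one_mul, one_mul,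
    one_smul, one_smul, one_def, ← add_assoc, ← single_add, heckeCoeff, map_sub]
  congr 2
  · linear_combination h
  · linear_combination -h

variable (b : P.Base)

/-- `X_I = X_{i_1} ⋯ X_{i_k}`. -/
abbrev XWord (J : List b.support) : QW F P :=
  twistedWord F b (invRoot F P) (fun i => -invRoot F P i) J

lemma XWord_cons (j : b.support) (J : List b.support) :
    XWord F b (j :: J) = XElt F P j * XWord F b J := by
  rw [XElt_eq]; rfl

lemma TWord_eq (J : List b.support) : TWord F b J = twistedWord F b
    (fun i => algebraMap (S F P) (Q F P) (S.xGamma F P) * invRoot F P i) (heckeCoeff F) J := by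
  induction J with
  | nil => rfl
  | cons j J ih =>
    have h : TWord F b (j :: J) = TElt F P j * TWord F b J := List.prod_cons
    rw [h, ih, TElt_eq]
    rfl

variable {F} in
lemma PreservesS.add {z z' : QW F P} (h : PreservesS F z) (h' : PreservesS F z') :
    PreservesS F (z + z') := fun u => by
  obtain ⟨v, hv⟩ := h u
  obtain ⟨v', hv'⟩ := h' u
  exact ⟨v + v', by rw [act_add, map_add, hv, hv']⟩

variable {F} in
lemma PreservesS.sub {z z' : QW F P} (h : PreservesS F z) (h' : PreservesS F z') :
    PreservesS F (z - z') := fun u => by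
  obtain ⟨v, hv⟩ := h u
  obtain ⟨v', hv'⟩ := h' u
  exact ⟨v - v', by rw [act_sub, map_sub, hv, hv']⟩

variable {F} in
lemma PreservesS.mul {z z' : QW F P} (h : PreservesS F z) (h' : PreservesS F z') :
    PreservesS F (z * z') := fun u => by
  obtain ⟨v', hv'⟩ := h' u
  rw [act_mul, ← hv']
  exact h v'

lemma PreservesS.one : PreservesS F (1 : QW F P) := fun u => ⟨u, (act_one F _).symm⟩

lemma PreservesS.ofS (s : S F P) : PreservesS F (ofS F P s) :=
  fun u => ⟨s * u, by rw [act_ofS, map_mul]⟩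

variable [F.IsComm] [Module.Free ℤ Λ] [Module.Finite ℤ Λ]
variable (h2 : ∀ i, (∃ m : Λ, P.root i = m + m) → IsUnit (2 : R))

include h2 in
lemma act_XElt (i : ι) (u : S F P) : act F P (XElt F P i) (algebraMap _ _ u) =
    algebraMap _ _ (S.demazure F P i u) := by
  have h1 := congrArg (algebraMap (S F P) (Q F P)) (S.demazure_spec F h2 i u)
  have h3 := algebraMap_xRoot_mul_invRoot F (P := P) i
  rw [map_mul, map_sub] at h1
  rw [XElt_eq, act_add, act_single, act_single, one_smul, Q.smul_algebraMap]
  linear_combination (-invRoot F P i) * h1 +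
    (algebraMap (S F P) (Q F P) (S.demazure F P i u)) * h3

include h2 in
lemma act_XWord (J : List b.support) (u : S F P) : act F P (XWord F b J) (algebraMap _ _ u) =
    algebraMap _ _ (S.demazureWord F b J u) := by
  induction J with
  | nil => exact act_one F _
  | cons j J ih => rw [XWord_cons, act_mul, ih, act_XElt F h2, S.demazureWord]

include h2 in
lemma PreservesS.XElt (i : ι) : PreservesS F (XElt F P i) :=
  fun u => ⟨_, (act_XElt F h2 i u).symm⟩

include h2 in
lemma PreservesS.TElt (i : ι) : PreservesS F (TElt F P i) := by
  rw [TElt_eq_one_add]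
  exact (PreservesS.one F).add ((PreservesS.ofS F _).mul (PreservesS.XElt F h2 i))

include h2 in
lemma PreservesS.of_mem_demazureAlgebra {z : QW F P} (hz : z ∈ demazureAlgebra F b) :
    PreservesS F z := by
  induction hz using Algebra.adjoin_induction with
  | mem z hz =>
    rcases hz with ⟨s, rfl⟩ | ⟨i, rfl⟩
    · exact PreservesS.ofS F s
    · exact PreservesS.XElt F h2 i
  | algebraMap r => exact PreservesS.ofS F _
  | add _ _ _ _ h h' => exact h.add h'
  | mul _ _ _ _ h h' => exact h.mul h'

include h2 in
lemma PreservesS.of_mem_heckeAlgebra {z : QW F P} (hz : z ∈ heckeAlgebra F b) :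
    PreservesS F z := by
  induction hz using Algebra.adjoin_induction with
  | mem z hz =>
    rcases hz with ⟨s, rfl⟩ | ⟨i, rfl⟩
    · exact PreservesS.ofS F s
    · exact PreservesS.TElt F h2 i
  | algebraMap r => exact PreservesS.ofS F _
  | add _ _ _ _ h h' => exact h.add h'
  | mul _ _ _ _ h h' => exact h.mul h'

omit [F.IsComm] [Module.Free ℤ Λ] [Module.Finite ℤ Λ] in
lemma ofS_mem_heckeAlgebra (s : S F P) : ofS F P s ∈ heckeAlgebra F b :=
  Algebra.subset_adjoin (Or.inl ⟨s, rfl⟩)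

omit [F.IsComm] [Module.Free ℤ Λ] [Module.Finite ℤ Λ] in
lemma TWord_mem_heckeAlgebra (J : List b.support) : TWord F b J ∈ heckeAlgebra F b := by
  induction J with
  | nil => exact one_mem _
  | cons j J ih =>
    have h : TWord F b (j :: J) = TElt F P j * TWord F b J := List.prod_cons
    rw [h]
    exact mul_mem (Algebra.subset_adjoin (Or.inr ⟨j, rfl⟩)) ih

omit [F.IsComm] [Module.Free ℤ Λ] [Module.Finite ℤ Λ] in
lemma XWord_mem_demazureAlgebra (J : List b.support) : XWord F b J ∈ demazureAlgebra F b := by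
  induction J with
  | nil => exact one_mem _
  | cons j J ih =>
    rw [XWord_cons]
    exact mul_mem (Algebra.subset_adjoin (Or.inr ⟨j, rfl⟩)) ih

include h2 in
lemma injective_algebraMap_Q : Function.Injective (algebraMap (S F P) (Q F P)) :=
  IsLocalization.injective _ fun _ hs =>
    isRegular_iff_mem_nonZeroDivisors.1 (S.isRegular_of_mem_rootSubmonoid F h2 hs)

omit [F.IsComm] [Module.Free ℤ Λ] [Module.Finite ℤ Λ] in
lemma isUnit_algebraMap_of_mem {s : S F P} (hs : s ∈ rootSubmonoid F P) :
    IsUnit (algebraMap (S F P) (Q F P) s) :=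
  IsLocalization.map_units (Q F P) (⟨s, hs⟩ : rootSubmonoid F P)

include h2 in
lemma S.xGamma_sub_xRoot_dvd_of_dvd_mul_of_mem {i : ι} {s u : S F P}
    (hs : s ∈ rootSubmonoid F P) (h : S.xGamma F P - S.xRoot F P i ∣ s * u) :
    S.xGamma F P - S.xRoot F P i ∣ u := by
  induction hs using Submonoid.closure_induction generalizing u with
  | mem x hx => obtain ⟨j, rfl⟩ := hx; exact S.xGamma_sub_xRoot_dvd_of_dvd_mul F h2 h
  | one => rwa [one_mul] at h
  | mul x y _ _ hx hy => rw [mul_assoc] at h; exact hy (hx h)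

include h2 in
-- Write q = s/c with c a product of elements x_β. Then c d = (x_γ - x_α) s for some d in S; x_γ -
-- x_α can be cancelled against c in the divisibility, so it divides d, and regularity gives c ∣ s.
lemma mem_range_of_mul_xGamma_sub_xRoot_mem {q : Q F P} {i : ι}
    (h : q * algebraMap (S F P) (Q F P) (S.xGamma F P - S.xRoot F P i) ∈
      Set.range (algebraMap (S F P) (Q F P))) : q ∈ Set.range (algebraMap (S F P) (Q F P)) := by
  obtain ⟨d, hd⟩ := h
  obtain ⟨⟨s, c⟩, hc⟩ := IsLocalization.surj (rootSubmonoid F P) q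
  dsimp only at hc
  have h1 : (c : S F P) * d = (S.xGamma F P - S.xRoot F P i) * s := by
    refine injective_algebraMap_Q F h2 ?_
    rw [map_mul, map_mul, ← hc, hd]
    ring
  obtain ⟨e, rfl⟩ := S.xGamma_sub_xRoot_dvd_of_dvd_mul_of_mem F h2 c.2 ⟨s, h1⟩
  refine ⟨e, ?_⟩
  have h3 : (c : S F P) * e = s := by
    refine (S.isRegular_xGamma_sub_xRoot F (P := P) i).left ?_
    dsimp only
    rw [← h1]
    ring
  refine (isUnit_algebraMap_of_mem F c.2).mul_right_cancel ?_
  rw [hc, ← map_mul, mul_comm, h3]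

include h2 in
lemma mem_range_of_mul_prod_mem {α : Type*} (s : Finset α) (f : α → ι) {q : Q F P}
    (h : q * ∏ k ∈ s, algebraMap (S F P) (Q F P) (S.xGamma F P - S.xRoot F P (f k)) ∈
      Set.range (algebraMap (S F P) (Q F P))) : q ∈ Set.range (algebraMap (S F P) (Q F P)) := by
  classical
  induction s using Finset.induction_on generalizing q with
  | empty => rwa [Finset.prod_empty, mul_one] at h
  | insert i s hi ih =>
    rw [Finset.prod_insert hi, ← mul_assoc] at h
    exact mem_range_of_mul_xGamma_sub_xRoot_mem F h2 (ih h)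

variable [Finite ι] [P.IsReduced]

include h2 in
omit [P.IsReduced] in
/-- If `u` times the leading coefficient of `T_{I_w}` is an element of `S` times the leading
coefficient of `X_{I_w}`, then `u` is in `S`. -/
lemma mem_range_of_mul_leadingCoeff_eq (w : P.weylGroup) {u : Q F P} {d : S F P}
    (h : u * leadingCoeff F b (heckeCoeff F) w =
      algebraMap _ _ d * leadingCoeff F b (fun i => -invRoot F P i) w) :
    u ∈ Set.range (algebraMap (S F P) (Q F P)) := by
  have key : ∀ i, heckeCoeff F i * -algebraMap (S F P) (Q F P) (S.xRoot F P i) =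
      algebraMap (S F P) (Q F P) (S.xGamma F P - S.xRoot F P i) := fun i => by
    rw [heckeCoeff, map_sub]
    linear_combination (algebraMap (S F P) (Q F P) (S.xGamma F P)) *
      algebraMap_xRoot_mul_invRoot F (P := P) i
  have key' : ∀ i, -invRoot F P i * -algebraMap (S F P) (Q F P) (S.xRoot F P i) = 1 := fun i => by
    rw [neg_mul_neg, mul_comm, algebraMap_xRoot_mul_invRoot]
  refine mem_range_of_mul_prod_mem F h2 (inversions b w)
    (fun i => P.weylGroupToPerm w (P.reflectionPerm i i)) ⟨d, ?_⟩
  simp only [← key]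
  rw [Finset.prod_mul_distrib, ← mul_assoc]
  refine Eq.trans ?_ (congrArg (· * _) h.symm)
  rw [leadingCoeff, mul_assoc, ← Finset.prod_mul_distrib, Finset.prod_congr rfl fun i _ => key' _,
    Finset.prod_const_one, mul_one]

omit [F.IsComm] [Module.Free ℤ Λ] [Module.Finite ℤ Λ] [P.IsReduced] in
-- The leading coefficients of the X_{I_w} are products of elements -1/x_β, hence units of Q; so
-- every element of Q_W is a combination of the X_{I_w}.
lemma isLeadingDivisible_neg_invRoot (z : QW F P) :
    IsLeadingDivisible b (fun i => -invRoot F P i) z := fun v => by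
  refine IsUnit.dvd (IsUnit.of_mul_eq_one (∏ i ∈ inversions b v, -algebraMap (S F P) (Q F P)
    (S.xRoot F P (P.weylGroupToPerm v (P.reflectionPerm i i)))) ?_)
  rw [leadingCoeff, ← Finset.prod_mul_distrib]
  refine Finset.prod_eq_one fun i _ => ?_
  rw [neg_mul_neg, mul_comm, algebraMap_xRoot_mul_invRoot]

variable {b} {I : P.weylGroup → List b.support} (hI : ∀ w, IsReducedWord b w (I w))
variable {w₀ : P.weylGroup} (hw₀ : ∀ w, (I w).length ≤ (I w₀).length)

include h2 hI hw₀ in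
/-- The coefficients in terms of the `X_{I_w}` of an element which preserves `S` are in `S`. -/
theorem PreservesS.mem_range [Fintype P.weylGroup]
    (ht : IsRegular ((torsionIndex b (I w₀) : ℕ) : R)) {q : P.weylGroup → Q F P}
    (h : PreservesS F (∑ w, SkewMonoidAlgebra.single 1 (q w) * XWord F b (I w)))
    (w : P.weylGroup) : q w ∈ Set.range (algebraMap (S F P) (Q F P)) := by
  -- Over a common denominator s, the claim becomes that s divides every numerator.
  obtain ⟨s, hs⟩ := IsLocalization.exist_integer_multiples_of_finite (rootSubmonoid F P) q
  choose c hc using hs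
  have hdvd : ∀ u, (s : S F P) ∣ ∑ w, c w * S.demazureWord F b (I w) u := by
    intro u
    obtain ⟨e, he⟩ := h u
    refine ⟨e, injective_algebraMap_Q F h2 ?_⟩
    rw [map_mul, he, act_sum, _root_.map_sum, Finset.mul_sum]
    refine Finset.sum_congr rfl fun w _ => ?_
    rw [map_mul, hc, act_mul, act_XWord F b h2, act_single, one_smul, Algebra.smul_def, mul_assoc]
  obtain ⟨d, hd⟩ := S.dvd_of_forall_dvd_sum F h2 hI hw₀ ht s.2 hdvd w
  refine ⟨d, (isUnit_algebraMap_of_mem F s.2).mul_left_cancel ?_⟩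
  rw [← map_mul, ← hd, hc, Algebra.smul_def]

include h2 hI hw₀ in
theorem mem_demazureAlgebra_iff (ht : IsRegular ((torsionIndex b (I w₀) : ℕ) : R)) (z : QW F P) :
    z ∈ demazureAlgebra F b ↔ PreservesS F z := by
  refine ⟨PreservesS.of_mem_demazureAlgebra F b h2, fun hz => ?_⟩
  have := finite_weylGroup hI hw₀
  have := Fintype.ofFinite P.weylGroup
  obtain ⟨q, -, rfl⟩ := (isLeadingDivisible_neg_invRoot F b z).exists_eq_sum (invRoot F P)
    (smul_neg_invRoot F) hI ((I w₀).length + 1) fun v hv => by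
      rw [← (hI v).length_eq] at hv
      exact absurd (hw₀ v) (by omega)
  refine sum_mem fun w _ => ?_
  obtain ⟨d, hd⟩ := PreservesS.mem_range F h2 hI hw₀ ht hz w
  rw [← hd]
  exact mul_mem (Algebra.subset_adjoin (Or.inl ⟨d, rfl⟩)) (XWord_mem_demazureAlgebra F b _)

omit [F.IsComm] [Module.Free ℤ Λ] [Module.Finite ℤ Λ] in
variable (b) in
-- The induction is on left multiplication: each generator preserves leading divisibility of
-- whatever stands to its right, and this property passes to sums and products.
lemma IsLeadingDivisible.of_mem_heckeAlgebra {z : QW F P} (hz : z ∈ heckeAlgebra F b) :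
    IsLeadingDivisible b (heckeCoeff F) z := by
  suffices h : ∀ m, IsLeadingDivisible b (heckeCoeff F) m →
      IsLeadingDivisible b (heckeCoeff F) (z * m) by
    have := h 1 (IsLeadingDivisible.one _)
    rwa [mul_one] at this
  induction hz using Algebra.adjoin_induction with
  | mem z hz =>
    rcases hz with ⟨s, rfl⟩ | ⟨i, rfl⟩
    · exact fun m hm => hm.single_one_mul _
    · intro m hm
      dsimp only
      rw [TElt_eq]
      exact hm.mul (smul_heckeCoeff F) _ i
  | algebraMap r => exact fun m hm => hm.single_one_mul _
  | add _ _ _ _ h h' => intro m hm; rw [add_mul]; exact (h m hm).add (h' m hm)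
  | mul _ _ _ _ h h' => intro m hm; rw [mul_assoc]; exact h _ (h' m hm)

include h2 hI hw₀ in
-- Only the coefficients u_w of maximal length are compared directly with the X-expansion; those of
-- smaller length are reached after subtracting the top terms, which lie in the Hecke algebra and
-- keep both hypotheses.
lemma mem_heckeAlgebra_of_preservesS (ht : IsRegular ((torsionIndex b (I w₀) : ℕ) : R)) (n : ℕ)
    {z : QW F P} (hz : PreservesS F z) (hd : IsLeadingDivisible b (heckeCoeff F) z)
    (hn : ∀ v, n ≤ weylLength b v → z.coeff v = 0) : z ∈ heckeAlgebra F b := by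
  induction n generalizing z with
  | zero =>
    rw [SkewMonoidAlgebra.ext (p := z) (q := 0) fun v => hn v (Nat.zero_le _)]
    exact zero_mem _
  | succ n ih =>
    have := finite_weylGroup hI hw₀
    have := Fintype.ofFinite P.weylGroup
    obtain ⟨q, hq, hzq⟩ := (isLeadingDivisible_neg_invRoot F b z).exists_eq_sum (invRoot F P)
      (smul_neg_invRoot F) hI (n + 1) hn
    have hqS := fun w => PreservesS.mem_range F h2 hI hw₀ ht (hzq ▸ hz) w
    obtain ⟨u, hu, hzu⟩ := hd.exists_eq_sum
      (fun i => algebraMap (S F P) (Q F P) (S.xGamma F P) * invRoot F P i)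
      (smul_heckeCoeff F) hI (n + 1) hn
    have htop : ∀ (p c : ι → Q F P) (_ : ∀ (w : P.weylGroup) i, w • c i =
        c (P.weylGroupToPerm w i)) (a : P.weylGroup → Q F P)
        (_ : ∀ w, n + 1 ≤ weylLength b w → a w = 0) (w : P.weylGroup) (_ : weylLength b w = n),
        (∑ v, SkewMonoidAlgebra.single 1 (a v) * twistedWord F b p c (I v)).coeff w =
          a w * leadingCoeff F b c w := by
      intro p c hc a ha w hw
      rw [coeff_finset_sum, Finset.sum_eq_single w]
      · have h3 := coeff_twistedWord_wordProd p hc (I w) (by rw [(hI w).1, (hI w).length_eq])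
        rw [(hI w).1] at h3
        rw [SkewMonoidAlgebra.coeff_single_one_mul, h3]
      · intro v _ hv
        rw [SkewMonoidAlgebra.coeff_single_one_mul]
        by_cases hvn : n + 1 ≤ weylLength b v
        · rw [ha v hvn, zero_mul]
        · rw [coeff_twistedWord_eq_zero, mul_zero]
          · rw [(hI v).1]; exact hv.symm
          · rw [(hI v).length_eq]; omega
      · exact fun h => absurd (Finset.mem_univ w) h
    -- At an element w of top length the coefficient of δ_w in z is q_w times the X-leading
    -- coefficient and also u_w times the T-leading one. Since q_w ∈ S, the factors x_γ - x_β can be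
    -- cancelled from u_w ∏ (x_γ - x_β).
    have huS : ∀ w, weylLength b w = n → u w ∈ Set.range (algebraMap (S F P) (Q F P)) := by
      intro w hw
      obtain ⟨d, hd⟩ := hqS w
      refine mem_range_of_mul_leadingCoeff_eq F b h2 w (d := d) ?_
      rw [hd, ← htop _ _ (smul_heckeCoeff F) u hu w hw, ← hzu,
        ← htop _ _ (smul_neg_invRoot F) q hq w hw, ← hzq]
    -- The value 0 off length n restricts the subtracted combination to the top layer.
    let a : P.weylGroup → S F P := fun w => if h : weylLength b w = n then (huS w h).choose else 0
    have ha : ∀ w, weylLength b w = n → algebraMap (S F P) (Q F P) (a w) = u w := fun w hw => by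
      simp only [a]
      rw [dif_pos hw]
      exact (huS w hw).choose_spec
    have ha0 : ∀ w, weylLength b w ≠ n → a w = 0 := fun w hw => dif_neg hw
    have hmem : ∑ w, ofS F P (a w) * TWord F b (I w) ∈ heckeAlgebra F b :=
      sum_mem fun w _ => mul_mem (ofS_mem_heckeAlgebra F b _) (TWord_mem_heckeAlgebra F b _)
    rw [← sub_add_cancel z (∑ w, ofS F P (a w) * TWord F b (I w))]
    refine add_mem (ih (hz.sub (PreservesS.of_mem_heckeAlgebra F b h2 hmem))
      (hd.sub (IsLeadingDivisible.of_mem_heckeAlgebra F b hmem)) fun v hv => ?_) hmem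
    have hsum : ∑ w, ofS F P (a w) * TWord F b (I w) =
        ∑ w, SkewMonoidAlgebra.single 1 (algebraMap (S F P) (Q F P) (a w)) * twistedWord F b
          (fun i => algebraMap (S F P) (Q F P) (S.xGamma F P) * invRoot F P i)
          (heckeCoeff F) (I w) :=
      Finset.sum_congr rfl fun w _ => by rw [TWord_eq]; rfl
    rw [SkewMonoidAlgebra.coeff_sub, Finsupp.sub_apply, hsum]
    by_cases hvn : weylLength b v = n
    · rw [htop _ _ (smul_heckeCoeff F) (fun w => algebraMap (S F P) (Q F P) (a w))
        (fun w hw => by rw [ha0 w (by omega), map_zero]) v hvn,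
        ha v hvn, ← htop _ _ (smul_heckeCoeff F) u hu v hvn, ← hzu, sub_self]
    · rw [hn v (by omega), coeff_finset_sum, Finset.sum_eq_zero, sub_zero]
      intro w _
      rw [SkewMonoidAlgebra.coeff_single_one_mul]
      by_cases hwn : weylLength b w = n
      · rw [coeff_twistedWord_eq_zero, mul_zero]
        · rw [(hI w).1]
          rintro rfl
          exact hvn hwn
        · rw [(hI w).length_eq]; omega
      · rw [ha0 w hwn, map_zero, zero_mul]

include h2 hI hw₀ in
theorem mem_heckeAlgebra_iff (ht : IsRegular ((torsionIndex b (I w₀) : ℕ) : R)) (z : QW F P) :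
    z ∈ heckeAlgebra F b ↔ (∃ u : P.weylGroup →₀ Q F P,
      z = u.sum fun w q => SkewMonoidAlgebra.single 1 q * TWord F b (I w)) ∧ PreservesS F z := by
  have hlen : ∀ v, (I w₀).length + 1 ≤ weylLength b v → z.coeff v = 0 := fun v hv => by
    rw [← (hI v).length_eq] at hv
    exact absurd (hw₀ v) (by omega)
  constructor
  · intro hz
    refine ⟨?_, PreservesS.of_mem_heckeAlgebra F b h2 hz⟩
    have := finite_weylGroup hI hw₀
    have := Fintype.ofFinite P.weylGroup
    obtain ⟨u, -, hu⟩ := (IsLeadingDivisible.of_mem_heckeAlgebra F b hz).exists_eq_sum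
      (fun i => algebraMap (S F P) (Q F P) (S.xGamma F P) * invRoot F P i)
      (smul_heckeCoeff F) hI _ hlen
    refine ⟨Finsupp.equivFunOnFinite.symm u, ?_⟩
    rw [Finsupp.sum_fintype _ _ fun w => by rw [SkewMonoidAlgebra.single_zero, zero_mul], hu]
    exact Finset.sum_congr rfl fun w _ => by rw [TWord_eq]; rfl
  · rintro ⟨⟨u, hu⟩, hz⟩
    refine mem_heckeAlgebra_of_preservesS F h2 hI hw₀ ht _ hz ?_ hlen
    rw [hu]
    exact IsLeadingDivisible.sum fun w _ => (IsLeadingDivisible.of_mem_heckeAlgebra F b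
      (TWord_mem_heckeAlgebra F b (I w))).single_one_mul _

end Action

end FormalHecke
end

theorem mainTheorem4 {R : Type*} [CommRing R] (F : FormalGroup R) [F.IsComm]
    {ι Λ Λv : Type*} [Finite ι] [AddCommGroup Λ] [Module.Free ℤ Λ] [Module.Finite ℤ Λ]
    [AddCommGroup Λv] (P : RootPairing ι ℤ Λ Λv) [P.IsReduced]
    (hss : FormalHecke.IsSemisimple P) (b : P.Base)
    -- a choice of reduced sequences, and the longest element of the Weyl group
    (I : P.weylGroup → List b.support) (hI : ∀ w, FormalHecke.IsReducedWord b w (I w))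
    (w₀ : P.weylGroup) (hw₀ : ∀ w, (I w).length ≤ (I w₀).length)
    (ht : IsRegular ((FormalHecke.torsionIndex b (I w₀) : ℕ) : R))
    (hC : FormalHecke.HasComponentCsc b → IsUnit (2 : R)) :
    (FormalHecke.demazureAlgebra F b : Set (FormalHecke.QW F P)) =
        {z | FormalHecke.PreservesS F z} ∧
      (FormalHecke.heckeAlgebra F b : Set (FormalHecke.QW F P)) =
        {z | (∃ u : P.weylGroup →₀ FormalHecke.Q F P,
            z = u.sum fun w q => SkewMonoidAlgebra.single 1 q * FormalHecke.TWord F b (I w)) ∧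
          FormalHecke.PreservesS F z} := by
  have h2 : ∀ i, (∃ m : Λ, P.root i = m + m) → IsUnit (2 : R) := fun i hi =>
    hC (FormalHecke.hasComponentCsc_of_root_eq_add_self hi)
  exact ⟨Set.ext fun z => FormalHecke.mem_demazureAlgebra_iff F h2 hI hw₀ ht z,
    Set.ext fun z => FormalHecke.mem_heckeAlgebra_iff F h2 hI hw₀ ht z⟩
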